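/- Let $(I,\mathbb A,m)$ be a measure space with $m(I)<\infty$, and write $|J|=m(J)$. Let $0<\lambda_1<\lambda_2<1$ and let $\mathcal P=(\mathcal P^k)_{k\ge 0}$ be a $(\lambda_1,\lambda_2)$-good grid: each $\mathcal P^k$ is a finite family of pairwise disjoint measurable sets of positive measure that cover $I$ up to a null set, no set belongs to two different levels, $\mathcal P^0=\{I\}$, every $Q\in\mathcal P^{k+1}$ is contained in some $P\in\mathcal P^{k}$, $\lambda_1\le |Q|/|P|\le\lambda_2$ whenever $Q\in\mathcal P^{k+1}$, $P\in\mathcal P^k$, $Q\subset P$, and $\bigcup_k\mathcal P^k$ generates $\mathbb A$. Let $s>0$, $p\in[1,\infty)$, $q\in[1,\infty]$; for $q=\infty$ the outer sums below are replaced by suprema. Functions $f:I\to\mathbb C$ are identified when they agree almost everywhere. **Souza's atoms.** A Souza atom on $Q\in\mathcal P$ is a function $a_Q:I\to\mathbb C$ that vanishes off $Q$, is constant on $Q$, and satisfies $|a_Q|_\infty\le|Q|^{s-1/p}$. The space $\mathcal B^s_{p,q}$ consists of all $f\in L^p$ that are sums of an absolutely convergent series in $L^p$, $f=\sum_k\sum_{Q\in\mathcal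 P^k}c_Qa_Q$ (that is, $\sum_k|\sum_{Q\in\mathcal P^k}c_Qa_Q|_p<\infty$), with Souza atoms $a_Q$, coefficients $c_Q\in\mathbb C$, and finite cost $\big(\sum_k(\sum_{Q\in\mathcal P^k}|c_Q|^p)^{q/p}\big)^{1/q}$. Let $|f|_{\mathcal B^s_{p,q}}$ be the infimum of the costs of all such series ($\infty$ if there is none). **Haar coefficients.** For $Q\in\mathcal P^k$ let the children of $Q$ be the elements of $\mathcal P^{k+1}$ contained in $Q$. For a finite family $T=\{R_1,\dots,R_n\}$, $n\ge2$, with an arbitrarily chosen ordering, cut it into $\{R_1,\dots,R_{[n/2]}\}$ and $\{R_{[n/2]+1},\dots,R_n\}$. Let $\mathcal H_Q$ be the set of all pairs $S=(S_1,S_2)$ obtained by cutting the family of children of $Q$, and then cutting repeatedly all resulting families that have at least two elements. With $|S_i|=\sum_{P\in S_i}|P|$ put $$\phi_S=\Big(\frac1{|S_1|}+\frac1{|S_2|}\Big)^{-1/2}\Big(\frac{\sum_{P\in S_1}1_P}{|S_1|}-\frac{\sum_{P\in S_2}1_P}{|S_2|}\Big),\qquad \phi_I=\frac{1_I}{|I|^{1/2}},$$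 $d_S^f=\int f\phi_S\,dm$, $d_I^f=\int f\phi_I\,dm$, and $$N_{haar}(f)=|I|^{1/p-s-1/2}|d_I^f|+\Big(\sum_k\Big(\sum_{Q\in\mathcal P^k}|Q|^{1-sp-p/2}\sum_{S\in\mathcal H_Q}|d_S^f|^p\Big)^{q/p}\Big)^{1/q}.$$ **Standard atomic representation.** Put $k_I^f=|I|^{1/p-s-1/2}d_I^f$ and, for a child $P$ of $Q$ and any $x_P\in P$, $k_P^f=|P|^{-(s-1/p)}\sum_{S\in\mathcal H_Q}d_S^f\phi_S(x_P)$; let $$N_{st}(f)=|k_I^f|+\Big(\sum_{k\ge1}\Big(\sum_{Q\in\mathcal P^k}|k_Q^f|^p\Big)^{q/p}\Big)^{1/q}.$$ **Mean oscillation.** With $osc_p(f,Q)=\inf_{c\in\mathbb C}(\int_Q|f-c|^p\,dm)^{1/p}$ let $$N_{osc}(f)=|I|^{-s}|f|_p+\Big(\sum_k\Big(\sum_{Q\in\mathcal P^k}|Q|^{-sp}osc_p(f,Q)^p\Big)^{q/p}\Big)^{1/q}.$$ **Theorem 13.1.** $\mathcal B^s_{p,q}$ is a complex linear subspace of $L^1$.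 For every $f\in L^1$, each of $|f|_{\mathcal B^s_{p,q}}$, $N_{st}(f)$, $N_{haar}(f)$, $N_{osc}(f)$ is finite if and only if $f\in\mathcal B^s_{p,q}$. The four quantities are norms on $\mathcal B^s_{p,q}$, and they are equivalent: for every $f\in L^1$ (with values in $[0,\infty]$) $$|f|_{\mathcal B^s_{p,q}}\le N_{st}(f),\quad N_{st}(f)\le C_{st}N_{haar}(f),\quad N_{haar}(f)\le C_{w}N_{osc}(f),\quad N_{osc}(f)\le C_{o}|f|_{\mathcal B^s_{p,q}},$$ where $$C_w=\frac{\lambda_2^{1/2}}{\sqrt2\,\lambda_1^{3/2}}+1,\qquad C_{st}=1+C_w\max\{\lambda_2^{1/p-s},\lambda_1^{1/p-s}\}\,\lambda_1^{-2-1/p},$$ $$C_o=M^{1+1/p}\,C\,|I|^{-s}+\frac1{1-\lambda_2^s}<\infty .$$ Here $M=\sup_k\sup_{Q\in\mathcal P^k}\#\{P\in\mathcal P^k: P\cap Q\ne\emptyset\}$ and, with $|\mathcal P^k|=\max_{Q\in\mathcal P^k}|Q|$, $C=\big(\sum_k|\mathcal P^k|^{sq'}\big)^{1/q'}$, $1/q+1/q'=1$,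 if $q>1$, and $C=\sup_k|\mathcal P^k|^{s}$ if $q=1$. -/

import Mathlib

open MeasureTheory Filter Topology
open scoped ENNReal

noncomputable section

namespace GridBesov

/-- A grid on a measure space `(I, m)`: a sequence of finite families of measurable sets of positive
measure, not all of them empty, for which the number of elements of one level that meet a given
element of the same level is bounded, and such that no set belongs to two different levels. -/
structure Grid {I : Type*} [MeasurableSpace I] (m : Measure I) where
  /-- the family of cells of level `k` -/
  cells : ℕ → Finset (Set I)
  measurableSet_of_mem : ∀ k, ∀ Q ∈ cells k, MeasurableSet Q
  measure_pos : ∀ k, ∀ Q ∈ cells k, 0 < m Q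
  exists_nonempty : ∃ k, (cells k).Nonempty
  overlap_lt_top :
    (⨆ k, ⨆ Q ∈ cells k, (({P ∈ (cells k : Set (Set I)) | (P ∩ Q).Nonempty}.encard : ℕ∞) : ℝ≥0∞)) < ∞
  ne_of_ne : ∀ i j, i ≠ j → ∀ P ∈ cells i, ∀ Q ∈ cells j, P ≠ Q

variable {I : Type*} [MeasurableSpace I] {m : Measure I}

/-- The largest number of cells of one level that meet a given cell of that level. -/
def Grid.overlap (G : Grid m) : ℝ≥0∞ :=
  ⨆ k, ⨆ Q ∈ G.cells k,
    (({P ∈ (G.cells k : Set (Set I)) | (P ∩ Q).Nonempty}.encard : ℕ∞) : ℝ≥0∞)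

/-- The largest measure `|P^k|` of a cell of level `k`. -/
def Grid.mesh (G : Grid m) (k : ℕ) : ℝ≥0∞ := ⨆ Q ∈ G.cells k, m Q

/-- A `(l₁, l₂)`-good grid. -/
structure Grid.IsGood (G : Grid m) (l₁ l₂ : ℝ) : Prop where
  pos : 0 < l₁
  lt : l₁ < l₂
  lt_one : l₂ < 1
  cells_zero : G.cells 0 = {Set.univ}
  cover : ∀ k, m (⋃ Q ∈ G.cells k, Q)ᶜ = 0
  disjoint : ∀ k, ∀ P ∈ G.cells k, ∀ Q ∈ G.cells k, P ≠ Q → Disjoint P Q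
  exists_parent : ∀ k, ∀ Q ∈ G.cells (k + 1), ∃ P ∈ G.cells k, Q ⊆ P
  ratio : ∀ k, ∀ Q ∈ G.cells (k + 1), ∀ P ∈ G.cells k, Q ⊆ P →
    l₁ ≤ m.real Q / m.real P ∧ m.real Q / m.real P ≤ l₂
  generate : ‹MeasurableSpace I› =
    MeasurableSpace.generateFrom (⋃ k, (G.cells k : Set (Set I)))

/-! ### Mixed sequence norms -/

/-- The `ℓ^q` norm, `1 ≤ q ≤ ∞`, of a sequence in `[0, ∞]`. -/
def lqNorm (q : ℝ≥0∞) (a : ℕ → ℝ≥0∞) : ℝ≥0∞ :=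
  if q = ∞ then ⨆ k, a k else (∑' k, a k ^ q.toReal) ^ (1 / q.toReal)

/-- The `ℓ^p` norm of a finite family in `[0, ∞]`. -/
def lpSum {ι : Type*} (p : ℝ) (F : Finset ι) (a : ι → ℝ≥0∞) : ℝ≥0∞ :=
  (∑ i ∈ F, a i ^ p) ^ (1 / p)

/-! ### The Besov space defined by Souza's atoms -/

/-- `(s, p)`-Souza's atoms supported on `Q`. -/
structure IsSouzaAtom (m : Measure I) (s p : ℝ) (Q : Set I) (a : I → ℂ) : Prop where
  eq_zero : ∀ x, x ∉ Q → a x = 0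
  const : ∃ c, ∀ x ∈ Q, a x = c
  norm_le : eLpNorm a ∞ m ≤ m Q ^ (s - 1 / p)

/-- The `k`-th block `∑_{Q ∈ P^k} c_Q a_Q` of an atomic series. -/
def Grid.block (G : Grid m) (c : Set I → ℂ) (a : Set I → I → ℂ) (k : ℕ) (x : I) : ℂ :=
  ∑ Q ∈ G.cells k, c Q * a Q x

/-- The cost `(∑_k (∑_{Q ∈ P^k} |c_Q|^p)^{q/p})^{1/q}` of a family of coefficients. -/
def Grid.cost (G : Grid m) (p : ℝ) (q : ℝ≥0∞) (c : Set I → ℂ) : ℝ≥0∞ :=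
  lqNorm q fun k => lpSum p (G.cells k) fun Q => ‖c Q‖ₑ

/-- `f` is the sum in `L^p` of the series `∑_k ∑_{Q ∈ P^k} c_Q a_Q`, which converges absolutely in
`L^p`, with Souza's atoms `a_Q` (here `1 ≤ p < ∞`). -/
structure Grid.IsRepresentation (G : Grid m) (s p : ℝ) (c : Set I → ℂ) (a : Set I → I → ℂ)
    (f : I → ℂ) : Prop where
  atom : ∀ k, ∀ Q ∈ G.cells k, IsSouzaAtom m s p Q (a Q)
  abs_conv : (∑' k, eLpNorm (G.block c a k) (ENNReal.ofReal p) m) < ∞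
  tendsto : Tendsto
    (fun n : ℕ => eLpNorm (fun x => f x - ∑ k ∈ Finset.range n, G.block c a k x)
      (ENNReal.ofReal p) m) atTop (𝓝 0)

/-- The space `B^s_{p,q}`: the functions in `L^p` that have a representation of finite cost. -/
def Grid.besovSpace (G : Grid m) (s p : ℝ) (q : ℝ≥0∞) : Set (I → ℂ) :=
  {f | MemLp f (ENNReal.ofReal p) m ∧
    ∃ c a, G.IsRepresentation s p c a f ∧ G.cost p q c < ∞}

/-- The norm `|f|_{B^s_{p,q}}`: the infimum of the costs of the representations of `f`
(`∞` if there is none). -/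
def Grid.besovNorm (G : Grid m) (s p : ℝ) (q : ℝ≥0∞) (f : I → ℂ) : ℝ≥0∞ :=
  ⨅ (c : Set I → ℂ) (a : Set I → I → ℂ) (_ : G.IsRepresentation s p c a f), G.cost p q c

/-! ### Unbalanced Haar wavelets -/

open Classical in
/-- The children of a cell `Q` of level `k`. -/
def Grid.children (G : Grid m) (k : ℕ) (Q : Set I) : Finset (Set I) :=
  {P ∈ G.cells (k + 1) | P ⊆ Q}

/-- The arbitrary choices in the construction: an ordering of every finite family of cells, and a
point in every cell. -/
structure Grid.Choices (G : Grid m) where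
  order : Finset (Set I) → List (Set I)
  nodup_order : ∀ T, (order T).Nodup
  mem_order : ∀ T P, P ∈ order T ↔ P ∈ T
  pt : Set I → I
  pt_mem : ∀ k, ∀ P ∈ G.cells k, pt P ∈ P

open Classical in
/-- The family `T`, listed as `R₁, …, Rₙ` in its chosen order, is cut into `{R₁, …, R_[n/2]}` and
`{R_([n/2]+1), …, Rₙ}`. -/
def halves {α : Type*} (order : Finset α → List α) (T : Finset α) : Finset α × Finset α :=
  (((order T).take (T.card / 2)).toFinset, ((order T).drop (T.card / 2)).toFinset)

open Classical in
/-- The `j`-th generation of pairs obtained from `T`: the halves of `T`, then the halves of every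
component with at least two elements of a pair of the preceding generation. -/
def haarGen {α : Type*} (order : Finset α → List α) (T : Finset α) :
    ℕ → Finset (Finset α × Finset α)
  | 0 => {halves order T}
  | j + 1 => (haarGen order T j).biUnion fun S =>
      (({S.1, S.2} : Finset (Finset α)).filter fun R => 2 ≤ R.card).image (halves order)

open Classical in
/-- All pairs obtained from `T`. Generations from `T.card` on are empty, see `mem_haarPairs`. -/
def haarPairs {α : Type*} (order : Finset α → List α) (T : Finset α) :
    Finset (Finset α × Finset α) :=
  (Finset.range T.card).biUnion (haarGen order T)

theorem card_halves {α : Type*} (order : Finset α → List α) (hn : ∀ T, (order T).Nodup)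
    (hm : ∀ T P, P ∈ order T ↔ P ∈ T) (T : Finset α) :
    (halves order T).1.card = T.card / 2 ∧ (halves order T).2.card = T.card - T.card / 2 := by
  classical
  have hl : (order T).length = T.card := by
    rw [← List.toFinset_card_of_nodup (hn T)]
    congr 1
    ext P
    simp [hm]
  have h1 : ((order T).take (T.card / 2)).Nodup := (hn T).sublist (List.take_sublist _ _)
  have h2 : ((order T).drop (T.card / 2)).Nodup := (hn T).sublist (List.drop_sublist _ _)
  constructor
  · have := List.toFinset_card_of_nodup h1
    simp only [List.length_take, hl] at this
    simp only [halves]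
    convert this using 1
    omega
  · have := List.toFinset_card_of_nodup h2
    simp only [List.length_drop, hl] at this
    simp only [halves]
    convert this using 1

theorem card_of_mem_haarGen {α : Type*} (order : Finset α → List α)
    (hn : ∀ T, (order T).Nodup) (hm : ∀ T P, P ∈ order T ↔ P ∈ T) (T : Finset α)
    (hT : 2 ≤ T.card) (j : ℕ) :
    ∀ S ∈ haarGen order T j, 1 ≤ S.1.card ∧ 1 ≤ S.2.card ∧ S.1.card + S.2.card + j ≤ T.card := by
  classical
  induction j with
  | zero =>
    intro S hS
    have h := card_halves order hn hm T
    simp only [haarGen, Finset.mem_singleton] at hS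
    subst hS
    omega
  | succ j ih =>
    intro S hS
    simp only [haarGen, Finset.mem_biUnion, Finset.mem_image, Finset.mem_filter,
      Finset.mem_insert, Finset.mem_singleton] at hS
    obtain ⟨S', hS', R, ⟨hR, hc⟩, rfl⟩ := hS
    have h := card_halves order hn hm R
    have h' := ih S' hS'
    rcases hR with rfl | rfl <;> omega

/-- `haarPairs` is the union of all generations. -/
theorem mem_haarPairs {α : Type*} (order : Finset α → List α)
    (hn : ∀ T, (order T).Nodup) (hm : ∀ T P, P ∈ order T ↔ P ∈ T) (T : Finset α)
    (hT : 2 ≤ T.card) (S : Finset α × Finset α) :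
    S ∈ haarPairs order T ↔ ∃ j, S ∈ haarGen order T j := by
  classical
  simp only [haarPairs, Finset.mem_biUnion, Finset.mem_range]
  constructor
  · rintro ⟨j, -, h⟩
    exact ⟨j, h⟩
  · rintro ⟨j, h⟩
    have := card_of_mem_haarGen order hn hm T hT j S h
    exact ⟨j, by omega, h⟩

/-- The family `H_Q` of a cell `Q` of level `k`. -/
def Grid.haarFamily (G : Grid m) (D : G.Choices) (k : ℕ) (Q : Set I) :
    Finset (Finset (Set I) × Finset (Set I)) :=
  haarPairs D.order (G.children k Q)

/-- The total measure `∑_{P ∈ F} |P|` of a family of cells. -/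
def totalMeasure (m : Measure I) (F : Finset (Set I)) : ℝ := ∑ P ∈ F, m.real P

/-- The Haar wavelet `φ_S` of the pair `S = (S₁, S₂)`. -/
def haarWavelet (m : Measure I) (S : Finset (Set I) × Finset (Set I)) (x : I) : ℝ :=
  1 / (1 / totalMeasure m S.1 + 1 / totalMeasure m S.2) ^ (1 / 2 : ℝ) *
    ((∑ P ∈ S.1, P.indicator (fun _ => (1 : ℝ)) x) / totalMeasure m S.1 -
      (∑ P ∈ S.2, P.indicator (fun _ => (1 : ℝ)) x) / totalMeasure m S.2)

/-- The Haar coefficient `d_S = ∫ f φ_S dm`. -/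
def haarCoeff (m : Measure I) (f : I → ℂ) (S : Finset (Set I) × Finset (Set I)) : ℂ :=
  ∫ x, f x * (haarWavelet m S x : ℂ) ∂m

/-- The Haar coefficient `d_I = ∫ f φ_I dm`, with `φ_I = 1_I / |I|^{1/2}`. -/
def haarCoeffTop (m : Measure I) (f : I → ℂ) : ℂ :=
  ∫ x, f x * ((1 / m.real Set.univ ^ (1 / 2 : ℝ) : ℝ) : ℂ) ∂m

/-- `N_haar(f) = |I|^{1/p-s-1/2} |d_I|
+ (∑_k (∑_{Q ∈ P^k} |Q|^{1-sp-p/2} ∑_{S ∈ H_Q} |d_S|^p)^{q/p})^{1/q}`. -/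
def Grid.haarNorm (G : Grid m) (D : G.Choices) (s p : ℝ) (q : ℝ≥0∞) (f : I → ℂ) : ℝ≥0∞ :=
  m Set.univ ^ (1 / p - s - 1 / 2) * ‖haarCoeffTop m f‖ₑ +
    lqNorm q fun k =>
      (∑ Q ∈ G.cells k, m Q ^ (1 - s * p - p / 2) *
        ∑ S ∈ G.haarFamily D k Q, ‖haarCoeff m f S‖ₑ ^ p) ^ (1 / p)

/-! ### The standard atomic representation -/

open Classical in
/-- The coefficient `k_P` of the canonical Souza's atom on `P` in the standard atomic representation:
`k_I = |I|^{1/p-s-1/2} d_I` at level `0`, and, at level `k + 1`,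
`k_P = |P|^{-(s-1/p)} ∑_{S ∈ H_Q} d_S φ_S(x_P)`, where `Q` is the cell of level `k` that contains
`P` (in a good grid the outer sum has this single term). -/
def Grid.stdCoeff (G : Grid m) (D : G.Choices) (s p : ℝ) (f : I → ℂ) : ℕ → Set I → ℂ
  | 0, _ => ((m.real Set.univ ^ (1 / p - s - 1 / 2) : ℝ) : ℂ) * haarCoeffTop m f
  | k + 1, P => ((1 / m.real P ^ (s - 1 / p) : ℝ) : ℂ) *
      ∑ Q ∈ G.cells k with P ⊆ Q, ∑ S ∈ G.haarFamily D k Q,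
        haarCoeff m f S * (haarWavelet m S (D.pt P) : ℂ)

/-- `N_st(f) = |k_I| + (∑_{k ≥ 1} (∑_{Q ∈ P^k} |k_Q|^p)^{q/p})^{1/q}`. -/
def Grid.stdNorm (G : Grid m) (D : G.Choices) (s p : ℝ) (q : ℝ≥0∞) (f : I → ℂ) : ℝ≥0∞ :=
  ‖G.stdCoeff D s p f 0 Set.univ‖ₑ +
    lqNorm q fun k => lpSum p (G.cells (k + 1)) fun Q => ‖G.stdCoeff D s p f (k + 1) Q‖ₑ

/-! ### Mean oscillation -/

/-- `osc_p(f, Q) = inf_c (∫_Q |f - c|^p dm)^{1/p}`. -/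
def osc (m : Measure I) (p : ℝ) (f : I → ℂ) (Q : Set I) : ℝ≥0∞ :=
  ⨅ c : ℂ, (∫⁻ x in Q, ‖f x - c‖ₑ ^ p ∂m) ^ (1 / p)

/-- `N_osc(f) = |I|^{-s} |f|_p + (∑_k (∑_{Q ∈ P^k} |Q|^{-sp} osc_p(f, Q)^p)^{q/p})^{1/q}`. -/
def Grid.oscNorm (G : Grid m) (s p : ℝ) (q : ℝ≥0∞) (f : I → ℂ) : ℝ≥0∞ :=
  m Set.univ ^ (-s) * eLpNorm f (ENNReal.ofReal p) m +
    lqNorm q fun k =>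
      (∑ Q ∈ G.cells k, m Q ^ (-(s * p)) * osc m p f Q ^ p) ^ (1 / p)

/-! ### Constants, and norms modulo null functions -/

/-- The constant of Hölder's inequality, for `1 ≤ t < ∞` and `1 ≤ q ≤ ∞`: it is
`(∑_k b_k^{q'/t})^{1/q'}` if `q > 1`, and `sup_k b_k^{1/t}` if `q = 1`. -/
def holderConst (t : ℝ) (q : ℝ≥0∞) (b : ℕ → ℝ≥0∞) : ℝ≥0∞ :=
  if q = 1 then ⨆ k, b k ^ (1 / t)
  else (∑' k, b k ^ (q.conjExponent.toReal / t)) ^ (1 / q.conjExponent.toReal)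

/-- `λ₂^{1/2} / (√2 λ₁^{3/2}) + 1`. -/
def waveletConst (l₁ l₂ : ℝ) : ℝ :=
  l₂ ^ (1 / 2 : ℝ) / (√2 * l₁ ^ (3 / 2 : ℝ)) + 1

/-- `1 + C max{λ₂^{1/p-s}, λ₁^{1/p-s}} λ₁^{-2-1/p}`, with `C` the constant `waveletConst`. -/
def stdConst (l₁ l₂ s p : ℝ) : ℝ :=
  1 + waveletConst l₁ l₂ * max (l₂ ^ (1 / p - s)) (l₁ ^ (1 / p - s)) * l₁ ^ (-2 - 1 / p)

/-- `M^{1+1/p} C(p, q, (|P^k|^{sp})_k) |I|^{-s} + 1 / (1 - λ₂^s)`, with `M` the overlap of the grid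
and `C` the constant `holderConst`. -/
def Grid.oscConst (G : Grid m) (l₂ s p : ℝ) (q : ℝ≥0∞) : ℝ≥0∞ :=
  G.overlap ^ (1 + 1 / p) * holderConst p q (fun k => G.mesh k ^ (s * p)) *
    m Set.univ ^ (-s) + ENNReal.ofReal (1 / (1 - l₂ ^ s))

/-- `V` is a complex linear space of functions and `N` is a norm on it, functions that agree almost
everywhere being identified. -/
structure IsNormOn (m : Measure I) (V : Set (I → ℂ)) (N : (I → ℂ) → ℝ≥0∞) : Prop where
  zero_mem : (fun _ => 0) ∈ V
  add_mem : ∀ f ∈ V, ∀ g ∈ V, (fun x => f x + g x) ∈ V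
  smul_mem : ∀ z : ℂ, ∀ f ∈ V, (fun x => z * f x) ∈ V
  lt_top : ∀ f ∈ V, N f < ∞
  add_le : ∀ f ∈ V, ∀ g ∈ V, N (fun x => f x + g x) ≤ N f + N g
  smul_eq : ∀ z : ℂ, ∀ f ∈ V, N (fun x => z * f x) = ‖z‖ₑ * N f
  eq_zero_iff : ∀ f ∈ V, N f = 0 ↔ f =ᵐ[m] fun _ => 0

end GridBesov

end

noncomputable section

namespace GridBesov

/-! ### Sequence norms -/

/-! The four quantities are compared in a cycle: `besovNorm` ≤ `stdNorm` ≲ `haarNorm` ≲ `oscNorm` ≲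
`besovNorm`. All constants are finite, so they are finite simultaneously, and definiteness passes
from one to another. Subadditivity and homogeneity are checked for each functional separately, by
Minkowski's inequality in ℓ^p and ℓ^q.

The Haar system of a cell is a binary tree of cuts. At a point of P ∈ S₁ the term d_S φ_S equals the
average of f over S₁ minus the average over S₁ ∪ S₂ (`haar_step`). Along the path from the root of
the tree to P these differences telescope to the average over P minus the average over the parent
(`sum_haarSum_mul_haarValue`). Hence the partial sums of the standard atomic representation are the
averages of f over the cells of one level. The averages converge to f in L¹, because averaging is an
L¹ contraction and the grid generates the σ-algebra (`averageTendsto`). If N_st is finite, Hölder's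
inequality and the geometric decay of the mesh make the series absolutely convergent in L^p, and
Fatou's lemma along an a.e. convergent subsequence identifies its sum with f
(`isRepresentation_stdFamily`). This is the first inequality.

The same telescoping, applied to an indicator, gives ∑ φ_S(P)² = 1/|P| - 1/|Q| (`sum_haarValue_sq`).
With the bound n ≤ 1/λ₁ for the number n of children, and the bound (n+1)/2 for the number of pairs
that see P, it controls all wavelets pointwise. The estimate N_st ≤ C_st N_haar then only compares
finite sums. For N_haar ≤ C_w N_osc, wavelets have mean zero, so f may be replaced by f - c on Q,
and Hölder's inequality with weight |φ_S| is summed over S (`sum_haarCoeff_rpow_le_lintegral`).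

For N_osc ≤ C_o |f|, take any atomic series. Its blocks of level at most k are constant on each Q ∈
P^k and serve as the constant in osc_p(f, Q). The block of level k + i, weighted by |Q|^{-s}, gains
a factor λ₂^{si} (`osc_level_le`). What remains is a convolution with a geometric sequence, bounded
in ℓ^q by `lqNorm_convolution_le`. -/

theorem lqNorm_eq_eLpNorm {q : ℝ≥0∞} (hq : 1 ≤ q) (a : ℕ → ℝ≥0∞) :
    lqNorm q a = eLpNorm a q Measure.count := by
  have h0 : q ≠ 0 := (zero_lt_one.trans_le hq).ne'
  rw [lqNorm]
  split_ifs with h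
  · subst h
    simp [eLpNorm_exponent_top, eLpNormEssSup]
  · rw [eLpNorm_eq_lintegral_rpow_enorm_toReal h0 h, lintegral_count]
    simp

theorem lqNorm_mono {q : ℝ≥0∞} {a b : ℕ → ℝ≥0∞} (h : ∀ k, a k ≤ b k) :
    lqNorm q a ≤ lqNorm q b := by
  rw [lqNorm, lqNorm]
  split_ifs
  · exact iSup_mono h
  · gcongr with k
    exact h k

theorem one_le_toReal {q : ℝ≥0∞} (hq : 1 ≤ q) (h : q ≠ ∞) : 1 ≤ q.toReal := by
  simpa using ENNReal.toReal_mono h hq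

theorem lqNorm_add_le {q : ℝ≥0∞} (hq : 1 ≤ q) (a b : ℕ → ℝ≥0∞) :
    lqNorm q (fun k => a k + b k) ≤ lqNorm q a + lqNorm q b := by
  simp only [lqNorm_eq_eLpNorm hq]
  exact eLpNorm_add_le (Measurable.of_discrete).aestronglyMeasurable
    (Measurable.of_discrete).aestronglyMeasurable hq

theorem lqNorm_const_mul {q : ℝ≥0∞} (hq : 1 ≤ q) (c : ℝ≥0∞) (a : ℕ → ℝ≥0∞) :
    lqNorm q (fun k => c * a k) = c * lqNorm q a := by
  rw [lqNorm, lqNorm]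
  split_ifs with h
  · rw [ENNReal.mul_iSup]
  · have := one_le_toReal hq h
    simp_rw [ENNReal.mul_rpow_of_nonneg _ _ (zero_le_one.trans this)]
    rw [ENNReal.tsum_mul_left, ENNReal.mul_rpow_of_nonneg _ _ (by positivity), ← ENNReal.rpow_mul,
      mul_one_div_cancel (by positivity), ENNReal.rpow_one]

theorem lqNorm_zero {q : ℝ≥0∞} (hq : 1 ≤ q) : lqNorm q (fun _ => 0) = 0 := by
  simpa using lqNorm_const_mul hq 0 (fun _ => 0)

theorem le_lqNorm {q : ℝ≥0∞} (hq : 1 ≤ q) (a : ℕ → ℝ≥0∞) (k : ℕ) : a k ≤ lqNorm q a := by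
  rw [lqNorm]
  split_ifs with h
  · exact le_iSup a k
  · have h1 := one_le_toReal hq h
    have h2 : a k ^ q.toReal ≤ ∑' k, a k ^ q.toReal := ENNReal.le_tsum k
    calc a k = (a k ^ q.toReal) ^ (1 / q.toReal) := by
          rw [← ENNReal.rpow_mul, mul_one_div_cancel (by positivity), ENNReal.rpow_one]
      _ ≤ _ := by gcongr

theorem lqNorm_shift_le {q : ℝ≥0∞} (a : ℕ → ℝ≥0∞) (i : ℕ) :
    lqNorm q (fun k => a (k + i)) ≤ lqNorm q a := by
  rw [lqNorm, lqNorm]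
  split_ifs with h
  · exact iSup_le fun k => le_iSup a (k + i)
  · exact ENNReal.rpow_le_rpow (ENNReal.tsum_comp_le_tsum_of_injective (add_left_injective i)
      (fun k => a k ^ q.toReal)) (by positivity)

/-- Fatou's lemma for ℓ^q. It carries Minkowski's inequality from finite sums to series in
`lqNorm_tsum_le`. -/
theorem lqNorm_le_of_tendsto {q : ℝ≥0∞} (hq : 1 ≤ q) {u : ℕ → ℕ → ℝ≥0∞} {a : ℕ → ℝ≥0∞}
    {B : ℝ≥0∞} (hu : ∀ n, lqNorm q (u n) ≤ B)
    (h : ∀ k, Tendsto (fun n => u n k) atTop (𝓝 (a k))) : lqNorm q a ≤ B := by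
  by_cases hqt : q = ∞
  · subst hqt
    rw [lqNorm, if_pos rfl]
    exact iSup_le fun k => le_of_tendsto' (h k) fun n => (le_lqNorm hq (u n) k).trans (hu n)
  · have h1 := one_le_toReal hq hqt
    have key : ∀ n, ∑' k, u n k ^ q.toReal ≤ B ^ q.toReal := by
      intro n
      have := hu n
      rw [lqNorm, if_neg hqt] at this
      rwa [one_div, ENNReal.rpow_inv_le_iff (by positivity)] at this
    rw [lqNorm, if_neg hqt, one_div, ENNReal.rpow_inv_le_iff (by positivity)]
    refine ENNReal.tsum_le_of_sum_range_le fun N => ?_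
    refine le_of_tendsto' (f := fun n => ∑ k ∈ Finset.range N, u n k ^ q.toReal) (x := atTop)
      (tendsto_finsetSum _ fun k _ => ?_) fun n => (ENNReal.sum_le_tsum _).trans (key n)
    exact (ENNReal.continuous_rpow_const.tendsto _).comp (h k)

theorem lqNorm_sum_le {q : ℝ≥0∞} (hq : 1 ≤ q) (u : ℕ → ℕ → ℝ≥0∞) (n : ℕ) :
    lqNorm q (fun k => ∑ i ∈ Finset.range n, u i k) ≤ ∑ i ∈ Finset.range n, lqNorm q (u i) := by
  induction n with
  | zero => simp [lqNorm_zero hq]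
  | succ n ih =>
    simp only [Finset.sum_range_succ]
    exact (lqNorm_add_le hq _ _).trans (by gcongr)

theorem lqNorm_tsum_le {q : ℝ≥0∞} (hq : 1 ≤ q) (u : ℕ → ℕ → ℝ≥0∞) :
    lqNorm q (fun k => ∑' i, u i k) ≤ ∑' i, lqNorm q (u i) :=
  lqNorm_le_of_tendsto hq
    (fun n => (lqNorm_sum_le hq u n).trans (ENNReal.sum_le_tsum _))
    fun k => ENNReal.tendsto_nat_tsum fun i => u i k

/-- A one-sided Young inequality: a left shift only drops terms of the sequence, so Minkowski's
inequality over `i` suffices. The offset `k + 1` is the first level whose atoms need not be constant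
on the cells of level `k`. -/
theorem lqNorm_convolution_le {q : ℝ≥0∞} (hq : 1 ≤ q) (r a : ℕ → ℝ≥0∞) :
    lqNorm q (fun k => ∑' i, r i * a (k + 1 + i)) ≤ (∑' i, r i) * lqNorm q a := by
  refine (lqNorm_tsum_le hq _).trans ?_
  rw [← ENNReal.tsum_mul_right]
  refine ENNReal.tsum_le_tsum fun i => ?_
  rw [lqNorm_const_mul hq]
  gcongr
  simpa only [add_assoc] using lqNorm_shift_le (q := q) a (1 + i)

theorem lqNorm_le_head_add {q : ℝ≥0∞} (hq : 1 ≤ q) (a : ℕ → ℝ≥0∞) :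
    lqNorm q a ≤ a 0 + lqNorm q (fun k => a (k + 1)) := by
  by_cases hqt : q = ∞
  · subst hqt
    simp only [lqNorm, if_true]
    refine iSup_le fun k => ?_
    cases k with
    | zero => exact le_self_add
    | succ k => exact (le_iSup (fun k => a (k + 1)) k).trans le_add_self
  · have h1 := one_le_toReal hq hqt
    rw [lqNorm, lqNorm, if_neg hqt, if_neg hqt, tsum_eq_zero_add' ENNReal.summable]
    -- The power 1/q ≤ 1 is subadditive.
    refine (ENNReal.rpow_add_le_add_rpow _ _ (by positivity) ?_).trans ?_
    · rw [div_le_one (by positivity)]; exact h1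
    · rw [← ENNReal.rpow_mul, mul_one_div_cancel (by positivity), ENNReal.rpow_one]

/-- Hölder's inequality for the pair of b^{1/t} and a, in the cases q = 1, q = ∞ and 1 < q < ∞. -/
theorem tsum_mul_le_holderConst_mul (t : ℝ) {q : ℝ≥0∞} (hq : 1 ≤ q)
    (b a : ℕ → ℝ≥0∞) :
    ∑' k, b k ^ (1 / t) * a k ≤ holderConst t q b * lqNorm q a := by
  rw [holderConst]
  split_ifs with h1
  · subst h1
    rw [lqNorm, if_neg (by simp)]
    simp only [ENNReal.toReal_one, ENNReal.rpow_one, div_one]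
    rw [← ENNReal.tsum_mul_left]
    refine ENNReal.tsum_le_tsum fun k => ?_
    gcongr
    exact le_iSup (fun k => b k ^ (1 / t)) k
  · by_cases hqt : q = ∞
    · subst hqt
      simp only [lqNorm, if_true, ENNReal.conjExponent]
      -- The conjugate exponent is 1 + (q - 1)⁻¹, which is 1 at q = ∞.
      have h2 : (∞ : ℝ≥0∞) - 1 = ∞ := by simp
      simp only [h2, ENNReal.inv_top, add_zero, ENNReal.toReal_one, div_one, ENNReal.rpow_one]
      rw [← ENNReal.tsum_mul_right]
      refine ENNReal.tsum_le_tsum fun k => ?_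
      gcongr
      exact le_iSup a k
    · have hq1 : 1 < q.toReal := by
        have := (ENNReal.toReal_lt_toReal ENNReal.one_ne_top hqt).2 (lt_of_le_of_ne hq (Ne.symm h1))
        simpa using this
      have hc : q.HolderConjugate q.conjExponent := ENNReal.HolderConjugate.conjExponent hq
      have hr : q.toReal.HolderConjugate q.conjExponent.toReal :=
        ENNReal.HolderConjugate.toReal hq1
      rw [lqNorm, if_neg hqt]
      refine ENNReal.tsum_le_of_sum_range_le fun n => ?_
      refine (ENNReal.inner_le_Lp_mul_Lq _ _ _ hr.symm).trans ?_
      simp_rw [← ENNReal.rpow_mul, one_div_mul_eq_div]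
      gcongr
      · exact ENNReal.sum_le_tsum _
      · exact ENNReal.sum_le_tsum _

/-! ### Finite weighted `ℓ^p` norms -/

/-- The weighted `ℓ^p` norm of a finite family in `[0, ∞]`. -/
def weightedSum {ι : Type*} (p : ℝ) (F : Finset ι) (w a : ι → ℝ≥0∞) : ℝ≥0∞ :=
  (∑ i ∈ F, w i * a i ^ p) ^ (1 / p)

section weighted

variable {ι : Type*} {p : ℝ} (F : Finset ι)

theorem lpSum_eq_weightedSum (a : ι → ℝ≥0∞) : lpSum p F a = weightedSum p F (fun _ => 1) a := by
  simp [lpSum, weightedSum]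

theorem weightedSum_mono (hp : 1 ≤ p) {w a b : ι → ℝ≥0∞} (h : ∀ i ∈ F, a i ≤ b i) :
    weightedSum p F w a ≤ weightedSum p F w b := by
  unfold weightedSum
  gcongr with i hi
  exact h i hi

theorem weightedSum_add_le (hp : 1 ≤ p) (w a b : ι → ℝ≥0∞) :
    weightedSum p F w (fun i => a i + b i) ≤ weightedSum p F w a + weightedSum p F w b := by
  have hp0 : 0 ≤ p := zero_le_one.trans hp
  -- The weight enters the base as w^{1/p}, which leaves the unweighted Minkowski inequality.
  have key : ∀ x y : ℝ≥0∞, x * y ^ p = (x ^ (1 / p) * y) ^ p := fun x y => by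
    rw [ENNReal.mul_rpow_of_nonneg _ _ hp0, ← ENNReal.rpow_mul, one_div_mul_cancel (by positivity),
      ENNReal.rpow_one]
  unfold weightedSum
  simp_rw [key, mul_add]
  exact ENNReal.Lp_add_le F _ _ hp

theorem weightedSum_const_mul (hp : 1 ≤ p) (c : ℝ≥0∞) (w a : ι → ℝ≥0∞) :
    weightedSum p F w (fun i => c * a i) = c * weightedSum p F w a := by
  have hp0 : 0 ≤ p := zero_le_one.trans hp
  unfold weightedSum
  simp_rw [ENNReal.mul_rpow_of_nonneg _ _ hp0, mul_left_comm _ (c ^ p), ← Finset.mul_sum]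
  rw [ENNReal.mul_rpow_of_nonneg _ _ (by positivity), ← ENNReal.rpow_mul,
    mul_one_div_cancel (by positivity), ENNReal.rpow_one]

theorem lpSum_mono (hp : 1 ≤ p) {a b : ι → ℝ≥0∞} (h : ∀ i ∈ F, a i ≤ b i) :
    lpSum p F a ≤ lpSum p F b := by
  simpa only [lpSum_eq_weightedSum] using weightedSum_mono F hp h

theorem lpSum_add_le (hp : 1 ≤ p) (a b : ι → ℝ≥0∞) :
    lpSum p F (fun i => a i + b i) ≤ lpSum p F a + lpSum p F b := by
  simpa only [lpSum_eq_weightedSum] using weightedSum_add_le F hp _ a b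

theorem lpSum_const_mul (hp : 1 ≤ p) (c : ℝ≥0∞) (a : ι → ℝ≥0∞) :
    lpSum p F (fun i => c * a i) = c * lpSum p F a := by
  simpa only [lpSum_eq_weightedSum] using weightedSum_const_mul F hp c _ a

end weighted

/-! ### The combinatorics of the Haar pairs -/

section pairs

variable {α : Type*} {order : Finset α → List α}

open Classical in
theorem halves_union (hm : ∀ T P, P ∈ order T ↔ P ∈ T) (T : Finset α) :
    (halves order T).1 ∪ (halves order T).2 = T := by
  ext P
  rw [halves, ← List.toFinset_append, List.take_append_drop, List.mem_toFinset, hm]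

theorem disjoint_halves (hn : ∀ T, (order T).Nodup) (T : Finset α) :
    Disjoint (halves order T).1 (halves order T).2 := by
  classical
  have h := hn T
  rw [← List.take_append_drop (T.card / 2) (order T), List.nodup_append'] at h
  rw [Finset.disjoint_left]
  intro P h1 h2
  simp only [halves, List.mem_toFinset] at h1 h2
  exact h.2.2 h1 h2

open Classical in
/-- The pairs obtained from `T` when `T` has at least two elements, and none otherwise. -/
def properPairs (order : Finset α → List α) (T : Finset α) : Finset (Finset α × Finset α) :=
  if 2 ≤ T.card then haarPairs order T else ∅

/-- `haarGen` grows the tree of cuts at its leaves. Reading it from the root instead, a generation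
of `T` is the preceding generation of each half, which permits induction on the family. -/
theorem mem_haarGen_succ (T : Finset α) (j : ℕ) (S : Finset α × Finset α) :
    S ∈ haarGen order T (j + 1) ↔
      (2 ≤ (halves order T).1.card ∧ S ∈ haarGen order (halves order T).1 j) ∨
      (2 ≤ (halves order T).2.card ∧ S ∈ haarGen order (halves order T).2 j) := by
  classical
  induction j generalizing S with
  | zero =>
    simp only [haarGen, Finset.mem_biUnion, Finset.mem_image, Finset.mem_filter,
      Finset.mem_insert, Finset.mem_singleton]
    grind
  | succ j ih =>
    rw [haarGen]
    simp only [Finset.mem_biUnion, ih]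
    constructor
    · rintro ⟨S', h | h, hS⟩
      · exact Or.inl ⟨h.1, by rw [haarGen]; exact Finset.mem_biUnion.2 ⟨S', h.2, hS⟩⟩
      · exact Or.inr ⟨h.1, by rw [haarGen]; exact Finset.mem_biUnion.2 ⟨S', h.2, hS⟩⟩
    · rintro (⟨h, hS⟩ | ⟨h, hS⟩)
      · rw [haarGen, Finset.mem_biUnion] at hS
        obtain ⟨S', h', hS⟩ := hS
        exact ⟨S', Or.inl ⟨h, h'⟩, hS⟩
      · rw [haarGen, Finset.mem_biUnion] at hS
        obtain ⟨S', h', hS⟩ := hS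
        exact ⟨S', Or.inr ⟨h, h'⟩, hS⟩

theorem mem_properPairs (hn : ∀ T, (order T).Nodup) (hm : ∀ T P, P ∈ order T ↔ P ∈ T)
    (T : Finset α) (S : Finset α × Finset α) :
    S ∈ properPairs order T ↔ 2 ≤ T.card ∧ ∃ j, S ∈ haarGen order T j := by
  rw [properPairs]
  split_ifs with h
  · rw [mem_haarPairs order hn hm T h]
    simp [h]
  · simp [h]

theorem subset_of_mem_haarGen (hm : ∀ T P, P ∈ order T ↔ P ∈ T) (j : ℕ) (T : Finset α)
    {S : Finset α × Finset α} (hS : S ∈ haarGen order T j) : S.1 ⊆ T ∧ S.2 ⊆ T := by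
  classical
  have h0 : ∀ T : Finset α, (halves order T).1 ⊆ T ∧ (halves order T).2 ⊆ T := fun T =>
    ⟨fun P h => (halves_union hm T) ▸ Finset.mem_union_left _ h,
      fun P h => (halves_union hm T) ▸ Finset.mem_union_right _ h⟩
  induction j generalizing T with
  | zero =>
    simp only [haarGen, Finset.mem_singleton] at hS
    subst hS
    exact h0 T
  | succ j ih =>
    rcases (mem_haarGen_succ T j S).1 hS with h | h
    · exact ⟨(ih _ h.2).1.trans (h0 T).1, (ih _ h.2).2.trans (h0 T).1⟩
    · exact ⟨(ih _ h.2).1.trans (h0 T).2, (ih _ h.2).2.trans (h0 T).2⟩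

theorem disjoint_of_mem_haarGen (hn : ∀ T, (order T).Nodup) (j : ℕ) (T : Finset α)
    {S : Finset α × Finset α} (hS : S ∈ haarGen order T j) : Disjoint S.1 S.2 := by
  classical
  induction j generalizing T with
  | zero =>
    simp only [haarGen, Finset.mem_singleton] at hS
    subst hS
    exact disjoint_halves hn T
  | succ j ih =>
    rcases (mem_haarGen_succ T j S).1 hS with h | h
    · exact ih _ h.2
    · exact ih _ h.2

theorem haarPairs_props (hn : ∀ T, (order T).Nodup) (hm : ∀ T P, P ∈ order T ↔ P ∈ T)
    {T : Finset α} (hT : 2 ≤ T.card) {S : Finset α × Finset α} (hS : S ∈ haarPairs order T) :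
    S.1 ⊆ T ∧ S.2 ⊆ T ∧ Disjoint S.1 S.2 ∧ S.1.Nonempty ∧ S.2.Nonempty := by
  obtain ⟨j, hj⟩ := (mem_haarPairs order hn hm T hT S).1 hS
  have h1 := subset_of_mem_haarGen hm j T hj
  have h2 := card_of_mem_haarGen order hn hm T hT j S hj
  exact ⟨h1.1, h1.2, disjoint_of_mem_haarGen hn j T hj, Finset.card_pos.1 h2.1,
    Finset.card_pos.1 h2.2.1⟩

/-- The tree of cuts is its root and two subtrees, and these are disjoint because the halves are.
The subtrees are `properPairs`: for a one-element family `haarPairs` contains the degenerate pair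
with empty first component, which must not be counted. -/
theorem sum_haarPairs {M : Type*} [AddCommMonoid M] (hn : ∀ T, (order T).Nodup)
    (hm : ∀ T P, P ∈ order T ↔ P ∈ T) {T : Finset α} (hT : 2 ≤ T.card)
    (F : Finset α × Finset α → M) :
    ∑ S ∈ haarPairs order T, F S = F (halves order T) +
      (∑ S ∈ properPairs order (halves order T).1, F S +
        ∑ S ∈ properPairs order (halves order T).2, F S) := by
  classical
  have hc := card_halves order hn hm T
  have hdec : haarPairs order T = insert (halves order T)
      (properPairs order (halves order T).1 ∪ properPairs order (halves order T).2) := by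
    ext S
    rw [mem_haarPairs order hn hm T hT, Finset.mem_insert, Finset.mem_union,
      mem_properPairs hn hm, mem_properPairs hn hm]
    constructor
    · rintro ⟨j, hj⟩
      cases j with
      | zero =>
        simp only [haarGen, Finset.mem_singleton] at hj
        exact Or.inl hj
      | succ j =>
        rcases (mem_haarGen_succ T j S).1 hj with h | h
        · exact Or.inr (Or.inl ⟨h.1, j, h.2⟩)
        · exact Or.inr (Or.inr ⟨h.1, j, h.2⟩)
    · rintro (h | ⟨h, j, hj⟩ | ⟨h, j, hj⟩)
      · exact ⟨0, by simp [haarGen, h]⟩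
      · exact ⟨j + 1, (mem_haarGen_succ T j S).2 (Or.inl ⟨h, hj⟩)⟩
      · exact ⟨j + 1, (mem_haarGen_succ T j S).2 (Or.inr ⟨h, hj⟩)⟩
  have hd := disjoint_halves hn T
  have hsub : ∀ R S, S ∈ properPairs order R → S.1 ⊆ R ∧ S.2 ⊆ R ∧ S.1.Nonempty := by
    intro R S hS
    rw [properPairs] at hS
    split_ifs at hS with h
    · have := haarPairs_props hn hm h hS
      exact ⟨this.1, this.2.1, this.2.2.2.1⟩
    · simp at hS
  rw [hdec, Finset.sum_insert, Finset.sum_union]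
  · rw [Finset.disjoint_left]
    intro S h1 h2
    obtain ⟨P, hP⟩ := (hsub _ _ h1).2.2
    exact Finset.disjoint_left.1 hd ((hsub _ _ h1).1 hP) ((hsub _ _ h2).1 hP)
  -- If the root occurred in the subtree of one half, the other half would be contained in it,
  -- although the two are disjoint and nonempty.
  · rw [Finset.mem_union]
    rintro (h | h)
    · have h2 : (halves order T).2 ⊆ (halves order T).1 := (hsub _ _ h).2.1
      have := Finset.card_le_card h2
      have h3 : (halves order T).2.Nonempty := Finset.card_pos.1 (by omega)
      obtain ⟨P, hP⟩ := h3
      exact Finset.disjoint_left.1 hd (h2 hP) hP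
    · have h2 : (halves order T).1 ⊆ (halves order T).2 := (hsub _ _ h).1
      have h3 : (halves order T).1.Nonempty := Finset.card_pos.1 (by omega)
      obtain ⟨P, hP⟩ := h3
      exact Finset.disjoint_left.1 hd hP (h2 hP)

theorem sum_properPairs_eq_zero {M : Type*} [AddCommMonoid M] (hn : ∀ T, (order T).Nodup)
    (hm : ∀ T P, P ∈ order T ↔ P ∈ T) {R : Finset α} {P : α} (hP : P ∉ R)
    (F : Finset α × Finset α → M) (hF : ∀ S, P ∉ S.1 → P ∉ S.2 → F S = 0) :
    ∑ S ∈ properPairs order R, F S = 0 := by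
  refine Finset.sum_eq_zero fun S hS => ?_
  obtain ⟨-, j, hj⟩ := (mem_properPairs hn hm R S).1 hS
  have := subset_of_mem_haarGen hm j R hj
  exact hF S (fun h => hP (this.1 h)) (fun h => hP (this.2 h))

/-- Among the pairs obtained from `T`, those that see `P` are the halves of `T` and the pairs that
see `P` obtained from the half that contains `P`. -/
theorem sum_haarPairs_of_mem {M : Type*} [AddCommMonoid M] (hn : ∀ T, (order T).Nodup)
    (hm : ∀ T P, P ∈ order T ↔ P ∈ T) {T : Finset α} (hT : 2 ≤ T.card) {P : α} (hP : P ∈ T)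
    (F : Finset α × Finset α → M) (hF : ∀ S, P ∉ S.1 → P ∉ S.2 → F S = 0) :
    (P ∈ (halves order T).1 ∧ P ∉ (halves order T).2 ∧ ∑ S ∈ haarPairs order T, F S =
      F (halves order T) + ∑ S ∈ properPairs order (halves order T).1, F S) ∨
    (P ∈ (halves order T).2 ∧ P ∉ (halves order T).1 ∧ ∑ S ∈ haarPairs order T, F S =
      F (halves order T) + ∑ S ∈ properPairs order (halves order T).2, F S) := by
  classical
  have hd := disjoint_halves hn T
  have hu := halves_union hm T
  rw [← hu, Finset.mem_union] at hP
  rcases hP with h | h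
  · have h' := Finset.disjoint_left.1 hd h
    refine Or.inl ⟨h, h', ?_⟩
    rw [sum_haarPairs hn hm hT, sum_properPairs_eq_zero hn hm h' F hF, add_zero]
  · have h' := Finset.disjoint_right.1 hd h
    refine Or.inr ⟨h, h', ?_⟩
    rw [sum_haarPairs hn hm hT, sum_properPairs_eq_zero hn hm h' F hF, zero_add]

-- The pairs that see P form the path from the root to P, and each cut leaves at most ⌈n/2⌉
-- elements. The true length is logarithmic, but this linear bound is what the constants require.
open Classical in
theorem card_pairs_of_mem_le (hn : ∀ T, (order T).Nodup) (hm : ∀ T P, P ∈ order T ↔ P ∈ T)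
    (T : Finset α) (hT : 2 ≤ T.card) {P : α} (hP : P ∈ T) :
    ((haarPairs order T).filter fun S => P ∈ S.1 ∨ P ∈ S.2).card ≤ (T.card + 1) / 2 := by
  rw [Finset.card_filter]
  generalize hN : T.card = N
  induction N using Nat.strong_induction_on generalizing T with
  | _ N ih =>
    have hc := card_halves order hn hm T
    have key : ∀ R : Finset α, P ∈ R → R.card ≤ (N + 1) / 2 →
        1 + ∑ S ∈ properPairs order R, (if P ∈ S.1 ∨ P ∈ S.2 then 1 else 0) ≤ (N + 1) / 2 := by
      intro R hR hRc
      rw [properPairs]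
      split_ifs with h
      · have := ih R.card (by omega) R h hR rfl
        omega
      · simp
        omega
    have h1 : ∀ S : Finset α × Finset α, (if P ∈ S.1 ∨ P ∈ S.2 then 1 else 0) ≤ 1 := fun S => by
      split_ifs <;> simp
    rcases sum_haarPairs_of_mem hn hm hT hP (fun S => if P ∈ S.1 ∨ P ∈ S.2 then 1 else 0)
      (fun S h h' => by simp [h, h']) with ⟨h, -, he⟩ | ⟨h, -, he⟩ <;> rw [he]
    · exact (Nat.add_le_add_right (h1 _) _).trans (key _ h (by omega))
    · exact (Nat.add_le_add_right (h1 _) _).trans (key _ h (by omega))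

/-- The normalizing factor of the Haar wavelet of a pair of sets of measures `a` and `b`. -/
def haarFactor (a b : ℝ) : ℝ := 1 / (1 / a + 1 / b) ^ (1 / 2 : ℝ)

theorem haarFactor_mul_self {a b : ℝ} (ha : 0 < a) (hb : 0 < b) :
    haarFactor a b * haarFactor a b = a * b / (a + b) := by
  rw [haarFactor, div_mul_div_comm, ← Real.sqrt_eq_rpow, Real.mul_self_sqrt (by positivity)]
  field_simp
  ring

open Classical in
/-- The value of the Haar wavelet of `S` on `P`, for cells of measures `w`. -/
def haarValue (w : α → ℝ) (S : Finset α × Finset α) (P : α) : ℝ :=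
  haarFactor (∑ R ∈ S.1, w R) (∑ R ∈ S.2, w R) *
    ((if P ∈ S.1 then 1 else 0) / (∑ R ∈ S.1, w R) - (if P ∈ S.2 then 1 else 0) / (∑ R ∈ S.2, w R))

/-- The Haar coefficient of `S` of a function whose integrals over the cells are `A`. -/
def haarSum (w : α → ℝ) (A : α → ℂ) (S : Finset α × Finset α) : ℂ :=
  (haarFactor (∑ R ∈ S.1, w R) (∑ R ∈ S.2, w R) : ℂ) *
    ((∑ R ∈ S.1, A R) / ((∑ R ∈ S.1, w R : ℝ) : ℂ) - (∑ R ∈ S.2, A R) / ((∑ R ∈ S.2, w R : ℝ) : ℂ))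

theorem haarValue_eq_zero (w : α → ℝ) {S : Finset α × Finset α} {P : α} (h1 : P ∉ S.1)
    (h2 : P ∉ S.2) : haarValue w S P = 0 := by
  simp [haarValue, h1, h2]

/-- The squared normalizing factor is ab/(a + b), exactly what turns one Haar term at a point of the
first component into a difference of two averages. The second component follows by symmetry. -/
theorem haar_step {a b : ℝ} (ha : 0 < a) (hb : 0 < b) (x y : ℂ) :
    (haarFactor a b : ℂ) * (x / (a : ℂ) - y / (b : ℂ)) * ((haarFactor a b * (1 / a) : ℝ) : ℂ) =
      x / (a : ℂ) - (x + y) / ((a + b : ℝ) : ℂ) := by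
  have h := congrArg (fun r : ℝ => (r : ℂ)) (haarFactor_mul_self ha hb)
  push_cast at h
  have ha' : (a : ℂ) ≠ 0 := by exact_mod_cast ha.ne'
  have hb' : (b : ℂ) ≠ 0 := by exact_mod_cast hb.ne'
  have hab : (a : ℂ) + b ≠ 0 := by exact_mod_cast (add_pos ha hb).ne'
  push_cast
  rw [show (haarFactor a b : ℂ) * (x / a - y / b) * (haarFactor a b * (1 / a)) =
    haarFactor a b * haarFactor a b * ((x / a - y / b) * (1 / a)) by ring, h]
  field_simp
  ring

theorem haarFactor_comm (a b : ℝ) : haarFactor a b = haarFactor b a := by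
  rw [haarFactor, haarFactor, add_comm]

theorem haarSum_mul_haarValue_left {w : α → ℝ} (A : α → ℂ) {S : Finset α × Finset α} {P : α}
    (h1 : P ∈ S.1) (h2 : P ∉ S.2) (hw1 : 0 < ∑ R ∈ S.1, w R) (hw2 : 0 < ∑ R ∈ S.2, w R) :
    haarSum w A S * (haarValue w S P : ℂ) =
      (∑ R ∈ S.1, A R) / ((∑ R ∈ S.1, w R : ℝ) : ℂ) -
      (∑ R ∈ S.1, A R + ∑ R ∈ S.2, A R) / ((∑ R ∈ S.1, w R + ∑ R ∈ S.2, w R : ℝ) : ℂ) := by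
  rw [← haar_step hw1 hw2, haarSum, haarValue, if_pos h1, if_neg h2, zero_div, sub_zero]

theorem haarSum_mul_haarValue_right {w : α → ℝ} (A : α → ℂ) {S : Finset α × Finset α} {P : α}
    (h1 : P ∉ S.1) (h2 : P ∈ S.2) (hw1 : 0 < ∑ R ∈ S.1, w R) (hw2 : 0 < ∑ R ∈ S.2, w R) :
    haarSum w A S * (haarValue w S P : ℂ) =
      (∑ R ∈ S.2, A R) / ((∑ R ∈ S.2, w R : ℝ) : ℂ) -
      (∑ R ∈ S.1, A R + ∑ R ∈ S.2, A R) / ((∑ R ∈ S.1, w R + ∑ R ∈ S.2, w R : ℝ) : ℂ) := by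
  rw [add_comm (∑ R ∈ S.1, A R), add_comm (∑ R ∈ S.1, w R), ← haar_step hw2 hw1, haarSum,
    haarValue, if_neg h1, if_pos h2, zero_div, zero_sub, haarFactor_comm (∑ R ∈ S.2, w R)]
  push_cast
  ring

/-- The Haar system reproduces the differences of averages. -/
theorem sum_haarSum_mul_haarValue (hn : ∀ T, (order T).Nodup) (hm : ∀ T P, P ∈ order T ↔ P ∈ T)
    {w : α → ℝ} (A : α → ℂ) (T : Finset α) (hw : ∀ P ∈ T, 0 < w P) (hT : 2 ≤ T.card) {P : α}
    (hP : P ∈ T) :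
    ∑ S ∈ haarPairs order T, haarSum w A S * (haarValue w S P : ℂ) =
      A P / (w P : ℂ) - (∑ R ∈ T, A R) / ((∑ R ∈ T, w R : ℝ) : ℂ) := by
  classical
  generalize hN : T.card = N
  induction N using Nat.strong_induction_on generalizing T with
  | _ N ih =>
    have hc := card_halves order hn hm T
    have hu := halves_union hm T
    have hd := disjoint_halves hn T
    have hsub1 : (halves order T).1 ⊆ T := fun R hR => hu ▸ Finset.mem_union_left _ hR
    have hsub2 : (halves order T).2 ⊆ T := fun R hR => hu ▸ Finset.mem_union_right _ hR
    have hw1 : 0 < ∑ R ∈ (halves order T).1, w R :=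
      Finset.sum_pos (fun R hR => hw R (hsub1 hR)) (Finset.card_pos.1 (by omega))
    have hw2 : 0 < ∑ R ∈ (halves order T).2, w R :=
      Finset.sum_pos (fun R hR => hw R (hsub2 hR)) (Finset.card_pos.1 (by omega))
    have hwT : ∑ R ∈ T, w R = ∑ R ∈ (halves order T).1, w R + ∑ R ∈ (halves order T).2, w R := by
      rw [← Finset.sum_union hd, hu]
    have hAT : ∑ R ∈ T, A R = ∑ R ∈ (halves order T).1, A R + ∑ R ∈ (halves order T).2, A R := by
      rw [← Finset.sum_union hd, hu]
    -- The half containing P contributes the rest of the telescoping sum. If that half is {P}, there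
    -- are no further cuts and both averages coincide.
    have key : ∀ R : Finset α, P ∈ R → R.card < N → R ⊆ T →
        ∑ S ∈ properPairs order R, haarSum w A S * (haarValue w S P : ℂ) =
          A P / (w P : ℂ) - (∑ R ∈ R, A R) / ((∑ R ∈ R, w R : ℝ) : ℂ) := by
      intro R hR hRc hRT
      rw [properPairs]
      split_ifs with h
      · exact ih R.card hRc R (fun P hP => hw P (hRT hP)) h hR rfl
      · obtain ⟨Q, rfl⟩ := Finset.card_eq_one.1
          (show R.card = 1 from by have := Finset.card_pos.2 ⟨P, hR⟩; omega)
        rw [Finset.mem_singleton] at hR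
        subst hR
        simp
    rcases sum_haarPairs_of_mem hn hm hT hP (fun S => haarSum w A S * (haarValue w S P : ℂ))
      (fun S h h' => by simp [haarValue_eq_zero w h h']) with ⟨h, h', he⟩ | ⟨h, h', he⟩ <;> rw [he]
    · rw [key _ h (by omega) hsub1, haarSum_mul_haarValue_left A h h' hw1 hw2, hwT, hAT]
      ring
    · rw [key _ h (by omega) hsub2, haarSum_mul_haarValue_right A h' h hw1 hw2, hwT, hAT]
      ring

/-- The reproducing identity is applied to cell integrals equal to 1 at P and 0 elsewhere. The Haar
coefficient of S is then the value of the wavelet at P. -/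
theorem sum_haarValue_sq (hn : ∀ T, (order T).Nodup) (hm : ∀ T P, P ∈ order T ↔ P ∈ T)
    {w : α → ℝ} (T : Finset α) (hw : ∀ P ∈ T, 0 < w P) (hT : 2 ≤ T.card) {P : α} (hP : P ∈ T) :
    ∑ S ∈ haarPairs order T, haarValue w S P ^ 2 = 1 / w P - 1 / ∑ R ∈ T, w R := by
  classical
  have h := sum_haarSum_mul_haarValue hn hm (w := w) (fun R => if R = P then 1 else 0) T hw hT hP
  have hv : ∀ S : Finset α × Finset α,
      haarSum w (fun R => if R = P then 1 else 0) S = (haarValue w S P : ℂ) := by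
    intro S
    rw [haarSum, haarValue]
    push_cast
    simp only [Finset.sum_ite_eq']
    split_ifs <;> simp
  simp only [hv, if_true, Finset.sum_ite_eq', if_pos hP] at h
  have h' : ((∑ S ∈ haarPairs order T, haarValue w S P ^ 2 : ℝ) : ℂ) =
      ((1 / w P - 1 / ∑ R ∈ T, w R : ℝ) : ℂ) := by
    push_cast
    push_cast at h
    rw [← h]
    exact Finset.sum_congr rfl fun S _ => sq _
  exact_mod_cast h'

/-- The bound for the sum of the absolute values of all Haar wavelets at a point. -/
theorem sum_abs_haarValue_sq_le (hn : ∀ T, (order T).Nodup)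
    (hm : ∀ T P, P ∈ order T ↔ P ∈ T) {w : α → ℝ} (T : Finset α) (hw : ∀ P ∈ T, 0 < w P)
    (hT : 2 ≤ T.card) {P : α} (hP : P ∈ T) :
    (∑ S ∈ haarPairs order T, |haarValue w S P|) ^ 2 ≤ ((T.card + 1) / 2) * (1 / w P) := by
  classical
  have h1 : ∑ S ∈ haarPairs order T, |haarValue w S P| =
      ∑ S ∈ (haarPairs order T).filter (fun S => P ∈ S.1 ∨ P ∈ S.2), |haarValue w S P| := by
    rw [Finset.sum_filter]
    refine Finset.sum_congr rfl fun S _ => ?_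
    split_ifs with h
    · rfl
    · push Not at h
      simp [haarValue_eq_zero w h.1 h.2]
  have h2 : ∑ S ∈ (haarPairs order T).filter (fun S => P ∈ S.1 ∨ P ∈ S.2), |haarValue w S P| ^ 2
      ≤ 1 / w P := by
    calc _ ≤ ∑ S ∈ haarPairs order T, |haarValue w S P| ^ 2 :=
          Finset.sum_le_sum_of_subset_of_nonneg (Finset.filter_subset _ _)
            fun _ _ _ => by positivity
      _ = 1 / w P - 1 / ∑ R ∈ T, w R := by simp_rw [sq_abs]; exact sum_haarValue_sq hn hm T hw hT hP
      _ ≤ 1 / w P := by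
          have : 0 < ∑ R ∈ T, w R := Finset.sum_pos hw ⟨P, hP⟩
          have : 0 < 1 / ∑ R ∈ T, w R := by positivity
          linarith
  have h3 : (((haarPairs order T).filter fun S => P ∈ S.1 ∨ P ∈ S.2).card : ℝ) ≤
      (T.card + 1) / 2 := by
    have h := card_pairs_of_mem_le hn hm T hT hP
    have h' : 2 * ((haarPairs order T).filter fun S => P ∈ S.1 ∨ P ∈ S.2).card ≤ T.card + 1 := by
      omega
    have h'' : (2 : ℝ) * ((haarPairs order T).filter fun S => P ∈ S.1 ∨ P ∈ S.2).card ≤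
        T.card + 1 := by exact_mod_cast h'
    linarith
  rw [h1]
  -- Cauchy–Schwarz over the pairs that see P only.
  refine sq_sum_le_card_mul_sum_sq.trans ?_
  have : 0 < w P := hw P hP
  gcongr

end pairs

/-! ### Geometry of good grids -/

variable {I : Type*} [MeasurableSpace I] {m : Measure I} {G : Grid m} {l₁ l₂ : ℝ}

open Classical in
/-- The cells of level `k` contained in `Q`. -/
def Grid.below (G : Grid m) (k : ℕ) (Q : Set I) : Finset (Set I) := {P ∈ G.cells k | P ⊆ Q}

theorem Grid.mem_below {k : ℕ} {Q P : Set I} : P ∈ G.below k Q ↔ P ∈ G.cells k ∧ P ⊆ Q := by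
  simp [Grid.below]

theorem Grid.below_univ (k : ℕ) : G.below k Set.univ = G.cells k := by
  ext P; simp [Grid.mem_below]

theorem Grid.nonempty_of_mem {k : ℕ} {Q : Set I} (hQ : Q ∈ G.cells k) : Q.Nonempty :=
  nonempty_of_measure_ne_zero (G.measure_pos k Q hQ).ne'

theorem Grid.measureReal_pos [IsFiniteMeasure m] {k : ℕ} {Q : Set I} (hQ : Q ∈ G.cells k) :
    0 < m.real Q := ENNReal.toReal_pos (G.measure_pos k Q hQ).ne' (measure_ne_top _ _)

theorem Grid.measurableSet_below {k : ℕ} {Q : Set I} : ∀ P ∈ G.below k Q, MeasurableSet P :=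
  fun P hP => G.measurableSet_of_mem k P (Grid.mem_below.1 hP).1

namespace Grid.IsGood

variable (hG : G.IsGood l₁ l₂)
include hG

theorem l₂_pos : 0 < l₂ := hG.pos.trans hG.lt

theorem univ_mem : Set.univ ∈ G.cells 0 := by rw [hG.cells_zero]; exact Finset.mem_singleton_self _

theorem eq_of_inter {k : ℕ} {P Q : Set I} (hP : P ∈ G.cells k) (hQ : Q ∈ G.cells k) {x : I}
    (hxP : x ∈ P) (hxQ : x ∈ Q) : P = Q := by
  by_contra h
  exact Set.disjoint_left.1 (hG.disjoint k P hP Q hQ h) hxP hxQ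

theorem exists_ancestor (k i : ℕ) {Q : Set I} (hQ : Q ∈ G.cells (k + i)) :
    ∃ P ∈ G.cells k, Q ⊆ P := by
  induction i generalizing Q with
  | zero => exact ⟨Q, hQ, subset_rfl⟩
  | succ i ih =>
    obtain ⟨R, hR, hQR⟩ := hG.exists_parent (k + i) Q hQ
    obtain ⟨P, hP, hRP⟩ := ih hR
    exact ⟨P, hP, hQR.trans hRP⟩

theorem subset_of_inter {j k : ℕ} (hjk : j ≤ k) {P Q : Set I} (hP : P ∈ G.cells j)
    (hQ : Q ∈ G.cells k) {x : I} (hxP : x ∈ P) (hxQ : x ∈ Q) : Q ⊆ P := by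
  obtain ⟨i, rfl⟩ := Nat.exists_eq_add_of_le hjk
  obtain ⟨R, hR, hQR⟩ := hG.exists_ancestor j i hQ
  rwa [hG.eq_of_inter hP hR hxP (hQR hxQ)]

theorem measure_le [IsFiniteMeasure m] (k i : ℕ) {P Q : Set I} (hP : P ∈ G.cells k)
    (hQ : Q ∈ G.cells (k + i)) (h : Q ⊆ P) : m Q ≤ ENNReal.ofReal l₂ ^ i * m P := by
  induction i generalizing Q with
  | zero => simpa using measure_mono h
  | succ i ih =>
    obtain ⟨R, hR, hQR⟩ := hG.exists_parent (k + i) Q hQ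
    obtain ⟨x, hx⟩ := Grid.nonempty_of_mem hQ
    have hRP : R ⊆ P := hG.subset_of_inter (Nat.le_add_right k i) hP hR (h hx) (hQR hx)
    have h1 := (hG.ratio (k + i) Q hQ R hR hQR).2
    rw [div_le_iff₀ (Grid.measureReal_pos hR)] at h1
    have h2 : m Q ≤ ENNReal.ofReal l₂ * m R := by
      rw [← ofReal_measureReal (s := Q) (measure_ne_top _ _),
        ← ofReal_measureReal (s := R) (measure_ne_top _ _), ← ENNReal.ofReal_mul hG.l₂_pos.le]
      exact ENNReal.ofReal_le_ofReal h1
    calc m Q ≤ ENNReal.ofReal l₂ * m R := h2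
      _ ≤ ENNReal.ofReal l₂ * (ENNReal.ofReal l₂ ^ i * m P) := by gcongr; exact ih hR hRP
      _ = _ := by ring

theorem mesh_le [IsFiniteMeasure m] (k : ℕ) :
    G.mesh k ≤ ENNReal.ofReal l₂ ^ k * m Set.univ := by
  refine iSup₂_le fun Q hQ => ?_
  refine hG.measure_le 0 k hG.univ_mem ?_ (Set.subset_univ _)
  rwa [zero_add]

/-- Almost every point of Q lies in a cell of level k; this cell meets Q, hence is contained in Q.
Additivity of measures and integrals over descendants rests on this. -/
theorem ae_eq_biUnion_below {j k : ℕ} (hjk : j ≤ k) {Q : Set I} (hQ : Q ∈ G.cells j) :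
    Q =ᵐ[m] ⋃ P ∈ G.below k Q, P := by
  have hsub : (⋃ P ∈ G.below k Q, P) ⊆ Q := Set.iUnion₂_subset fun P hP => (Grid.mem_below.1 hP).2
  have hnull : m (Q \ ⋃ P ∈ G.below k Q, P) = 0 := by
    refine measure_mono_null ?_ (hG.cover k)
    rintro x ⟨hxQ, hx⟩ hxU
    simp only [Set.mem_iUnion, exists_prop] at hxU hx
    obtain ⟨R, hR, hxR⟩ := hxU
    exact hx ⟨R, Grid.mem_below.2 ⟨hR, hG.subset_of_inter hjk hQ hR hxQ hxR⟩, hxR⟩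
  refine Filter.EventuallyLE.antisymm ?_ hsub.eventuallyLE
  exact ae_le_set.2 hnull

theorem pairwiseDisjoint_below (k : ℕ) (Q : Set I) :
    Set.PairwiseDisjoint (↑(G.below k Q)) (fun P : Set I => P) := fun P hP R hR h =>
  hG.disjoint k P (Grid.mem_below.1 hP).1 R (Grid.mem_below.1 hR).1 h

theorem setLIntegral_eq_sum {j k : ℕ} (hjk : j ≤ k) {Q : Set I} (hQ : Q ∈ G.cells j)
    (f : I → ℝ≥0∞) : ∫⁻ x in Q, f x ∂m = ∑ P ∈ G.below k Q, ∫⁻ x in P, f x ∂m := by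
  rw [setLIntegral_congr (hG.ae_eq_biUnion_below hjk hQ),
    lintegral_biUnion_finset (hG.pairwiseDisjoint_below k Q) Grid.measurableSet_below]

theorem setIntegral_eq_sum {j k : ℕ} (hjk : j ≤ k) {Q : Set I} (hQ : Q ∈ G.cells j)
    {f : I → ℂ} (hf : Integrable f m) :
    ∫ x in Q, f x ∂m = ∑ P ∈ G.below k Q, ∫ x in P, f x ∂m := by
  rw [setIntegral_congr_set (hG.ae_eq_biUnion_below hjk hQ),
    integral_biUnion_finset (G.below k Q) Grid.measurableSet_below (hG.pairwiseDisjoint_below k Q)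
      fun P _ => hf.integrableOn]

theorem measureReal_eq_sum [IsFiniteMeasure m] {j k : ℕ} (hjk : j ≤ k) {Q : Set I}
    (hQ : Q ∈ G.cells j) : m.real Q = ∑ P ∈ G.below k Q, m.real P := by
  rw [measureReal_congr (hG.ae_eq_biUnion_below hjk hQ),
    measureReal_biUnion_finset (hG.pairwiseDisjoint_below k Q) Grid.measurableSet_below]

theorem lintegral_eq_sum (k : ℕ) (f : I → ℝ≥0∞) :
    ∫⁻ x, f x ∂m = ∑ P ∈ G.cells k, ∫⁻ x in P, f x ∂m := by
  rw [← setLIntegral_univ, hG.setLIntegral_eq_sum (Nat.zero_le k) hG.univ_mem, Grid.below_univ]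

theorem child_ratio [IsFiniteMeasure m] {k : ℕ} {Q P : Set I} (hQ : Q ∈ G.cells k)
    (hP : P ∈ G.children k Q) : l₁ * m.real Q ≤ m.real P ∧ m.real P ≤ l₂ * m.real Q := by
  have hP := Grid.mem_below.1 hP
  have h := hG.ratio k P hP.1 Q hQ hP.2
  rwa [le_div_iff₀ (Grid.measureReal_pos hQ), div_le_iff₀ (Grid.measureReal_pos hQ)] at h

theorem totalMeasure_children [IsFiniteMeasure m] {k : ℕ} {Q : Set I} (hQ : Q ∈ G.cells k) :
    totalMeasure m (G.children k Q) = m.real Q :=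
  (hG.measureReal_eq_sum (Nat.le_succ k) hQ).symm

theorem one_le_card_children_mul [IsFiniteMeasure m] {k : ℕ} {Q : Set I} (hQ : Q ∈ G.cells k) :
    1 ≤ (G.children k Q).card * l₂ := by
  have h := hG.totalMeasure_children hQ
  have h1 : totalMeasure m (G.children k Q) ≤ (G.children k Q).card • (l₂ * m.real Q) :=
    Finset.sum_le_card_nsmul _ _ _ fun P hP => (hG.child_ratio hQ hP).2
  rw [h, nsmul_eq_mul, ← mul_assoc] at h1
  have := Grid.measureReal_pos hQ
  by_contra! h2
  nlinarith

theorem card_children_mul_le [IsFiniteMeasure m] {k : ℕ} {Q : Set I} (hQ : Q ∈ G.cells k) :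
    (G.children k Q).card * l₁ ≤ 1 := by
  have h := hG.totalMeasure_children hQ
  have h1 : (G.children k Q).card • (l₁ * m.real Q) ≤ totalMeasure m (G.children k Q) :=
    Finset.card_nsmul_le_sum _ _ _ fun P hP => (hG.child_ratio hQ hP).1
  rw [h, nsmul_eq_mul, ← mul_assoc] at h1
  have := Grid.measureReal_pos hQ
  by_contra! h2
  nlinarith

theorem two_le_card_children [IsFiniteMeasure m] {k : ℕ} {Q : Set I} (hQ : Q ∈ G.cells k) :
    2 ≤ (G.children k Q).card := by
  have h := hG.one_le_card_children_mul hQ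
  have h2 := hG.l₂_pos
  have h3 := hG.lt_one
  by_contra! hc
  have h4 : ((G.children k Q).card : ℝ) ≤ 1 := by exact_mod_cast Nat.lt_succ_iff.1 hc
  nlinarith

/-- Cells of one level are nonempty and pairwise disjoint, so each meets only itself and the factor
M^{1+1/p} equals 1. -/
theorem overlap_eq : G.overlap = 1 := by
  have h1 : ∀ k, ∀ Q ∈ G.cells k,
      {P ∈ (G.cells k : Set (Set I)) | (P ∩ Q).Nonempty} = {Q} := by
    intro k Q hQ
    ext P
    simp only [Set.mem_ofPred_eq, Finset.mem_coe, Set.mem_singleton_iff]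
    constructor
    · rintro ⟨hP, x, hxP, hxQ⟩
      exact hG.eq_of_inter hP hQ hxP hxQ
    · rintro rfl
      exact ⟨hQ, by simpa using Grid.nonempty_of_mem hQ⟩
  apply le_antisymm
  · refine iSup_le fun k => iSup₂_le fun Q hQ => ?_
    rw [h1 k Q hQ]
    simp
  · refine le_trans ?_ (le_iSup₂_of_le 0 Set.univ (le_iSup_of_le hG.univ_mem le_rfl))
    rw [h1 0 _ hG.univ_mem]
    simp

theorem ofReal_l₂_rpow_lt_one {s : ℝ} (hs : 0 < s) : ENNReal.ofReal l₂ ^ s < 1 :=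
  ENNReal.rpow_lt_one (by simpa using hG.lt_one) hs

theorem mesh_rpow_le [IsFiniteMeasure m] {r : ℝ} (hr : 0 ≤ r) (k : ℕ) :
    G.mesh k ^ r ≤ (ENNReal.ofReal l₂ ^ r) ^ k * m Set.univ ^ r := by
  calc G.mesh k ^ r ≤ (ENNReal.ofReal l₂ ^ k * m Set.univ) ^ r := by gcongr; exact hG.mesh_le k
    _ = _ := by
      rw [ENNReal.mul_rpow_of_nonneg _ _ hr, ← ENNReal.rpow_natCast, ← ENNReal.rpow_natCast,
        ← ENNReal.rpow_mul, ← ENNReal.rpow_mul, mul_comm r]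

theorem tsum_mesh_rpow_lt_top [IsFiniteMeasure m] {r : ℝ} (hr : 0 < r) :
    ∑' k, G.mesh k ^ r < ∞ := by
  refine (ENNReal.tsum_le_tsum fun k => hG.mesh_rpow_le hr.le k).trans_lt ?_
  rw [ENNReal.tsum_mul_right, ENNReal.tsum_geometric]
  refine ENNReal.mul_lt_top ?_ (ENNReal.rpow_lt_top_of_nonneg hr.le (measure_ne_top _ _))
  rw [ENNReal.inv_lt_top, tsub_pos_iff_lt]
  exact hG.ofReal_l₂_rpow_lt_one hr

/-- The mesh is at most λ₂^k |I|, so every positive power of it is summable; for q = 1 the bound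
|I|^s suffices. -/
theorem holderConst_lt_top [IsFiniteMeasure m] {s p : ℝ} (hs : 0 < s) (hp : 1 ≤ p) {q : ℝ≥0∞}
    (hq : 1 ≤ q) : holderConst p q (fun k => G.mesh k ^ (s * p)) < ∞ := by
  have hp0 : 0 < p := by linarith
  rw [holderConst]
  split_ifs with h
  · refine lt_of_le_of_lt (iSup_le fun k => ?_)
      (ENNReal.rpow_lt_top_of_nonneg hs.le (measure_ne_top m Set.univ))
    rw [← ENNReal.rpow_mul, mul_assoc, mul_one_div_cancel hp0.ne', mul_one]
    gcongr
    exact iSup₂_le fun Q _ => measure_mono (Set.subset_univ _)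
  -- Here q > 1 is what keeps the conjugate exponent finite; at ∞ its `toReal` would be 0.
  · have hc : 0 < q.conjExponent.toReal := by
      refine ENNReal.toReal_pos ?_ ?_
      · simp [ENNReal.conjExponent]
      · simp only [ENNReal.conjExponent, ne_eq, ENNReal.add_eq_top, ENNReal.one_ne_top,
          ENNReal.inv_eq_top, false_or, tsub_eq_zero_iff_le, not_le]
        exact lt_of_le_of_ne hq (Ne.symm h)
    simp_rw [← ENNReal.rpow_mul]
    refine ENNReal.rpow_lt_top_of_nonneg (by positivity) (hG.tsum_mesh_rpow_lt_top ?_).ne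
    positivity

theorem measure_univ_pos : 0 < m Set.univ := G.measure_pos 0 _ hG.univ_mem

theorem oscConst_lt_top [IsFiniteMeasure m] {s p : ℝ} (hs : 0 < s) (hp : 1 ≤ p) {q : ℝ≥0∞}
    (hq : 1 ≤ q) : G.oscConst l₂ s p q < ∞ := by
  rw [Grid.oscConst, hG.overlap_eq, ENNReal.one_rpow, one_mul]
  refine ENNReal.add_lt_top.2 ⟨ENNReal.mul_lt_top (hG.holderConst_lt_top hs hp hq) ?_,
    ENNReal.ofReal_lt_top⟩
  exact (ENNReal.rpow_ne_top_of_ne_zero hG.measure_univ_pos.ne' (measure_ne_top _ _)).lt_top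

end Grid.IsGood

/-! ### Averages over the cells of one level -/

/-- The average of `f` over `Q`. -/
def cellAverage (m : Measure I) (f : I → ℂ) (Q : Set I) : ℂ := (∫ x in Q, f x ∂m) / (m.real Q : ℂ)

/-- The function that is equal on every cell of level `n` to the average of `f` over that cell. -/
def Grid.average (G : Grid m) (f : I → ℂ) (n : ℕ) (x : I) : ℂ :=
  ∑ Q ∈ G.cells n, Q.indicator (fun _ => cellAverage m f Q) x

theorem Grid.measurable_average (f : I → ℂ) (n : ℕ) : Measurable (G.average f n) :=
  Finset.measurable_fun_sum _ fun Q hQ => measurable_const.indicator (G.measurableSet_of_mem n Q hQ)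

theorem Grid.average_add {f g : I → ℂ} (hf : Integrable f m) (hg : Integrable g m) (n : ℕ) (x : I) :
    G.average (fun x => f x + g x) n x = G.average f n x + G.average g n x := by
  simp only [Grid.average, ← Finset.sum_add_distrib]
  refine Finset.sum_congr rfl fun Q _ => ?_
  have : cellAverage m (fun x => f x + g x) Q = cellAverage m f Q + cellAverage m g Q := by
    rw [cellAverage, integral_add hf.integrableOn hg.integrableOn, add_div]; rfl
  by_cases hx : x ∈ Q <;> simp [hx, this]

theorem Grid.average_neg (f : I → ℂ) (n : ℕ) (x : I) :
    G.average (fun x => -f x) n x = -G.average f n x := by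
  simp only [Grid.average, ← Finset.sum_neg_distrib]
  refine Finset.sum_congr rfl fun Q _ => ?_
  have : cellAverage m (fun x => -f x) Q = -cellAverage m f Q := by
    rw [cellAverage, integral_neg, neg_div]; rfl
  by_cases hx : x ∈ Q <;> simp [hx, this]

theorem Grid.average_sub {f g : I → ℂ} (hf : Integrable f m) (hg : Integrable g m) (n : ℕ) (x : I) :
    G.average (fun x => f x - g x) n x = G.average f n x - G.average g n x := by
  simp only [sub_eq_add_neg]
  rw [← Grid.average_neg]
  exact Grid.average_add hf hg.neg n x

theorem Grid.average_congr_ae {f g : I → ℂ} (h : f =ᵐ[m] g) (n : ℕ) :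
    G.average f n = G.average g n := by
  have : ∀ Q, cellAverage m f Q = cellAverage m g Q := fun Q => by
    rw [cellAverage, cellAverage, integral_congr_ae (ae_restrict_of_ae h)]
  ext x
  simp only [Grid.average, this]

/-- The averages of `f` converge to `f` in `L¹`. -/
def Grid.AverageTendsto (G : Grid m) (f : I → ℂ) : Prop :=
  Tendsto (fun n => eLpNorm (fun x => G.average f n x - f x) 1 m) atTop (𝓝 0)

theorem Grid.averageTendsto_add {f g : I → ℂ} (hf : Integrable f m) (hg : Integrable g m)
    (hf' : G.AverageTendsto f) (hg' : G.AverageTendsto g) :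
    G.AverageTendsto fun x => f x + g x := by
  have h := Tendsto.add hf' hg'
  rw [add_zero] at h
  refine tendsto_of_tendsto_of_tendsto_of_le_of_le tendsto_const_nhds h
    (fun _ => zero_le) fun n => ?_
  have : (fun x => G.average (fun x => f x + g x) n x - (f x + g x)) =
      (fun x => G.average f n x - f x) + fun x => G.average g n x - g x := by
    ext x
    rw [Grid.average_add hf hg, Pi.add_apply]
    ring
  rw [this]
  exact eLpNorm_add_le (((Grid.measurable_average f n).aestronglyMeasurable).sub hf.1)
    (((Grid.measurable_average g n).aestronglyMeasurable).sub hg.1) le_rfl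

theorem Grid.averageTendsto_neg {f : I → ℂ} (hf' : G.AverageTendsto f) :
    G.AverageTendsto fun x => -f x := by
  refine hf'.congr fun n => ?_
  rw [← eLpNorm_neg]
  congr 1
  ext x
  rw [Pi.neg_apply, Grid.average_neg]
  ring

namespace Grid.IsGood

variable (hG : G.IsGood l₁ l₂)
include hG

theorem sum_indicator_eq {E : Type*} [AddCommMonoid E] {n : ℕ} {Q : Set I} (hQ : Q ∈ G.cells n)
    {x : I} (hx : x ∈ Q) (v : Set I → E) :
    ∑ R ∈ G.cells n, R.indicator (fun _ => v R) x = v Q := by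
  rw [Finset.sum_eq_single_of_mem Q hQ, Set.indicator_of_mem hx]
  intro R hR hne
  exact Set.indicator_of_notMem (fun h => hne (hG.eq_of_inter hR hQ h hx)) _

theorem average_eq {f : I → ℂ} {n : ℕ} {Q : Set I} (hQ : Q ∈ G.cells n) {x : I} (hx : x ∈ Q) :
    G.average f n x = cellAverage m f Q := hG.sum_indicator_eq hQ hx _

theorem ae_exists_mem (n : ℕ) : ∀ᵐ x ∂m, ∃ Q ∈ G.cells n, x ∈ Q := by
  have h := measure_eq_zero_iff_ae_notMem.1 (hG.cover n)
  filter_upwards [h] with x hx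
  simpa using hx

/-- On each cell, the average times the measure is the integral, so averaging is a contraction of
L¹, uniformly in the level. -/
theorem eLpNorm_average_le [IsFiniteMeasure m] (f : I → ℂ) (n : ℕ) :
    eLpNorm (G.average f n) 1 m ≤ eLpNorm f 1 m := by
  rw [eLpNorm_one_eq_lintegral_enorm, eLpNorm_one_eq_lintegral_enorm, hG.lintegral_eq_sum n,
    hG.lintegral_eq_sum n]
  refine Finset.sum_le_sum fun Q hQ => ?_
  have h1 : ∫⁻ x in Q, ‖G.average f n x‖ₑ ∂m = ∫⁻ x in Q, ‖cellAverage m f Q‖ₑ ∂m :=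
    setLIntegral_congr_fun (G.measurableSet_of_mem n Q hQ) fun x hx => by
      simp only [hG.average_eq hQ hx]
  rw [h1, setLIntegral_const]
  have h2 : ‖cellAverage m f Q‖ₑ * m Q = ‖∫ x in Q, f x ∂m‖ₑ := by
    have h3 : m Q = ‖(m.real Q : ℂ)‖ₑ := by
      rw [← ofReal_norm, Complex.norm_real, Real.norm_of_nonneg measureReal_nonneg,
        ofReal_measureReal (measure_ne_top _ _)]
    rw [h3, ← enorm_mul, cellAverage, div_mul_cancel₀]
    exact_mod_cast (Grid.measureReal_pos hQ).ne'
  rw [h2]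
  exact enorm_integral_le_lintegral_enorm _

/-- An ε/3 argument: contractivity makes the class of functions with convergent averages closed in
L¹. -/
theorem averageTendsto_of_tendsto [IsFiniteMeasure m] {f : I → ℂ} {g : ℕ → I → ℂ}
    (hf : Integrable f m) (hg : ∀ j, Integrable (g j) m) (hg' : ∀ j, G.AverageTendsto (g j))
    (h : Tendsto (fun j => eLpNorm (fun x => f x - g j x) 1 m) atTop (𝓝 0)) :
    G.AverageTendsto f := by
  rw [Grid.AverageTendsto, ENNReal.tendsto_nhds_zero]
  intro ε hε
  have hε3 : 0 < ε / 3 := ENNReal.div_pos hε.ne' (by simp)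
  obtain ⟨j, hj⟩ := ((ENNReal.tendsto_nhds_zero.1 h) (ε / 3) hε3).exists
  filter_upwards [(ENNReal.tendsto_nhds_zero.1 (hg' j)) (ε / 3) hε3] with n hn
  have hd : (fun x => G.average f n x - f x) = (G.average (fun x => f x - g j x) n +
      fun x => G.average (g j) n x - g j x) - fun x => f x - g j x := by
    ext x
    rw [Pi.sub_apply, Pi.add_apply, Grid.average_sub hf (hg j)]
    ring
  have hm1 : AEStronglyMeasurable (G.average (fun x => f x - g j x) n) m :=
    (Grid.measurable_average _ n).aestronglyMeasurable
  have hm2 : AEStronglyMeasurable (fun x => G.average (g j) n x - g j x) m :=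
    ((Grid.measurable_average (g j) n).aestronglyMeasurable).sub (hg j).1
  rw [hd]
  calc _ ≤ eLpNorm (G.average (fun x => f x - g j x) n) 1 m +
        eLpNorm (fun x => G.average (g j) n x - g j x) 1 m +
        eLpNorm (fun x => f x - g j x) 1 m :=
      (eLpNorm_sub_le (hm1.add hm2) (hf.1.sub (hg j).1) le_rfl).trans
        (add_le_add (eLpNorm_add_le hm1 hm2 le_rfl) le_rfl)
    _ ≤ ε / 3 + ε / 3 + ε / 3 :=
        add_le_add (add_le_add ((hG.eLpNorm_average_le _ n).trans hj) hn) hj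
    _ = ε := ENNReal.add_thirds ε

/-- From level k on, every cell is either contained in Q or disjoint from it, so averaging
reproduces the function almost everywhere. -/
theorem averageTendsto_cell [IsFiniteMeasure m] {k : ℕ} {Q : Set I} (hQ : Q ∈ G.cells k) (c : ℂ) :
    G.AverageTendsto (Q.indicator fun _ => c) := by
  refine tendsto_const_nhds.congr' ?_
  filter_upwards [eventually_ge_atTop k] with n hn
  symm
  refine (eLpNorm_eq_zero_iff (Measurable.aestronglyMeasurable ((Grid.measurable_average _ n).sub
    (measurable_const.indicator (G.measurableSet_of_mem k Q hQ)))) one_ne_zero).2 ?_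
  filter_upwards [hG.ae_exists_mem n] with x hx
  obtain ⟨R, hR, hxR⟩ := hx
  rw [Pi.sub_apply, hG.average_eq hR hxR, cellAverage, Pi.zero_apply]
  by_cases hxQ : x ∈ Q
  · have hRQ := hG.subset_of_inter hn hQ hR hxQ hxR
    have h1 : ∫ y in R, Q.indicator (fun _ => c) y ∂m = ∫ y in R, c ∂m :=
      setIntegral_congr_fun (G.measurableSet_of_mem n R hR) fun y hy => by simp [hRQ hy]
    rw [h1, Set.indicator_of_mem hxQ, setIntegral_const, Complex.real_smul, mul_div_cancel_left₀,
      sub_self]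
    exact_mod_cast (Grid.measureReal_pos hR).ne'
  · have h1 : ∫ y in R, Q.indicator (fun _ => c) y ∂m = ∫ y in R, (0 : ℂ) ∂m :=
      setIntegral_congr_fun (G.measurableSet_of_mem n R hR) fun y hy => by
        have : y ∉ Q := fun hy' => hxQ (hG.subset_of_inter hn hQ hR hy' hy hxR)
        simp [this]
    rw [h1, Set.indicator_of_notMem hxQ]
    simp

theorem isPiSystem_cells : IsPiSystem (⋃ k, (G.cells k : Set (Set I))) := by
  have key : ∀ j k, j ≤ k → ∀ P ∈ G.cells j, ∀ Q ∈ G.cells k, (P ∩ Q).Nonempty → P ∩ Q = Q := by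
    rintro j k hjk P hP Q hQ ⟨x, hxP, hxQ⟩
    exact Set.inter_eq_right.2 (hG.subset_of_inter hjk hP hQ hxP hxQ)
  intro P hP Q hQ hne
  obtain ⟨j, hP⟩ := Set.mem_iUnion.1 hP
  obtain ⟨k, hQ⟩ := Set.mem_iUnion.1 hQ
  rcases le_total j k with h | h
  · rw [key j k h P hP Q hQ hne]
    exact Set.mem_iUnion.2 ⟨k, hQ⟩
  · rw [Set.inter_comm, key k j h Q hQ P hP (by rwa [Set.inter_comm])]
    exact Set.mem_iUnion.2 ⟨j, hP⟩

/-- Dynkin's π-λ theorem: the cells, being nested or disjoint, form a π-system generating the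
σ-algebra, and the sets in question are stable under complements and countable disjoint unions. -/
theorem averageTendsto_indicator [IsFiniteMeasure m] {t : Set I} (ht : MeasurableSet t) (c : ℂ) :
    G.AverageTendsto (t.indicator fun _ => c) := by
  have hint : ∀ {t : Set I}, MeasurableSet t → Integrable (t.indicator fun _ => c) m :=
    fun ht => (integrable_const c).indicator ht
  refine MeasurableSpace.induction_on_inter
    (C := fun t _ => G.AverageTendsto (t.indicator fun _ => c)) hG.generate hG.isPiSystem_cells
    ?_ ?_ ?_ ?_ t ht
  · refine tendsto_const_nhds.congr fun n => ?_
    simp [Grid.average, cellAverage]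
  · intro t ht
    obtain ⟨k, hk⟩ := Set.mem_iUnion.1 ht
    exact hG.averageTendsto_cell hk c
  · intro t ht h
    -- The indicator of the complement is that of the whole space, a cell of level 0, minus that of
    -- t.
    have h1 := Grid.averageTendsto_add (hint MeasurableSet.univ) (hint ht).neg
      (hG.averageTendsto_cell hG.univ_mem c) (Grid.averageTendsto_neg h)
    convert h1 using 1
    ext x
    by_cases hx : x ∈ t <;> simp [hx]
  · intro f hd hm h
    have hfin : ∀ N, Integrable (fun x => ∑ i ∈ Finset.range N, (f i).indicator (fun _ => c) x) m ∧
        G.AverageTendsto fun x => ∑ i ∈ Finset.range N, (f i).indicator (fun _ => c) x := by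
      intro N
      induction N with
      | zero =>
        refine ⟨by simp, tendsto_const_nhds.congr fun n => ?_⟩
        simp [Grid.average, cellAverage]
      | succ N ih =>
        simp only [Finset.sum_range_succ]
        exact ⟨ih.1.add (hint (hm N)), Grid.averageTendsto_add ih.1 (hint (hm N)) ih.2 (h N)⟩
    refine hG.averageTendsto_of_tendsto (hint (MeasurableSet.iUnion hm)) (fun N => (hfin N).1)
      (fun N => (hfin N).2) ?_
    -- The L¹ distance from the N-th partial sum to the indicator of the union is |c| times the
    -- measure of the remaining sets.
    have h0 := tendsto_measure_biUnion_Ici_zero_of_pairwise_disjoint (μ := m)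
      (fun i => (hm i).nullMeasurableSet) hd
    have h1 : Tendsto (fun n => ‖c‖ₑ * m (⋃ i ≥ n, f i)) atTop (𝓝 0) := by
      have := ENNReal.Tendsto.const_mul (a := ‖c‖ₑ) h0 (Or.inr enorm_ne_top)
      rwa [mul_zero] at this
    refine h1.congr fun N => ?_
    have h2 : (fun x => (⋃ i, f i).indicator (fun _ => c) x -
        ∑ i ∈ Finset.range N, (f i).indicator (fun _ => c) x) =
        (⋃ i ≥ N, f i).indicator fun _ => c := by
      ext x
      by_cases hx : ∃ i, x ∈ f i
      · obtain ⟨i, hi⟩ := hx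
        have huniq : ∀ j, x ∈ f j → j = i := fun j hj => by
          by_contra hne
          exact Set.disjoint_left.1 (hd hne) hj hi
        rw [Set.indicator_of_mem (Set.mem_iUnion.2 ⟨i, hi⟩)]
        by_cases hiN : i < N
        · rw [Finset.sum_eq_single_of_mem i (Finset.mem_range.2 hiN), Set.indicator_of_mem hi,
            Set.indicator_of_notMem, sub_self]
          · simp only [Set.mem_iUnion, exists_prop, not_exists, not_and]
            intro j hj hxj
            have := huniq j hxj
            omega
          · intro j _ hne
            exact Set.indicator_of_notMem (fun hj => hne (huniq j hj)) _
        · rw [Finset.sum_eq_zero, sub_zero, Set.indicator_of_mem]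
          · simp only [Set.mem_iUnion, exists_prop]
            exact ⟨i, not_lt.1 hiN, hi⟩
          · intro j hj
            refine Set.indicator_of_notMem (fun hxj => ?_) _
            have := huniq j hxj
            rw [Finset.mem_range] at hj
            omega
      · push Not at hx
        simp [hx]
    rw [h2, eLpNorm_one_eq_lintegral_enorm]
    simp_rw [enorm_indicator_eq_indicator_enorm]
    rw [lintegral_indicator_const (MeasurableSet.iUnion fun i => MeasurableSet.iUnion fun _ => hm i)]

theorem averageTendsto [IsFiniteMeasure m] {f : I → ℂ} (hf : Integrable f m) :
    G.AverageTendsto f := by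
  refine Integrable.induction (fun f => G.AverageTendsto f) ?_ ?_ ?_ ?_ hf
  · intro c t ht _
    exact hG.averageTendsto_indicator ht c
  · intro f g _ hf hg hf' hg'
    exact Grid.averageTendsto_add hf hg hf' hg'
  · refine IsSeqClosed.isClosed fun u f hu h => ?_
    have h1 := (Lp.tendsto_Lp_iff_tendsto_eLpNorm' u f).1 h
    refine hG.averageTendsto_of_tendsto (L1.integrable_coeFn f) (fun j => L1.integrable_coeFn (u j))
      hu (h1.congr fun j => ?_)
    rw [← eLpNorm_neg]
    congr 1
    ext x
    simp
  · intro f g hfg hf h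
    refine h.congr fun n => ?_
    rw [Grid.average_congr_ae hfg]
    refine eLpNorm_congr_ae ?_
    filter_upwards [hfg] with x hx
    rw [hx]

theorem exists_subseq_average_tendsto [IsFiniteMeasure m] {f : I → ℂ} (hf : Integrable f m) :
    ∃ ns : ℕ → ℕ, StrictMono ns ∧
      ∀ᵐ x ∂m, Tendsto (fun i => G.average f (ns i) x) atTop (𝓝 (f x)) :=
  (tendstoInMeasure_of_tendsto_eLpNorm one_ne_zero
    (fun n => (Grid.measurable_average f n).aestronglyMeasurable) hf.1
    (hG.averageTendsto hf)).exists_seq_tendsto_ae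

end Grid.IsGood

/-! ### Atomic representations -/

theorem eLpNorm_ofReal_eq {p : ℝ} (hp : 1 ≤ p) (f : I → ℂ) (μ : Measure I) :
    eLpNorm f (ENNReal.ofReal p) μ = (∫⁻ x, ‖f x‖ₑ ^ p ∂μ) ^ (1 / p) := by
  have hp0 : 0 < p := by linarith
  rw [eLpNorm_eq_lintegral_rpow_enorm_toReal (by simpa using hp0) ENNReal.ofReal_ne_top,
    ENNReal.toReal_ofReal hp0.le]

theorem one_le_ofReal {p : ℝ} (hp : 1 ≤ p) : 1 ≤ ENNReal.ofReal p := by simpa using hp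

theorem enorm_measureReal_rpow [IsFiniteMeasure m] {Q : Set I} (hQ : 0 < m Q) (r : ℝ) :
    ‖((m.real Q ^ r : ℝ) : ℂ)‖ₑ = m Q ^ r := by
  have h : 0 < m.real Q := ENNReal.toReal_pos hQ.ne' (measure_ne_top _ _)
  rw [← ofReal_norm, Complex.norm_real, Real.norm_of_nonneg (by positivity),
    ← ENNReal.ofReal_rpow_of_pos h, ofReal_measureReal (measure_ne_top _ _)]

/-- The canonical Souza's atom on `Q`. -/
def canonicalAtom (m : Measure I) (s p : ℝ) (Q : Set I) : I → ℂ :=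
  Q.indicator fun _ => ((m.real Q ^ (s - 1 / p) : ℝ) : ℂ)

theorem isSouzaAtom_canonicalAtom [IsFiniteMeasure m] (s p : ℝ) {k : ℕ} {Q : Set I}
    (hQ : Q ∈ G.cells k) : IsSouzaAtom m s p Q (canonicalAtom m s p Q) where
  eq_zero x hx := Set.indicator_of_notMem hx _
  const := ⟨_, fun x hx => Set.indicator_of_mem hx _⟩
  norm_le := by
    rw [eLpNorm_exponent_top, canonicalAtom, ← enorm_measureReal_rpow (G.measure_pos k Q hQ)]
    exact eLpNormEssSup_indicator_const_le _ _

/-- The `k`-th block of the series of multiples of canonical atoms. -/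
abbrev Grid.canonicalBlock (G : Grid m) (s p : ℝ) (c : Set I → ℂ) (k : ℕ) (x : I) : ℂ :=
  G.block c (canonicalAtom m s p) k x

theorem Grid.measurable_canonicalBlock (s p : ℝ) (c : Set I → ℂ) (k : ℕ) :
    Measurable (G.canonicalBlock s p c k) :=
  Finset.measurable_fun_sum _ fun Q hQ =>
    measurable_const.mul (measurable_const.indicator (G.measurableSet_of_mem k Q hQ))

/-- The atom is bounded only essentially, but Q has positive measure and the atom is constant there,
so the bound holds at every point of Q. -/
theorem norm_value_le {s p : ℝ} {k : ℕ} {Q : Set I} (hQ : Q ∈ G.cells k) {a : I → ℂ}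
    (ha : IsSouzaAtom m s p Q a) {x : I} (hx : x ∈ Q) : ‖a x‖ₑ ≤ m Q ^ (s - 1 / p) := by
  obtain ⟨v, hv⟩ := ha.const
  have h1 : ∀ᵐ y ∂m, ‖a y‖ₑ ≤ eLpNorm a ∞ m := by
    rw [eLpNorm_exponent_top]
    exact enorm_ae_le_eLpNormEssSup a m
  have h2 : ∃ y ∈ Q, ‖a y‖ₑ ≤ eLpNorm a ∞ m := by
    by_contra! h
    have : m Q = 0 := measure_mono_null (fun y hy => not_le.2 (h y hy)) (ae_iff.1 h1)
    exact (G.measure_pos k Q hQ).ne' this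
  obtain ⟨y, hy, h⟩ := h2
  rw [hv x hx, ← hv y hy]
  exact h.trans ha.norm_le

/-- Each atom is its value on Q times an indicator, hence a multiple, of modulus at most 1, of the
canonical atom. Absorbing the multiple into the coefficient leaves the blocks unchanged and does not
raise the cost. -/
theorem Grid.IsRepresentation.exists_canonical [IsFiniteMeasure m] {s p : ℝ} {c : Set I → ℂ}
    {a : Set I → I → ℂ} {f : I → ℂ} (h : G.IsRepresentation s p c a f) :
    ∃ c' : Set I → ℂ, (∀ k, ∀ Q ∈ G.cells k, ‖c' Q‖ₑ ≤ ‖c Q‖ₑ) ∧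
      G.IsRepresentation s p c' (canonicalAtom m s p) f := by
  classical
  let v : Set I → ℂ := fun Q => if h : Q.Nonempty then a Q h.some else 0
  have hv : ∀ k, ∀ Q ∈ G.cells k, ‖v Q‖ₑ ≤ m Q ^ (s - 1 / p) ∧ a Q = Q.indicator fun _ => v Q := by
    intro k Q hQ
    have hne := Grid.nonempty_of_mem hQ
    have hvQ : v Q = a Q hne.some := dif_pos hne
    refine ⟨by rw [hvQ]; exact norm_value_le hQ (h.atom k Q hQ) hne.some_mem, ?_⟩
    obtain ⟨w, hw⟩ := (h.atom k Q hQ).const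
    ext x
    by_cases hx : x ∈ Q
    · rw [Set.indicator_of_mem hx, hvQ, hw x hx, hw _ hne.some_mem]
    · rw [Set.indicator_of_notMem hx, (h.atom k Q hQ).eq_zero x hx]
  let c' : Set I → ℂ := fun Q => c Q * v Q / ((m.real Q ^ (s - 1 / p) : ℝ) : ℂ)
  have hblock : ∀ k, G.block c' (canonicalAtom m s p) k = G.block c a k := by
    intro k
    ext x
    refine Finset.sum_congr rfl fun Q hQ => ?_
    rw [(hv k Q hQ).2, canonicalAtom]
    by_cases hx : x ∈ Q
    · rw [Set.indicator_of_mem hx, Set.indicator_of_mem hx]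
      refine div_mul_cancel₀ _ ?_
      exact_mod_cast (Real.rpow_pos_of_pos (Grid.measureReal_pos hQ) _).ne'
    · rw [Set.indicator_of_notMem hx, Set.indicator_of_notMem hx, mul_zero, mul_zero]
  refine ⟨c', fun k Q hQ => ?_, fun k Q hQ => isSouzaAtom_canonicalAtom s p hQ, ?_, ?_⟩
  · have hpos := G.measure_pos k Q hQ
    have hne : m Q ^ (s - 1 / p) ≠ 0 :=
      (ENNReal.rpow_pos hpos (measure_ne_top _ _)).ne'
    have hnt : m Q ^ (s - 1 / p) ≠ ∞ := ENNReal.rpow_ne_top_of_ne_zero hpos.ne' (measure_ne_top _ _)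
    have hmul : c' Q * ((m.real Q ^ (s - 1 / p) : ℝ) : ℂ) = c Q * v Q := by
      refine div_mul_cancel₀ _ ?_
      exact_mod_cast (Real.rpow_pos_of_pos (Grid.measureReal_pos hQ) _).ne'
    have hmul' := congrArg (fun z : ℂ => ‖z‖ₑ) hmul
    simp only [enorm_mul, enorm_measureReal_rpow hpos] at hmul'
    refine (ENNReal.mul_le_mul_iff_left hne hnt).1 ?_
    rw [hmul']
    gcongr
    exact (hv k Q hQ).1
  · simpa only [hblock] using h.abs_conv
  · simpa only [hblock] using h.tendsto

theorem Grid.cost_mono {p : ℝ} (hp : 1 ≤ p) {q : ℝ≥0∞} {c c' : Set I → ℂ}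
    (h : ∀ k, ∀ Q ∈ G.cells k, ‖c' Q‖ₑ ≤ ‖c Q‖ₑ) : G.cost p q c' ≤ G.cost p q c :=
  lqNorm_mono fun k => lpSum_mono _ hp (h k)

/-- The weighted measure `∑_{Q ∈ P^k} |Q|^{-sp} m|_Q`. -/
def Grid.levelMeasure (G : Grid m) (s p : ℝ) (k : ℕ) : Measure I :=
  ∑ Q ∈ G.cells k, m Q ^ (-(s * p)) • m.restrict Q

theorem Grid.lintegral_levelMeasure (s p : ℝ) (k : ℕ) (f : I → ℝ≥0∞) :
    ∫⁻ x, f x ∂(G.levelMeasure s p k) =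
      ∑ Q ∈ G.cells k, m Q ^ (-(s * p)) * ∫⁻ x in Q, f x ∂m := by
  rw [Grid.levelMeasure, lintegral_finsetSum_measure]
  simp only [lintegral_smul_measure, smul_eq_mul]

theorem Grid.levelMeasure_absolutelyContinuous (s p : ℝ) (k : ℕ) : G.levelMeasure s p k ≪ m := by
  intro t ht
  rw [Grid.levelMeasure, Measure.coe_finsetSum, Finset.sum_apply]
  refine Finset.sum_eq_zero fun Q _ => ?_
  rw [Measure.smul_apply, Measure.restrict_le_self.absolutelyContinuous ht, smul_zero]

/-- Only the finiteness of C matters: convergence in L^p(m) then implies convergence in L^p of the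
weighted measure. -/
theorem Grid.eLpNorm_levelMeasure_le [IsFiniteMeasure m] (s : ℝ) {p : ℝ} (hp : 1 ≤ p) (k : ℕ) :
    ∃ C : ℝ≥0∞, C ≠ ∞ ∧ ∀ h : I → ℂ, eLpNorm h (ENNReal.ofReal p) (G.levelMeasure s p k) ≤
      C * eLpNorm h (ENNReal.ofReal p) m := by
  have hp0 : 0 < p := by linarith
  refine ⟨(∑ Q ∈ G.cells k, m Q ^ (-(s * p))) ^ (1 / p), ?_, fun h => ?_⟩
  · refine ENNReal.rpow_ne_top_of_nonneg (by positivity) (ENNReal.sum_ne_top.2 fun Q hQ => ?_)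
    exact ENNReal.rpow_ne_top_of_ne_zero (G.measure_pos k Q hQ).ne' (measure_ne_top _ _)
  · rw [eLpNorm_ofReal_eq hp, eLpNorm_ofReal_eq hp, ← ENNReal.mul_rpow_of_nonneg _ _ (by positivity),
      Grid.lintegral_levelMeasure, Finset.sum_mul]
    gcongr
    exact Measure.restrict_le_self

/-- Minkowski's inequality for the tail of the series. It is used with ν = m and n = 0 to bound
|f|_p, and with ν the weighted measure of level k and n = k + 1 to bound the oscillation. -/
theorem Grid.IsRepresentation.eLpNorm_sub_le [IsFiniteMeasure m] {s p : ℝ} (hp : 1 ≤ p)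
    {c : Set I → ℂ} {f : I → ℂ} (hf : AEStronglyMeasurable f m)
    (h : G.IsRepresentation s p c (canonicalAtom m s p) f) {ν : Measure I} (hν : ν ≪ m)
    {C : ℝ≥0∞} (hC : C ≠ ∞)
    (hle : ∀ h : I → ℂ, eLpNorm h (ENNReal.ofReal p) ν ≤ C * eLpNorm h (ENNReal.ofReal p) m)
    (n : ℕ) :
    eLpNorm (fun x => f x - ∑ k ∈ Finset.range n, G.canonicalBlock s p c k x)
      (ENNReal.ofReal p) ν ≤
      ∑' i, eLpNorm (G.canonicalBlock s p c (n + i)) (ENNReal.ofReal p) ν := by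
  have hmeas : ∀ n, AEStronglyMeasurable
      (fun x => f x - ∑ k ∈ Finset.range n, G.canonicalBlock s p c k x) ν := fun n =>
    (hf.mono_ac hν).sub (Finset.measurable_fun_sum _ fun k _ =>
      Grid.measurable_canonicalBlock s p c k).aestronglyMeasurable
  have hstep : ∀ M, eLpNorm (fun x => f x - ∑ k ∈ Finset.range n, G.canonicalBlock s p c k x)
      (ENNReal.ofReal p) ν ≤
      eLpNorm (fun x => f x - ∑ k ∈ Finset.range (n + M), G.canonicalBlock s p c k x)
        (ENNReal.ofReal p) ν +
      ∑' i, eLpNorm (G.canonicalBlock s p c (n + i)) (ENNReal.ofReal p) ν := by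
    intro M
    have h1 : (fun x => f x - ∑ k ∈ Finset.range n, G.canonicalBlock s p c k x) =
        (fun x => f x - ∑ k ∈ Finset.range (n + M), G.canonicalBlock s p c k x) +
          ∑ i ∈ Finset.range M, G.canonicalBlock s p c (n + i) := by
      ext x
      rw [Pi.add_apply, Finset.sum_apply, Finset.sum_range_add]
      ring
    rw [h1]
    refine (eLpNorm_add_le (hmeas _) (Finset.aestronglyMeasurable_sum _ fun i _ =>
      (Grid.measurable_canonicalBlock s p c _).aestronglyMeasurable) (one_le_ofReal hp)).trans ?_
    refine add_le_add le_rfl ((eLpNorm_sum_le (fun i _ =>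
      (Grid.measurable_canonicalBlock s p c _).aestronglyMeasurable) (one_le_ofReal hp)).trans
        (ENNReal.sum_le_tsum _))
  have hlim : Tendsto (fun M => eLpNorm
      (fun x => f x - ∑ k ∈ Finset.range (n + M), G.canonicalBlock s p c k x)
        (ENNReal.ofReal p) ν) atTop (𝓝 0) := by
    have h1 := ENNReal.Tendsto.const_mul (a := C)
      (h.tendsto.comp (tendsto_add_atTop_nat n)) (Or.inr hC)
    rw [mul_zero] at h1
    refine tendsto_of_tendsto_of_tendsto_of_le_of_le tendsto_const_nhds h1
      (fun _ => zero_le) fun M => ?_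
    simp only [Function.comp_apply]
    rw [add_comm n M]
    exact hle _
  have h2 := hlim.add_const
    (∑' i, eLpNorm (G.canonicalBlock s p c (n + i)) (ENNReal.ofReal p) ν)
  rw [zero_add] at h2
  exact ge_of_tendsto' h2 hstep

namespace Grid.IsGood

variable (hG : G.IsGood l₁ l₂)
include hG

/-! ### Estimates of atomic blocks and of the oscillation of their sums -/

theorem canonicalBlock_eq (s p : ℝ) (c : Set I → ℂ) {k : ℕ} {Q : Set I} (hQ : Q ∈ G.cells k)
    {x : I} (hx : x ∈ Q) :
    G.canonicalBlock s p c k x = c Q * ((m.real Q ^ (s - 1 / p) : ℝ) : ℂ) := by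
  rw [← hG.sum_indicator_eq hQ hx fun Q => c Q * ((m.real Q ^ (s - 1 / p) : ℝ) : ℂ)]
  refine Finset.sum_congr rfl fun R _ => ?_
  by_cases h : x ∈ R <;> simp [canonicalAtom, h]

theorem setLIntegral_canonicalBlock [IsFiniteMeasure m] {s p : ℝ} (hp : 1 ≤ p) (c : Set I → ℂ)
    {j k : ℕ} (hjk : j ≤ k) {Q : Set I} (hQ : Q ∈ G.cells j) :
    ∫⁻ x in Q, ‖G.canonicalBlock s p c k x‖ₑ ^ p ∂m =
      ∑ P ∈ G.below k Q, ‖c P‖ₑ ^ p * m P ^ (s * p) := by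
  have hp0 : 0 < p := by linarith
  rw [hG.setLIntegral_eq_sum hjk hQ]
  refine Finset.sum_congr rfl fun P hP => ?_
  have hP' := (Grid.mem_below.1 hP).1
  have hpos := G.measure_pos k P hP'
  have h1 : ∫⁻ x in P, ‖G.canonicalBlock s p c k x‖ₑ ^ p ∂m =
      ∫⁻ x in P, (‖c P‖ₑ * m P ^ (s - 1 / p)) ^ p ∂m :=
    setLIntegral_congr_fun (G.measurableSet_of_mem k P hP') fun x hx => by
      simp only [hG.canonicalBlock_eq s p c hP' hx, enorm_mul, enorm_measureReal_rpow hpos]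
  rw [h1, setLIntegral_const, ENNReal.mul_rpow_of_nonneg _ _ hp0.le, ← ENNReal.rpow_mul, mul_assoc]
  congr 1
  -- The exponents add up to (s - 1/p)p + 1 = sp.
  nth_rw 2 [← ENNReal.rpow_one (m P)]
  rw [← ENNReal.rpow_add _ _ hpos.ne' (measure_ne_top _ _)]
  congr 1
  field_simp
  ring

theorem eLpNorm_canonicalBlock_le [IsFiniteMeasure m] {s p : ℝ} (hs : 0 < s) (hp : 1 ≤ p)
    (c : Set I → ℂ) (k : ℕ) :
    eLpNorm (G.canonicalBlock s p c k) (ENNReal.ofReal p) m ≤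
      G.mesh k ^ s * lpSum p (G.cells k) fun Q => ‖c Q‖ₑ := by
  have hp0 : 0 < p := by linarith
  have h := hG.setLIntegral_canonicalBlock (s := s) hp c (Nat.zero_le k) hG.univ_mem
  rw [setLIntegral_univ, Grid.below_univ] at h
  rw [eLpNorm_ofReal_eq hp, h, ← lpSum_const_mul _ hp, lpSum]
  gcongr with Q hQ
  rw [ENNReal.mul_rpow_of_nonneg _ _ hp0.le, mul_comm, ← ENNReal.rpow_mul]
  gcongr
  exact le_iSup₂_of_le Q hQ le_rfl

theorem tsum_eLpNorm_canonicalBlock_le [IsFiniteMeasure m] {s p : ℝ} (hs : 0 < s) (hp : 1 ≤ p)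
    {q : ℝ≥0∞} (hq : 1 ≤ q) (c : Set I → ℂ) :
    ∑' k, eLpNorm (G.canonicalBlock s p c k) (ENNReal.ofReal p) m ≤
      holderConst p q (fun k => G.mesh k ^ (s * p)) * G.cost p q c := by
  have hp0 : 0 < p := by linarith
  refine le_trans (ENNReal.tsum_le_tsum fun k => ?_) (tsum_mul_le_holderConst_mul p hq _ _)
  rw [← ENNReal.rpow_mul, mul_assoc, mul_one_div_cancel hp0.ne', mul_one]
  exact hG.eLpNorm_canonicalBlock_le hs hp c k

theorem sum_sum_below {M : Type*} [AddCommMonoid M] {j k : ℕ} (hjk : j ≤ k) (F : Set I → M) :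
    ∑ Q ∈ G.cells j, ∑ P ∈ G.below k Q, F P = ∑ P ∈ G.cells k, F P := by
  classical
  simp only [Grid.below, Finset.sum_filter]
  rw [Finset.sum_comm]
  refine Finset.sum_congr rfl fun P hP => ?_
  obtain ⟨i, rfl⟩ := Nat.exists_eq_add_of_le hjk
  obtain ⟨Q, hQ, hPQ⟩ := hG.exists_ancestor j i hP
  rw [Finset.sum_eq_single_of_mem Q hQ, if_pos hPQ]
  intro R hR hne
  obtain ⟨x, hx⟩ := Grid.nonempty_of_mem hP
  exact if_neg fun h => hne (hG.eq_of_inter hR hQ (h hx) (hPQ hx))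

/-- A cell P lying i levels below Q has |P|^{sp} |Q|^{-sp} ≤ λ₂^{isp}. This is the geometric gain
behind the bound for the oscillation. -/
theorem eLpNorm_canonicalBlock_levelMeasure_le [IsFiniteMeasure m] {s p : ℝ} (hs : 0 < s)
    (hp : 1 ≤ p) (c : Set I → ℂ) (k i : ℕ) :
    eLpNorm (G.canonicalBlock s p c (k + i)) (ENNReal.ofReal p) (G.levelMeasure s p k) ≤
      (ENNReal.ofReal l₂ ^ s) ^ i * lpSum p (G.cells (k + i)) fun Q => ‖c Q‖ₑ := by
  have hp0 : 0 < p := by linarith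
  rw [eLpNorm_ofReal_eq hp, Grid.lintegral_levelMeasure, ← lpSum_const_mul _ hp, lpSum,
    ← hG.sum_sum_below (Nat.le_add_right k i)]
  gcongr with Q hQ
  rw [hG.setLIntegral_canonicalBlock hp c (Nat.le_add_right k i) hQ, Finset.mul_sum]
  refine Finset.sum_le_sum fun P hP => ?_
  obtain ⟨hP, hPQ⟩ := Grid.mem_below.1 hP
  have hpos := G.measure_pos k Q hQ
  rw [ENNReal.mul_rpow_of_nonneg _ _ hp0.le, mul_comm (‖c P‖ₑ ^ p), ← mul_assoc]
  gcongr
  calc m Q ^ (-(s * p)) * m P ^ (s * p)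
      ≤ m Q ^ (-(s * p)) * (ENNReal.ofReal l₂ ^ i * m Q) ^ (s * p) := by
        gcongr
        exact hG.measure_le k i hQ hP hPQ
    _ = (ENNReal.ofReal l₂ ^ i) ^ (s * p) * (m Q ^ (-(s * p)) * m Q ^ (s * p)) := by
        rw [ENNReal.mul_rpow_of_nonneg _ _ (by positivity)]
        ring
    _ = ((ENNReal.ofReal l₂ ^ s) ^ i) ^ p := by
        rw [← ENNReal.rpow_add _ _ hpos.ne' (measure_ne_top _ _), neg_add_cancel, ENNReal.rpow_zero,
          mul_one, ← ENNReal.rpow_natCast, ← ENNReal.rpow_natCast, ← ENNReal.rpow_mul,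
          ← ENNReal.rpow_mul, ← ENNReal.rpow_mul]
        congr 1
        ring

theorem sum_canonicalBlock_eq_of_mem (s p : ℝ) (c : Set I → ℂ) {k : ℕ} {Q : Set I}
    (hQ : Q ∈ G.cells k) {x y : I} (hx : x ∈ Q) (hy : y ∈ Q) :
    ∑ j ∈ Finset.range (k + 1), G.canonicalBlock s p c j x =
      ∑ j ∈ Finset.range (k + 1), G.canonicalBlock s p c j y := by
  refine Finset.sum_congr rfl fun j hj => ?_
  obtain ⟨i, rfl⟩ := Nat.exists_eq_add_of_le (Nat.lt_succ_iff.1 (Finset.mem_range.1 hj))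
  obtain ⟨R, hR, hQR⟩ := hG.exists_ancestor j i hQ
  rw [hG.canonicalBlock_eq s p c hR (hQR hx), hG.canonicalBlock_eq s p c hR (hQR hy)]

/-- On a cell of level k the blocks of levels at most k are constant; their sum is the competitor in
the infimum, and only levels k + 1 + i contribute. In terms of the weighted measure, the left side
is bounded by one L^p norm of the tail. -/
theorem osc_level_le [IsFiniteMeasure m] {s p : ℝ} (hs : 0 < s) (hp : 1 ≤ p)
    {c : Set I → ℂ} {f : I → ℂ} (hf : AEStronglyMeasurable f m)
    (h : G.IsRepresentation s p c (canonicalAtom m s p) f) (k : ℕ) :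
    (∑ Q ∈ G.cells k, m Q ^ (-(s * p)) * osc m p f Q ^ p) ^ (1 / p) ≤
      ∑' i, (ENNReal.ofReal l₂ ^ s) ^ (i + 1) *
        lpSum p (G.cells (k + 1 + i)) fun Q => ‖c Q‖ₑ := by
  have hp0 : 0 < p := by linarith
  obtain ⟨C, hC, hle⟩ := Grid.eLpNorm_levelMeasure_le (G := G) s hp k
  have h1 := h.eLpNorm_sub_le hp hf (Grid.levelMeasure_absolutelyContinuous s p k) hC hle (k + 1)
  refine le_trans ?_ (h1.trans (ENNReal.tsum_le_tsum fun i => ?_))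
  · rw [eLpNorm_ofReal_eq hp, Grid.lintegral_levelMeasure]
    gcongr with Q hQ
    obtain ⟨y, hy⟩ := Grid.nonempty_of_mem hQ
    have h2 : osc m p f Q ≤ (∫⁻ x in Q, ‖f x -
        ∑ j ∈ Finset.range (k + 1), G.canonicalBlock s p c j x‖ₑ ^ p ∂m) ^ (1 / p) := by
      refine (iInf_le _ (∑ j ∈ Finset.range (k + 1), G.canonicalBlock s p c j y)).trans_eq ?_
      congr 1
      refine setLIntegral_congr_fun (G.measurableSet_of_mem k Q hQ) fun x hx => ?_
      simp only [hG.sum_canonicalBlock_eq_of_mem s p c hQ hx hy]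
    calc osc m p f Q ^ p ≤ _ := ENNReal.rpow_le_rpow h2 hp0.le
      _ = _ := by rw [← ENNReal.rpow_mul, one_div_mul_cancel hp0.ne', ENNReal.rpow_one]
  · have := hG.eLpNorm_canonicalBlock_levelMeasure_le hs hp c k (1 + i)
    rwa [← add_assoc, add_comm 1 i] at this

theorem ofReal_one_div_one_sub {s : ℝ} (hs : 0 < s) :
    ENNReal.ofReal (1 / (1 - l₂ ^ s)) = (1 - ENNReal.ofReal l₂ ^ s)⁻¹ := by
  have h1 : l₂ ^ s < 1 := Real.rpow_lt_one hG.l₂_pos.le hG.lt_one hs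
  rw [one_div, ENNReal.ofReal_inv_of_pos (by linarith), ENNReal.ofReal_sub _
    (Real.rpow_nonneg hG.l₂_pos.le s), ENNReal.ofReal_one, ENNReal.ofReal_rpow_of_pos hG.l₂_pos]

theorem oscNorm_le_cost [IsFiniteMeasure m] {s p : ℝ} (hs : 0 < s) (hp : 1 ≤ p) {q : ℝ≥0∞}
    (hq : 1 ≤ q) {c : Set I → ℂ} {f : I → ℂ} (hf : AEStronglyMeasurable f m)
    (h : G.IsRepresentation s p c (canonicalAtom m s p) f) :
    G.oscNorm s p q f ≤ G.oscConst l₂ s p q * G.cost p q c := by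
  rw [Grid.oscNorm, Grid.oscConst, hG.overlap_eq, ENNReal.one_rpow, one_mul, add_mul]
  refine add_le_add ?_ ?_
  · have h1 := h.eLpNorm_sub_le hp hf Measure.AbsolutelyContinuous.rfl ENNReal.one_ne_top
      (fun h => (one_mul _).ge) 0
    simp only [Finset.range_zero, Finset.sum_empty, sub_zero, zero_add] at h1
    rw [mul_comm (holderConst p q _), mul_assoc]
    gcongr
    exact h1.trans (hG.tsum_eLpNorm_canonicalBlock_le hs hp hq c)
  · refine (lqNorm_mono fun k => hG.osc_level_le hs hp hf h k).trans ?_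
    refine (lqNorm_convolution_le hq _ fun k => lpSum p (G.cells k) fun Q => ‖c Q‖ₑ).trans ?_
    rw [hG.ofReal_one_div_one_sub hs, ← ENNReal.tsum_geometric]
    refine mul_le_mul' ?_ le_rfl
    -- The series starts with the exponent 1; restoring the term of exponent 0 gives the constant
    -- 1/(1 - λ₂^s).
    exact ENNReal.tsum_comp_le_tsum_of_injective (add_left_injective 1)
      fun i => (ENNReal.ofReal l₂ ^ s) ^ i

/-- Needed to move the constant through the infimum defining the Besov norm: if f has no
representation, a zero constant would give 0 · ∞ = 0. -/
theorem oscConst_ne_zero [IsFiniteMeasure m] {s p : ℝ} (hs : 0 < s) {q : ℝ≥0∞} :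
    G.oscConst l₂ s p q ≠ 0 := by
  have h1 : l₂ ^ s < 1 := Real.rpow_lt_one hG.l₂_pos.le hG.lt_one hs
  rw [Grid.oscConst, ne_eq, add_eq_zero, not_and_or]
  right
  simpa using h1

theorem oscNorm_le_besovNorm [IsFiniteMeasure m] {s p : ℝ} (hs : 0 < s) (hp : 1 ≤ p) {q : ℝ≥0∞}
    (hq : 1 ≤ q) {f : I → ℂ} (hf : AEStronglyMeasurable f m) :
    G.oscNorm s p q f ≤ G.oscConst l₂ s p q * G.besovNorm s p q f := by
  have h0 := hG.oscConst_ne_zero (p := p) (q := q) hs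
  have ht := (hG.oscConst_lt_top hs hp hq).ne
  simp only [Grid.besovNorm, ENNReal.mul_iInf_of_ne h0 ht]
  refine le_iInf fun c => le_iInf fun a => le_iInf fun h => ?_
  obtain ⟨c', hc', h'⟩ := h.exists_canonical
  exact (hG.oscNorm_le_cost hs hp hq hf h').trans (by gcongr; exact Grid.cost_mono hp hc')

theorem memLp_of_representation [IsFiniteMeasure m] {s p : ℝ} (hs : 0 < s) (hp : 1 ≤ p) {q : ℝ≥0∞}
    (hq : 1 ≤ q) {c : Set I → ℂ} {a : Set I → I → ℂ} {f : I → ℂ} (hf : AEStronglyMeasurable f m)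
    (h : G.IsRepresentation s p c a f) (hc : G.cost p q c < ∞) : MemLp f (ENNReal.ofReal p) m := by
  obtain ⟨c', hc', h'⟩ := h.exists_canonical
  refine ⟨hf, ?_⟩
  have h1 := h'.eLpNorm_sub_le hp hf Measure.AbsolutelyContinuous.rfl ENNReal.one_ne_top
    (fun h => (one_mul _).ge) 0
  simp only [Finset.range_zero, Finset.sum_empty, sub_zero, zero_add] at h1
  refine (h1.trans (hG.tsum_eLpNorm_canonicalBlock_le hs hp hq c')).trans_lt ?_
  exact ENNReal.mul_lt_top (hG.holderConst_lt_top hs hp hq) ((Grid.cost_mono hp hc').trans_lt hc)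

theorem besovNorm_lt_top_iff [IsFiniteMeasure m] {s p : ℝ} (hs : 0 < s) (hp : 1 ≤ p) {q : ℝ≥0∞}
    (hq : 1 ≤ q) {f : I → ℂ} (hf : AEStronglyMeasurable f m) :
    G.besovNorm s p q f < ∞ ↔ f ∈ G.besovSpace s p q := by
  simp only [Grid.besovNorm, iInf_lt_iff, Grid.besovSpace, Set.mem_ofPred_eq]
  constructor
  · rintro ⟨c, a, h, hc⟩
    exact ⟨hG.memLp_of_representation hs hp hq hf h hc, c, a, h, hc⟩
  · rintro ⟨-, c, a, h, hc⟩
    exact ⟨c, a, h, hc⟩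

end Grid.IsGood

/-! ### Haar coefficients and the standard atomic representation -/

theorem haarCoeff_eq_haarSum {f : I → ℂ} (hf : Integrable f m)
    {S : Finset (Set I) × Finset (Set I)} (h1 : ∀ R ∈ S.1, MeasurableSet R)
    (h2 : ∀ R ∈ S.2, MeasurableSet R) :
    haarCoeff m f S = haarSum m.real (fun R => ∫ x in R, f x ∂m) S := by
  have hint : ∀ F : Finset (Set I), (∀ R ∈ F, MeasurableSet R) →
      Integrable (fun x => ∑ R ∈ F, R.indicator f x) m ∧
      ∫ x, ∑ R ∈ F, R.indicator f x ∂m = ∑ R ∈ F, ∫ x in R, f x ∂m := by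
    intro F hF
    refine ⟨integrable_finsetSum F fun R hR => hf.indicator (hF R hR), ?_⟩
    rw [integral_finsetSum F fun R hR => hf.indicator (hF R hR)]
    exact Finset.sum_congr rfl fun R hR => integral_indicator (hF R hR)
  have hpt : ∀ x, f x * (haarWavelet m S x : ℂ) =
      (haarFactor (∑ R ∈ S.1, m.real R) (∑ R ∈ S.2, m.real R) : ℂ) *
      ((∑ R ∈ S.1, R.indicator f x) / ((∑ R ∈ S.1, m.real R : ℝ) : ℂ) -
        (∑ R ∈ S.2, R.indicator f x) / ((∑ R ∈ S.2, m.real R : ℝ) : ℂ)) := by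
    intro x
    have hs : ∀ F : Finset (Set I), f x * ((∑ R ∈ F, R.indicator (fun _ => (1 : ℝ)) x : ℝ) : ℂ) =
        ∑ R ∈ F, R.indicator f x := by
      intro F
      rw [Complex.ofReal_sum, Finset.mul_sum]
      refine Finset.sum_congr rfl fun R _ => ?_
      by_cases hx : x ∈ R <;> simp [hx]
    rw [← hs, ← hs, haarWavelet]
    simp only [totalMeasure, haarFactor]
    push_cast
    ring
  rw [haarCoeff]
  simp_rw [hpt]
  rw [integral_const_mul, integral_sub ((hint _ h1).1.div_const _) ((hint _ h2).1.div_const _),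
    integral_div, integral_div, (hint _ h1).2, (hint _ h2).2, haarSum]

theorem measurable_haarWavelet {S : Finset (Set I) × Finset (Set I)}
    (h1 : ∀ R ∈ S.1, MeasurableSet R) (h2 : ∀ R ∈ S.2, MeasurableSet R) :
    Measurable (haarWavelet m S) :=
  measurable_const.mul (((Finset.measurable_fun_sum _ fun R hR =>
    measurable_const.indicator (h1 R hR)).div_const _).sub
    ((Finset.measurable_fun_sum _ fun R hR => measurable_const.indicator (h2 R hR)).div_const _))

theorem haarWavelet_eq_zero {S : Finset (Set I) × Finset (Set I)} {x : I}
    (h1 : ∀ R ∈ S.1, x ∉ R) (h2 : ∀ R ∈ S.2, x ∉ R) : haarWavelet m S x = 0 := by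
  rw [haarWavelet, Finset.sum_eq_zero fun R hR => Set.indicator_of_notMem (h1 R hR) _,
    Finset.sum_eq_zero fun R hR => Set.indicator_of_notMem (h2 R hR) _]
  simp

theorem haarCoeffTop_eq (m : Measure I) (f : I → ℂ) :
    haarCoeffTop m f = (∫ x, f x ∂m) * ((1 / m.real Set.univ ^ (1 / 2 : ℝ) : ℝ) : ℂ) :=
  integral_mul_const _ _

open Classical in
/-- The coefficients of the standard atomic representation, as a function of the cell. -/
def Grid.stdFamily (G : Grid m) (D : G.Choices) (s p : ℝ) (f : I → ℂ) (Q : Set I) : ℂ :=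
  if h : ∃ k, Q ∈ G.cells k then G.stdCoeff D s p f h.choose Q else 0

theorem Grid.stdFamily_eq (D : G.Choices) (s p : ℝ) (f : I → ℂ) {k : ℕ} {Q : Set I}
    (hQ : Q ∈ G.cells k) : G.stdFamily D s p f Q = G.stdCoeff D s p f k Q := by
  have h : ∃ k, Q ∈ G.cells k := ⟨k, hQ⟩
  have hk : h.choose = k := by
    -- A set occurs at one level only, so the chosen level is unambiguous.
    by_contra hne
    exact G.ne_of_ne _ _ hne Q h.choose_spec Q hQ rfl
  rw [Grid.stdFamily, dif_pos h, hk]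

namespace Grid.IsGood

variable (hG : G.IsGood l₁ l₂)
include hG

theorem haarFamily_props [IsFiniteMeasure m] (D : G.Choices) {k : ℕ} {Q : Set I}
    (hQ : Q ∈ G.cells k) {S : Finset (Set I) × Finset (Set I)} (hS : S ∈ G.haarFamily D k Q) :
    S.1 ⊆ G.children k Q ∧ S.2 ⊆ G.children k Q ∧ Disjoint S.1 S.2 ∧ S.1.Nonempty ∧
      S.2.Nonempty :=
  haarPairs_props D.nodup_order D.mem_order (hG.two_le_card_children hQ) hS

theorem haarWavelet_eq_haarValue {k : ℕ} {Q : Set I} {S : Finset (Set I) × Finset (Set I)}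
    (h1 : S.1 ⊆ G.children k Q) (h2 : S.2 ⊆ G.children k Q) {P : Set I}
    (hP : P ∈ G.cells (k + 1)) {x : I} (hx : x ∈ P) :
    haarWavelet m S x = haarValue m.real S P := by
  classical
  have hs : ∀ F : Finset (Set I), F ⊆ G.children k Q →
      ∑ R ∈ F, R.indicator (fun _ => (1 : ℝ)) x = if P ∈ F then 1 else 0 := by
    intro F hF
    have h0 : ∀ R ∈ F, R ≠ P → R.indicator (fun _ => (1 : ℝ)) x = 0 := fun R hR hne =>
      Set.indicator_of_notMem (fun h => hne
        (hG.eq_of_inter (Grid.mem_below.1 (hF hR)).1 hP h hx)) _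
    split_ifs with h
    · rw [Finset.sum_eq_single_of_mem P h h0, Set.indicator_of_mem hx]
    · exact Finset.sum_eq_zero fun R hR => h0 R hR fun h' => h (h' ▸ hR)
  rw [haarWavelet, hs _ h1, hs _ h2, haarValue]
  rfl

/-- The combinatorial identity applied to the integrals of f over the children, whose sum is the
integral over Q because the children cover Q up to a null set. -/
theorem sum_haarCoeff_mul_haarWavelet [IsFiniteMeasure m] (D : G.Choices) {f : I → ℂ}
    (hf : Integrable f m) {k : ℕ} {Q P : Set I} (hQ : Q ∈ G.cells k) (hP : P ∈ G.children k Q)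
    {x : I} (hx : x ∈ P) :
    ∑ S ∈ G.haarFamily D k Q, haarCoeff m f S * (haarWavelet m S x : ℂ) =
      cellAverage m f P - cellAverage m f Q := by
  have h1 : ∀ S ∈ G.haarFamily D k Q, haarCoeff m f S * (haarWavelet m S x : ℂ) =
      haarSum m.real (fun R => ∫ x in R, f x ∂m) S * (haarValue m.real S P : ℂ) := by
    intro S hS
    have h := hG.haarFamily_props D hQ hS
    rw [haarCoeff_eq_haarSum hf (fun R hR => Grid.measurableSet_below R (h.1 hR))
      (fun R hR => Grid.measurableSet_below R (h.2.1 hR)),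
      hG.haarWavelet_eq_haarValue h.1 h.2.1 (Grid.mem_below.1 hP).1 hx]
  rw [Finset.sum_congr rfl h1, cellAverage, cellAverage, hG.measureReal_eq_sum (Nat.le_succ k) hQ,
    hG.setIntegral_eq_sum (Nat.le_succ k) hQ hf]
  exact sum_haarSum_mul_haarValue D.nodup_order D.mem_order _ _
    (fun R hR => Grid.measureReal_pos (Grid.mem_below.1 hR).1) (hG.two_le_card_children hQ) hP

theorem filter_supset_eq {k : ℕ} {Q P : Set I} [DecidablePred fun Q : Set I => P ⊆ Q]
    (hQ : Q ∈ G.cells k) (hP : P ∈ G.children k Q) :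
    {Q ∈ G.cells k | P ⊆ Q} = {Q} := by
  have hP := Grid.mem_below.1 hP
  obtain ⟨x, hx⟩ := Grid.nonempty_of_mem hP.1
  ext R
  rw [Finset.mem_filter, Finset.mem_singleton]
  constructor
  · rintro ⟨hR, hPR⟩
    exact hG.eq_of_inter hR hQ (hPR hx) (hP.2 hx)
  · rintro rfl
    exact ⟨hQ, hP.2⟩

theorem stdCoeff_succ_eq (D : G.Choices) (s p : ℝ) (f : I → ℂ) {k : ℕ} {Q P : Set I}
    (hQ : Q ∈ G.cells k) (hP : P ∈ G.children k Q) :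
    G.stdCoeff D s p f (k + 1) P = ((1 / m.real P ^ (s - 1 / p) : ℝ) : ℂ) *
      ∑ S ∈ G.haarFamily D k Q, haarCoeff m f S * (haarWavelet m S (D.pt P) : ℂ) := by
  classical
  rw [Grid.stdCoeff, hG.filter_supset_eq hQ hP, Finset.sum_singleton]

theorem stdCoeff_zero_mul [IsFiniteMeasure m] (D : G.Choices) (s p : ℝ) (f : I → ℂ) (Q : Set I) :
    G.stdCoeff D s p f 0 Q * ((m.real Set.univ ^ (s - 1 / p) : ℝ) : ℂ) =
      cellAverage m f Set.univ := by
  have hpos : 0 < m.real Set.univ := Grid.measureReal_pos hG.univ_mem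
  have h1 : m.real Set.univ ^ (1 / p - s - 1 / 2) * (1 / m.real Set.univ ^ (1 / 2 : ℝ)) *
      m.real Set.univ ^ (s - 1 / p) = (m.real Set.univ)⁻¹ := by
    rw [one_div (m.real Set.univ ^ _), ← Real.rpow_neg hpos.le, ← Real.rpow_add hpos, ← Real.rpow_add hpos,
      ← Real.rpow_neg_one]
    congr 1
    ring
  have h2 := congrArg (fun r : ℝ => (r : ℂ)) h1
  simp only [Complex.ofReal_mul, Complex.ofReal_inv] at h2
  rw [Grid.stdCoeff, haarCoeffTop_eq, cellAverage, setIntegral_univ,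
    div_eq_mul_inv (∫ x, f x ∂m), ← h2]
  ring

theorem stdCoeff_succ_mul [IsFiniteMeasure m] (D : G.Choices) (s p : ℝ) {f : I → ℂ}
    (hf : Integrable f m) {k : ℕ} {Q P : Set I} (hQ : Q ∈ G.cells k) (hP : P ∈ G.children k Q) :
    G.stdCoeff D s p f (k + 1) P * ((m.real P ^ (s - 1 / p) : ℝ) : ℂ) =
      cellAverage m f P - cellAverage m f Q := by
  have hP' := (Grid.mem_below.1 hP).1
  have h0 : ((m.real P ^ (s - 1 / p) : ℝ) : ℂ) ≠ 0 := by
    exact_mod_cast (Real.rpow_pos_of_pos (Grid.measureReal_pos hP') _).ne'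
  rw [hG.stdCoeff_succ_eq D s p f hQ hP,
    hG.sum_haarCoeff_mul_haarWavelet D hf hQ hP (D.pt_mem _ P hP'), mul_right_comm]
  rw [Complex.ofReal_div, Complex.ofReal_one, one_div_mul_cancel h0, one_mul]

/-- The partial sums of the standard atomic representation are the averages of `f`. -/
theorem sum_canonicalBlock_stdFamily [IsFiniteMeasure m] (D : G.Choices) (s p : ℝ) {f : I → ℂ}
    (hf : Integrable f m) (n : ℕ) {P : Set I} (hP : P ∈ G.cells n) {x : I} (hx : x ∈ P) :
    ∑ k ∈ Finset.range (n + 1), G.canonicalBlock s p (G.stdFamily D s p f) k x =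
      G.average f n x := by
  induction n generalizing P with
  | zero =>
    have hP' : P = Set.univ := by simpa [hG.cells_zero] using hP
    subst hP'
    rw [Finset.sum_range_one, hG.canonicalBlock_eq s p _ hP hx, hG.average_eq hP hx,
      Grid.stdFamily_eq D s p f hP, hG.stdCoeff_zero_mul]
  | succ n ih =>
    obtain ⟨Q, hQ, hPQ⟩ := hG.exists_parent n P hP
    rw [Finset.sum_range_succ, ih hQ (hPQ hx), hG.canonicalBlock_eq s p _ hP hx,
      hG.average_eq hP hx, hG.average_eq hQ (hPQ hx), Grid.stdFamily_eq D s p f hP,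
      hG.stdCoeff_succ_mul D s p hf hQ (Grid.mem_below.2 ⟨hP, hPQ⟩)]
    ring

theorem cost_stdFamily_le (D : G.Choices) {s p : ℝ} (hp : 1 ≤ p) {q : ℝ≥0∞} (hq : 1 ≤ q)
    (f : I → ℂ) : G.cost p q (G.stdFamily D s p f) ≤ G.stdNorm D s p q f := by
  have hp0 : 0 < p := by linarith
  refine (lqNorm_le_head_add hq _).trans (add_le_add (le_of_eq ?_) (le_of_eq ?_))
  · rw [hG.cells_zero, lpSum, Finset.sum_singleton, ← ENNReal.rpow_mul, mul_one_div_cancel hp0.ne',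
      ENNReal.rpow_one, Grid.stdFamily_eq D s p f hG.univ_mem]
  · congr 1
    ext k
    rw [lpSum, lpSum]
    congr 1
    exact Finset.sum_congr rfl fun Q hQ => by rw [Grid.stdFamily_eq D s p f hQ]

/-- Although f is only assumed integrable, finite cost yields convergence in L^p: the difference
between f and a partial sum is an a.e. limit of differences of partial sums, and Fatou's lemma
bounds its L^p norm by the tail of the convergent series of block norms. -/
theorem isRepresentation_stdFamily [IsFiniteMeasure m] (D : G.Choices) {s p : ℝ} (hs : 0 < s)
    (hp : 1 ≤ p) {q : ℝ≥0∞} (hq : 1 ≤ q) {f : I → ℂ} (hf : Integrable f m)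
    (hc : G.cost p q (G.stdFamily D s p f) < ∞) :
    G.IsRepresentation s p (G.stdFamily D s p f) (canonicalAtom m s p) f := by
  set c := G.stdFamily D s p f with hcdef
  have hsum : ∑' k, eLpNorm (G.canonicalBlock s p c k) (ENNReal.ofReal p) m < ∞ :=
    (hG.tsum_eLpNorm_canonicalBlock_le hs hp hq c).trans_lt
      (ENNReal.mul_lt_top (hG.holderConst_lt_top hs hp hq) hc)
  refine ⟨fun k Q hQ => isSouzaAtom_canonicalAtom s p hQ, hsum, ?_⟩
  have hmeas : ∀ k, AEStronglyMeasurable (G.canonicalBlock s p c k) m := fun k =>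
    (Grid.measurable_canonicalBlock s p c k).aestronglyMeasurable
  have hsumm : ∀ n, AEStronglyMeasurable
      (fun x => ∑ k ∈ Finset.range n, G.canonicalBlock s p c k x) m := fun n =>
    (Finset.measurable_fun_sum _ fun k _ =>
      Grid.measurable_canonicalBlock s p c k).aestronglyMeasurable
  refine tendsto_of_tendsto_of_tendsto_of_le_of_le tendsto_const_nhds
    (ENNReal.tendsto_sum_nat_add _ hsum.ne) (fun _ => zero_le) fun n => ?_
  obtain ⟨ns, hns, hlim⟩ := hG.exists_subseq_average_tendsto hf
  -- The shift by n ensures that the later partial sum contains the first n blocks, so the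
  -- difference is a sum of blocks of levels at least n.
  have hlim' : ∀ᵐ x ∂m, Tendsto (fun i => (∑ k ∈ Finset.range (ns (i + n) + 1),
      G.canonicalBlock s p c k x) - ∑ k ∈ Finset.range n, G.canonicalBlock s p c k x) atTop
      (𝓝 (f x - ∑ k ∈ Finset.range n, G.canonicalBlock s p c k x)) := by
    filter_upwards [hlim, ae_all_iff.2 fun n => hG.ae_exists_mem n] with x hx hx'
    refine Tendsto.sub_const ?_ _
    refine ((hx.comp (tendsto_add_atTop_nat n))).congr fun i => ?_
    obtain ⟨P, hP, hxP⟩ := hx' (ns (i + n))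
    exact (hG.sum_canonicalBlock_stdFamily D s p hf _ hP hxP).symm
  refine (Lp.eLpNorm_lim_le_liminf_eLpNorm (fun i => (hsumm _).sub (hsumm n)) _ hlim').trans ?_
  refine liminf_le_of_le (by isBoundedDefault) fun b hb => ?_
  obtain ⟨i, hi⟩ := hb.exists
  refine hi.trans ?_
  obtain ⟨M, hM⟩ := Nat.exists_eq_add_of_le
    (show n ≤ ns (i + n) + 1 from by have := hns.id_le (i + n); simp only [id] at this; omega)
  have h1 : ((fun x => ∑ k ∈ Finset.range (ns (i + n) + 1), G.canonicalBlock s p c k x) -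
      fun x => ∑ k ∈ Finset.range n, G.canonicalBlock s p c k x) =
      ∑ j ∈ Finset.range M, G.canonicalBlock s p c (j + n) := by
    ext x
    rw [Pi.sub_apply, hM, Finset.sum_range_add, Finset.sum_apply, add_sub_cancel_left]
    simp only [add_comm n]
  have h2 : eLpNorm (∑ j ∈ Finset.range M, G.canonicalBlock s p c (j + n)) (ENNReal.ofReal p) m ≤
      ∑' j, eLpNorm (G.canonicalBlock s p c (j + n)) (ENNReal.ofReal p) m :=
    (eLpNorm_sum_le (fun j _ => hmeas (j + n)) (one_le_ofReal hp)).trans (ENNReal.sum_le_tsum _)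
  rw [← h1] at h2
  exact h2

theorem besovNorm_le_stdNorm [IsFiniteMeasure m] (D : G.Choices) {s p : ℝ} (hs : 0 < s)
    (hp : 1 ≤ p) {q : ℝ≥0∞} (hq : 1 ≤ q) {f : I → ℂ} (hf : Integrable f m) :
    G.besovNorm s p q f ≤ G.stdNorm D s p q f := by
  rcases eq_or_ne (G.stdNorm D s p q f) ∞ with h | h
  · rw [h]; exact le_top
  · have hc := hG.cost_stdFamily_le D (s := s) hp hq f
    refine le_trans ?_ hc
    exact iInf_le_of_le _ (iInf_le_of_le _ (iInf_le _
      (hG.isRepresentation_stdFamily D hs hp hq hf (hc.trans_lt h.lt_top))))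

end Grid.IsGood

/-! ### Comparison of the Haar, standard and mean oscillation norms -/

theorem one_le_waveletConst (l₁ l₂ : ℝ) (h₁ : 0 < l₁) (h₂ : 0 < l₂) : 1 ≤ waveletConst l₁ l₂ := by
  have : 0 ≤ l₂ ^ (1 / 2 : ℝ) / (√2 * l₁ ^ (3 / 2 : ℝ)) := by positivity
  rw [waveletConst]
  linarith

/-- With A = λ₂^{1/2}/(√2 λ₁^{3/2}), the two parts n/(2λ₁) and 1/(2λ₁) are at most A² and A, and A²
+ A ≤ (A + 1)². -/
theorem card_div_le_waveletConst_sq {l₁ l₂ n : ℝ} (h₁ : 0 < l₁) (h₂ : 0 < l₂) (hn₁ : n * l₁ ≤ 1)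
    (hn₂ : 1 ≤ n * l₂) : (n + 1) / 2 / l₁ ≤ waveletConst l₁ l₂ ^ 2 := by
  set A := l₂ ^ (1 / 2 : ℝ) / (√2 * l₁ ^ (3 / 2 : ℝ)) with hA
  have hA0 : 0 ≤ A := by positivity
  have hA2 : A ^ 2 = l₂ / (2 * l₁ ^ 3) := by
    rw [hA, div_pow, mul_pow, Real.sq_sqrt (by norm_num), ← Real.rpow_natCast, ← Real.rpow_natCast,
      ← Real.rpow_mul h₂.le, ← Real.rpow_mul h₁.le]
    norm_num
  have hl : l₁ ≤ l₂ := by nlinarith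
  have h1 : n / (2 * l₁) ≤ A ^ 2 := by
    rw [hA2, div_le_div_iff₀ (by positivity) (by positivity)]
    nlinarith [mul_nonneg h₁.le h₁.le, mul_le_mul_of_nonneg_right hn₁ (mul_nonneg h₁.le h₁.le)]
  have h2 : 1 / (2 * l₁) ≤ A := by
    refine (sq_le_sq₀ (by positivity) hA0).1 ?_
    rw [hA2, div_pow, one_pow, mul_pow, div_le_div_iff₀ (by positivity) (by positivity)]
    nlinarith [mul_nonneg h₁.le h₁.le]
  have h3 : (n + 1) / 2 / l₁ = n / (2 * l₁) + 1 / (2 * l₁) := by field_simp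
  rw [h3, waveletConst, ← hA]
  nlinarith

theorem abs_haarValue_le {α : Type*} (w : α → ℝ) {S : Finset α × Finset α}
    (P : α) (h1 : 0 < ∑ R ∈ S.1, w R) (h2 : 0 < ∑ R ∈ S.2, w R) [DecidableEq α] :
    |haarValue w S P| ≤ haarFactor (∑ R ∈ S.1, w R) (∑ R ∈ S.2, w R) *
      ((if P ∈ S.1 then 1 else 0) / (∑ R ∈ S.1, w R) +
        (if P ∈ S.2 then 1 else 0) / (∑ R ∈ S.2, w R)) := by
  have hf : 0 ≤ haarFactor (∑ R ∈ S.1, w R) (∑ R ∈ S.2, w R) := by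
    rw [haarFactor]; positivity
  rw [haarValue, abs_mul, abs_of_nonneg hf]
  refine mul_le_mul_of_nonneg_left ?_ hf
  refine (abs_sub _ _).trans (le_of_eq ?_)
  congr 1
  · rw [abs_of_nonneg (by split_ifs <;> positivity)]
    split_ifs <;> rfl
  · rw [abs_of_nonneg (by split_ifs <;> positivity)]
    split_ifs <;> rfl

/-- The L¹ norm of the wavelet is at most twice its normalizing factor, 2(ab/(a + b))^{1/2}, and 4ab
≤ (a + b)². -/
theorem sum_mul_abs_haarValue_le {α : Type*} {w : α → ℝ} {T : Finset α}
    (hw : ∀ R ∈ T, 0 < w R) {S : Finset α × Finset α} (hS1 : S.1 ⊆ T) (hS2 : S.2 ⊆ T)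
    (hd : Disjoint S.1 S.2) (hne1 : S.1.Nonempty) (hne2 : S.2.Nonempty) :
    ∑ P ∈ T, w P * |haarValue w S P| ≤ (∑ P ∈ T, w P) ^ (1 / 2 : ℝ) := by
  classical
  set a := ∑ R ∈ S.1, w R with ha
  set b := ∑ R ∈ S.2, w R with hb
  have ha0 : 0 < a := Finset.sum_pos (fun R hR => hw R (hS1 hR)) hne1
  have hb0 : 0 < b := Finset.sum_pos (fun R hR => hw R (hS2 hR)) hne2
  have hf : 0 ≤ haarFactor a b := by rw [haarFactor]; positivity
  have hsub : ∀ F ⊆ T, ∑ P ∈ T, w P * (if P ∈ F then 1 else 0) = ∑ P ∈ F, w P := by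
    intro F hF
    simp only [mul_ite, mul_one, mul_zero]
    rw [← Finset.sum_filter, Finset.filter_mem_eq_inter, Finset.inter_eq_right.2 hF]
  have h1 : ∑ P ∈ T, w P * |haarValue w S P| ≤ haarFactor a b * 2 := by
    calc _ ≤ ∑ P ∈ T, w P * (haarFactor a b *
          ((if P ∈ S.1 then 1 else 0) / a + (if P ∈ S.2 then 1 else 0) / b)) :=
          Finset.sum_le_sum fun P hP =>
            mul_le_mul_of_nonneg_left (abs_haarValue_le w P ha0 hb0) (hw P hP).le
      _ = haarFactor a b * ((∑ P ∈ T, w P * (if P ∈ S.1 then 1 else 0)) / a +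
          (∑ P ∈ T, w P * (if P ∈ S.2 then 1 else 0)) / b) := by
          rw [Finset.sum_div, Finset.sum_div, ← Finset.sum_add_distrib, Finset.mul_sum]
          exact Finset.sum_congr rfl fun P _ => by ring
      _ = haarFactor a b * 2 := by
          rw [hsub _ hS1, hsub _ hS2, ← ha, ← hb, div_self ha0.ne', div_self hb0.ne']
          norm_num
  have h2 : a + b ≤ ∑ P ∈ T, w P := by
    rw [ha, hb, ← Finset.sum_union hd]
    exact Finset.sum_le_sum_of_subset_of_nonneg (Finset.union_subset hS1 hS2)
      fun R hR _ => (hw R hR).le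
  refine h1.trans ?_
  rw [← Real.sqrt_eq_rpow]
  refine Real.le_sqrt_of_sq_le (le_trans ?_ h2)
  rw [mul_pow, sq (haarFactor a b), haarFactor_mul_self ha0 hb0, div_mul_eq_mul_div,
    div_le_iff₀ (by positivity)]
  nlinarith [sq_nonneg (a - b)]

/-- Comparison of the L¹ and L^p norms for the measure w dμ. -/
theorem lintegral_mul_rpow_le {μ : Measure I} {p : ℝ} (hp : 1 ≤ p) {g : I → ℂ}
    (hg : AEStronglyMeasurable g μ) {w : I → ℝ≥0∞} (hw : Measurable w) :
    (∫⁻ x, ‖g x‖ₑ * w x ∂μ) ^ p ≤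
      (∫⁻ x, w x ∂μ) ^ (p - 1) * ∫⁻ x, ‖g x‖ₑ ^ p * w x ∂μ := by
  have hp0 : 0 < p := by linarith
  have hν := withDensity_absolutelyContinuous μ w
  have h := eLpNorm_le_eLpNorm_mul_rpow_measure_univ (one_le_ofReal hp) (hg.mono_ac hν)
  rw [eLpNorm_one_eq_lintegral_enorm, eLpNorm_ofReal_eq hp,
    lintegral_withDensity_eq_lintegral_mul₀ hw.aemeasurable hg.enorm,
    lintegral_withDensity_eq_lintegral_mul₀ hw.aemeasurable (hg.enorm.pow_const p),
    withDensity_apply _ MeasurableSet.univ, setLIntegral_univ, ENNReal.toReal_one,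
    ENNReal.toReal_ofReal hp0.le] at h
  simp only [Pi.mul_apply, mul_comm (w _)] at h
  refine (ENNReal.rpow_le_rpow h hp0.le).trans_eq ?_
  rw [ENNReal.mul_rpow_of_nonneg _ _ hp0.le, ← ENNReal.rpow_mul, ← ENNReal.rpow_mul,
    one_div_mul_cancel hp0.ne', ENNReal.rpow_one, mul_comm]
  congr 2
  field_simp

namespace Grid.IsGood

variable (hG : G.IsGood l₁ l₂)
include hG

/-! ### Haar coefficients controlled by mean oscillation -/

theorem integral_haarWavelet [IsFiniteMeasure m] (D : G.Choices) {k : ℕ}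
    {Q : Set I} (hQ : Q ∈ G.cells k) {S : Finset (Set I) × Finset (Set I)}
    (hS : S ∈ G.haarFamily D k Q) (c : ℂ) : haarCoeff m (fun _ => c) S = 0 := by
  obtain ⟨h1, h2, -, hne1, hne2⟩ := hG.haarFamily_props D hQ hS
  have hpos : ∀ F ⊆ G.children k Q, F.Nonempty → ((∑ R ∈ F, m.real R : ℝ) : ℂ) ≠ 0 :=
    fun F hF hne => by
      exact_mod_cast (Finset.sum_pos (fun R hR =>
        Grid.measureReal_pos (Grid.mem_below.1 (hF hR)).1) hne).ne'
  rw [haarCoeff_eq_haarSum (integrable_const c) (fun R hR => Grid.measurableSet_below R (h1 hR))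
    (fun R hR => Grid.measurableSet_below R (h2 hR)), haarSum]
  simp only [setIntegral_const, Complex.real_smul, ← Finset.sum_mul, ← Complex.ofReal_sum]
  rw [mul_div_cancel_left₀ _ (hpos _ h1 hne1), mul_div_cancel_left₀ _ (hpos _ h2 hne2), sub_self,
    mul_zero]

/-- The wavelet has mean zero and is supported in Q, so subtracting a constant from f does not
change the coefficient. -/
theorem enorm_haarCoeff_le [IsFiniteMeasure m] (D : G.Choices) {f : I → ℂ} (hf : Integrable f m)
    {k : ℕ} {Q : Set I} (hQ : Q ∈ G.cells k) {S : Finset (Set I) × Finset (Set I)}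
    (hS : S ∈ G.haarFamily D k Q) (c : ℂ) :
    ‖haarCoeff m f S‖ₑ ≤ ∫⁻ x in Q, ‖f x - c‖ₑ * ‖haarWavelet m S x‖ₑ ∂m := by
  obtain ⟨h1, h2, -, -, -⟩ := hG.haarFamily_props D hQ hS
  have hm1 := fun R hR => Grid.measurableSet_below R (h1 hR)
  have hm2 := fun R hR => Grid.measurableSet_below R (h2 hR)
  have hsub : haarCoeff m f S = haarCoeff m (fun x => f x - c) S := by
    have h3 := hG.integral_haarWavelet D hQ hS c
    rw [haarCoeff_eq_haarSum (integrable_const c) hm1 hm2] at h3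
    rw [haarCoeff_eq_haarSum hf hm1 hm2,
      haarCoeff_eq_haarSum (f := fun x => f x - c) (hf.sub (integrable_const c)) hm1 hm2]
    have h4 : ∀ R, ∫ x in R, f x - c ∂m = ∫ x in R, f x ∂m - ∫ x in R, c ∂m := fun R =>
      integral_sub hf.integrableOn (integrable_const c)
    rw [haarSum] at h3 ⊢
    rw [haarSum]
    simp only [h4, Finset.sum_sub_distrib, sub_div]
    linear_combination (exp := 1) h3
  rw [hsub, haarCoeff]
  refine (enorm_integral_le_lintegral_enorm _).trans_eq ?_
  rw [← lintegral_indicator (G.measurableSet_of_mem k Q hQ)]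
  refine lintegral_congr fun x => ?_
  by_cases hx : x ∈ Q
  · rw [Set.indicator_of_mem hx, enorm_mul]
    congr 1
    rw [← ofReal_norm, ← ofReal_norm, Complex.norm_real]
  · rw [Set.indicator_of_notMem hx, haarWavelet_eq_zero
      (fun R hR h => hx ((Grid.mem_below.1 (h1 hR)).2 h))
      (fun R hR h => hx ((Grid.mem_below.1 (h2 hR)).2 h))]
    simp

theorem setLIntegral_haarWavelet_le [IsFiniteMeasure m] (D : G.Choices) {k : ℕ}
    {Q : Set I} (hQ : Q ∈ G.cells k) {S : Finset (Set I) × Finset (Set I)}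
    (hS : S ∈ G.haarFamily D k Q) :
    ∫⁻ x in Q, ‖haarWavelet m S x‖ₑ ∂m ≤ m Q ^ (1 / 2 : ℝ) := by
  obtain ⟨h1, h2, hd, hne1, hne2⟩ := hG.haarFamily_props D hQ hS
  have hw : ∀ R ∈ G.children k Q, 0 < m.real R := fun R hR =>
    Grid.measureReal_pos (Grid.mem_below.1 hR).1
  have h3 := sum_mul_abs_haarValue_le hw h1 h2 hd hne1 hne2
  have h4 : ∑ P ∈ G.children k Q, m.real P = m.real Q := hG.totalMeasure_children hQ
  rw [h4] at h3
  rw [hG.setLIntegral_eq_sum (Nat.le_succ k) hQ, ← ofReal_measureReal (s := Q) (measure_ne_top _ _),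
    ENNReal.ofReal_rpow_of_pos (Grid.measureReal_pos hQ)]
  refine le_trans (le_of_eq ?_) (ENNReal.ofReal_le_ofReal h3)
  rw [ENNReal.ofReal_sum_of_nonneg fun R hR => mul_nonneg (hw R hR).le (abs_nonneg _)]
  refine Finset.sum_congr rfl fun P hP => ?_
  have hP' := (Grid.mem_below.1 hP).1
  have h5 : ∫⁻ x in P, ‖haarWavelet m S x‖ₑ ∂m = ∫⁻ x in P, ‖haarValue m.real S P‖ₑ ∂m :=
    setLIntegral_congr_fun (G.measurableSet_of_mem _ P hP') fun x hx => by
      simp only [hG.haarWavelet_eq_haarValue h1 h2 hP' hx]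
  rw [h5, setLIntegral_const, ENNReal.ofReal_mul (hw P hP).le,
    ofReal_measureReal (measure_ne_top _ _), mul_comm, ← Real.norm_eq_abs, ofReal_norm]

/-- The Cauchy–Schwarz bound combined with |P| ≥ λ₁|Q| leaves the quantity (n + 1)/(2λ₁), which the
square of `waveletConst` dominates. -/
theorem sum_abs_haarValue_le [IsFiniteMeasure m] (D : G.Choices) {k : ℕ} {Q P : Set I}
    (hQ : Q ∈ G.cells k) (hP : P ∈ G.children k Q) :
    ∑ S ∈ G.haarFamily D k Q, |haarValue m.real S P| ≤
      waveletConst l₁ l₂ * m.real Q ^ (-(1 / 2) : ℝ) := by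
  have hQ0 := Grid.measureReal_pos hQ
  have hP0 := Grid.measureReal_pos (Grid.mem_below.1 hP).1
  have h := sum_abs_haarValue_sq_le D.nodup_order D.mem_order (w := m.real) (G.children k Q)
    (fun R hR => Grid.measureReal_pos (Grid.mem_below.1 hR).1) (hG.two_le_card_children hQ) hP
  have hK := card_div_le_waveletConst_sq hG.pos hG.l₂_pos (hG.card_children_mul_le hQ)
    (hG.one_le_card_children_mul hQ)
  have hK1 := one_le_waveletConst l₁ l₂ hG.pos hG.l₂_pos
  refine (sq_le_sq₀ (Finset.sum_nonneg fun _ _ => abs_nonneg _) (by positivity)).1 (h.trans ?_)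
  have h1 : (m.real Q ^ (-(1 / 2) : ℝ)) ^ 2 = 1 / m.real Q := by
    rw [← Real.rpow_natCast, ← Real.rpow_mul hQ0.le]
    norm_num [Real.rpow_neg_one]
  rw [mul_pow, h1]
  have hl := hG.pos
  calc ((G.children k Q).card + 1 : ℝ) / 2 * (1 / m.real P)
      ≤ ((G.children k Q).card + 1 : ℝ) / 2 * (1 / (l₁ * m.real Q)) := by
        gcongr
        exact (hG.child_ratio hQ hP).1
    _ = ((G.children k Q).card + 1 : ℝ) / 2 / l₁ * (1 / m.real Q) := by field_simp
    _ ≤ _ := by gcongr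

theorem ae_sum_enorm_haarWavelet_le [IsFiniteMeasure m] (D : G.Choices) {k : ℕ} {Q : Set I}
    (hQ : Q ∈ G.cells k) : ∀ᵐ x ∂(m.restrict Q), ∑ S ∈ G.haarFamily D k Q, ‖haarWavelet m S x‖ₑ ≤
      ENNReal.ofReal (waveletConst l₁ l₂) * m Q ^ (-(1 / 2) : ℝ) := by
  have hK1 := one_le_waveletConst l₁ l₂ hG.pos hG.l₂_pos
  filter_upwards [ae_restrict_mem (G.measurableSet_of_mem k Q hQ),
    ae_restrict_of_ae (hG.ae_exists_mem (k + 1))] with x hxQ hx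
  obtain ⟨P, hP, hxP⟩ := hx
  have hPQ : P ∈ G.children k Q :=
    Grid.mem_below.2 ⟨hP, hG.subset_of_inter (Nat.le_succ k) hQ hP hxQ hxP⟩
  rw [← ofReal_measureReal (s := Q) (measure_ne_top _ _),
    ENNReal.ofReal_rpow_of_pos (Grid.measureReal_pos hQ), ← ENNReal.ofReal_mul (by linarith)]
  refine le_trans (le_of_eq ?_) (ENNReal.ofReal_le_ofReal (hG.sum_abs_haarValue_le D hQ hPQ))
  rw [ENNReal.ofReal_sum_of_nonneg fun _ _ => abs_nonneg _]
  refine Finset.sum_congr rfl fun S hS => ?_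
  have h := hG.haarFamily_props D hQ hS
  rw [hG.haarWavelet_eq_haarValue h.1 h.2.1 hP hxP, ← Real.norm_eq_abs, ofReal_norm]

/-- Hölder's inequality with weight |φ_S| keeps the factor |φ_S| inside the integral, so summing
over S costs only the pointwise bound of ∑|φ_S| and not the number of pairs. The powers of |Q|
combine to (p - 1)/2 - 1/2 = p/2 - 1. -/
theorem sum_haarCoeff_rpow_le_lintegral [IsFiniteMeasure m] (D : G.Choices) {p : ℝ} (hp : 1 ≤ p)
    {f : I → ℂ} (hf : Integrable f m) {k : ℕ} {Q : Set I} (hQ : Q ∈ G.cells k) (c : ℂ) :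
    ∑ S ∈ G.haarFamily D k Q, ‖haarCoeff m f S‖ₑ ^ p ≤
      ENNReal.ofReal (waveletConst l₁ l₂) ^ p * m Q ^ (p / 2 - 1) *
        ∫⁻ x in Q, ‖f x - c‖ₑ ^ p ∂m := by
  have hp0 : 0 < p := by linarith
  have hK1 := one_le_waveletConst l₁ l₂ hG.pos hG.l₂_pos
  set K := ENNReal.ofReal (waveletConst l₁ l₂) with hK
  have hK1' : 1 ≤ K := by simpa [hK] using hK1
  have hfc : AEStronglyMeasurable (fun x => f x - c) (m.restrict Q) :=
    (hf.1.sub aestronglyMeasurable_const).restrict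
  have hw : ∀ S ∈ G.haarFamily D k Q, Measurable fun x => ‖haarWavelet m S x‖ₑ := fun S hS => by
    have h := hG.haarFamily_props D hQ hS
    exact (measurable_haarWavelet (fun R hR => Grid.measurableSet_below R (h.1 hR))
      (fun R hR => Grid.measurableSet_below R (h.2.1 hR))).enorm
  have h1 : ∀ S ∈ G.haarFamily D k Q, ‖haarCoeff m f S‖ₑ ^ p ≤
      (m Q ^ (1 / 2 : ℝ)) ^ (p - 1) *
        ∫⁻ x in Q, ‖f x - c‖ₑ ^ p * ‖haarWavelet m S x‖ₑ ∂m := by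
    intro S hS
    refine (ENNReal.rpow_le_rpow (hG.enorm_haarCoeff_le D hf hQ hS c) hp0.le).trans ?_
    refine (lintegral_mul_rpow_le hp hfc (hw S hS)).trans ?_
    exact mul_le_mul' (ENNReal.rpow_le_rpow (hG.setLIntegral_haarWavelet_le D hQ hS)
      (by linarith)) le_rfl
  refine (Finset.sum_le_sum h1).trans ?_
  have h3 : ∑ S ∈ G.haarFamily D k Q, ∫⁻ x in Q, ‖f x - c‖ₑ ^ p * ‖haarWavelet m S x‖ₑ ∂m =
      ∫⁻ x in Q, ‖f x - c‖ₑ ^ p * ∑ S ∈ G.haarFamily D k Q, ‖haarWavelet m S x‖ₑ ∂m := by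
    simp_rw [Finset.mul_sum]
    exact (lintegral_finsetSum' _ fun S hS =>
      (hfc.enorm.pow_const p).mul (hw S hS).aemeasurable).symm
  rw [← Finset.mul_sum, h3]
  have h2 : ∫⁻ x in Q, ‖f x - c‖ₑ ^ p * ∑ S ∈ G.haarFamily D k Q, ‖haarWavelet m S x‖ₑ ∂m ≤
      (∫⁻ x in Q, ‖f x - c‖ₑ ^ p ∂m) * (K * m Q ^ (-(1 / 2) : ℝ)) := by
    rw [← lintegral_mul_const'' _ (hfc.enorm.pow_const p)]
    refine lintegral_mono_ae ?_
    filter_upwards [hG.ae_sum_enorm_haarWavelet_le D hQ] with x hx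
    gcongr
  have hpos := G.measure_pos k Q hQ
  calc _ ≤ (m Q ^ (1 / 2 : ℝ)) ^ (p - 1) *
        ((∫⁻ x in Q, ‖f x - c‖ₑ ^ p ∂m) * (K * m Q ^ (-(1 / 2) : ℝ))) := by gcongr
    _ = K * (m Q ^ (1 / 2 * (p - 1)) * m Q ^ (-(1 / 2) : ℝ)) *
        ∫⁻ x in Q, ‖f x - c‖ₑ ^ p ∂m := by
        rw [ENNReal.rpow_mul]
        ring
    _ = K * m Q ^ (p / 2 - 1) * ∫⁻ x in Q, ‖f x - c‖ₑ ^ p ∂m := by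
        rw [← ENNReal.rpow_add _ _ hpos.ne' (measure_ne_top _ _)]
        congr 3
        ring
    _ ≤ _ := by
        gcongr
        -- Since K ≥ 1, it may be enlarged to K^p, which becomes K after the p-th root.
        calc K = K ^ (1 : ℝ) := (ENNReal.rpow_one K).symm
          _ ≤ K ^ p := ENNReal.rpow_le_rpow_of_exponent_le hK1' hp

theorem sum_haarCoeff_rpow_le_osc [IsFiniteMeasure m] (D : G.Choices) {p : ℝ} (hp : 1 ≤ p)
    {f : I → ℂ} (hf : Integrable f m) {k : ℕ} {Q : Set I} (hQ : Q ∈ G.cells k) :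
    ∑ S ∈ G.haarFamily D k Q, ‖haarCoeff m f S‖ₑ ^ p ≤
      ENNReal.ofReal (waveletConst l₁ l₂) ^ p * m Q ^ (p / 2 - 1) * osc m p f Q ^ p := by
  have hp0 : 0 < p := by linarith
  have hK1 := one_le_waveletConst l₁ l₂ hG.pos hG.l₂_pos
  have hpos := G.measure_pos k Q hQ
  -- B is neither 0 nor ∞, so multiplication by its p-th root commutes with the infimum over c.
  set B := ENNReal.ofReal (waveletConst l₁ l₂) ^ p * m Q ^ (p / 2 - 1) with hB
  have hB0 : B ^ (1 / p) ≠ 0 := by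
    refine (ENNReal.rpow_pos (pos_iff_ne_zero.2 (mul_ne_zero ?_ ?_)) ?_).ne'
    · exact (ENNReal.rpow_pos (by simp; linarith) ENNReal.ofReal_ne_top).ne'
    · exact (ENNReal.rpow_pos hpos (measure_ne_top _ _)).ne'
    · exact ENNReal.mul_ne_top (ENNReal.rpow_ne_top_of_nonneg hp0.le ENNReal.ofReal_ne_top)
        (ENNReal.rpow_ne_top_of_ne_zero hpos.ne' (measure_ne_top _ _))
  have hBt : B ^ (1 / p) ≠ ∞ := ENNReal.rpow_ne_top_of_nonneg (by positivity)
    (ENNReal.mul_ne_top (ENNReal.rpow_ne_top_of_nonneg hp0.le ENNReal.ofReal_ne_top)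
        (ENNReal.rpow_ne_top_of_ne_zero hpos.ne' (measure_ne_top _ _)))
  have h : (∑ S ∈ G.haarFamily D k Q, ‖haarCoeff m f S‖ₑ ^ p) ^ (1 / p) ≤
      B ^ (1 / p) * osc m p f Q := by
    rw [osc, ENNReal.mul_iInf_of_ne hB0 hBt]
    refine le_iInf fun c => ?_
    rw [← ENNReal.mul_rpow_of_nonneg _ _ (by positivity)]
    gcongr
    exact hG.sum_haarCoeff_rpow_le_lintegral D hp hf hQ c
  have h' := ENNReal.rpow_le_rpow h hp0.le
  rwa [ENNReal.mul_rpow_of_nonneg _ _ hp0.le, ← ENNReal.rpow_mul, ← ENNReal.rpow_mul,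
    one_div_mul_cancel hp0.ne', ENNReal.rpow_one, ENNReal.rpow_one] at h'

theorem haarNorm_le_oscNorm [IsFiniteMeasure m] (D : G.Choices) {s p : ℝ} (hp : 1 ≤ p)
    {q : ℝ≥0∞} (hq : 1 ≤ q) {f : I → ℂ} (hf : Integrable f m) :
    G.haarNorm D s p q f ≤ ENNReal.ofReal (waveletConst l₁ l₂) * G.oscNorm s p q f := by
  have hp0 : 0 < p := by linarith
  have hK1 : 1 ≤ ENNReal.ofReal (waveletConst l₁ l₂) := by
    simpa using one_le_waveletConst l₁ l₂ hG.pos hG.l₂_pos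
  set K := ENNReal.ofReal (waveletConst l₁ l₂) with hK
  have hIpos := hG.measure_univ_pos
  have hIne := measure_ne_top m Set.univ
  rw [Grid.haarNorm, Grid.oscNorm, mul_add]
  refine add_le_add ?_ ?_
  · refine le_trans ?_ (le_mul_of_one_le_left' hK1)
    -- |d_I| is at most |I|^{-1/2} |f|_1, then Hölder's inequality passes to |f|_p; the exponents of
    -- |I| add up to -s.
    have h1 : ‖haarCoeffTop m f‖ₑ ≤ eLpNorm f 1 m * m Set.univ ^ (-(1 / 2) : ℝ) := by
      rw [haarCoeffTop_eq, enorm_mul, one_div (m.real Set.univ ^ _), ← Real.rpow_neg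
        measureReal_nonneg, enorm_measureReal_rpow hIpos, eLpNorm_one_eq_lintegral_enorm]
      gcongr
      exact enorm_integral_le_lintegral_enorm _
    have h2 := eLpNorm_le_eLpNorm_mul_rpow_measure_univ (one_le_ofReal hp) hf.1
    rw [ENNReal.toReal_one, ENNReal.toReal_ofReal hp0.le, div_one] at h2
    calc _ ≤ m Set.univ ^ (1 / p - s - 1 / 2) * (eLpNorm f (ENNReal.ofReal p) m *
          m Set.univ ^ (1 - 1 / p) * m Set.univ ^ (-(1 / 2) : ℝ)) := by
          gcongr
          exact h1.trans (by gcongr)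
      _ = m Set.univ ^ (1 / p - s - 1 / 2) * m Set.univ ^ (1 - 1 / p) *
          m Set.univ ^ (-(1 / 2) : ℝ) * eLpNorm f (ENNReal.ofReal p) m := by ring
      _ = _ := by
          rw [← ENNReal.rpow_add _ _ hIpos.ne' hIne, ← ENNReal.rpow_add _ _ hIpos.ne' hIne]
          congr 2
          ring
  · rw [← lqNorm_const_mul hq]
    refine lqNorm_mono fun k => ?_
    have h3 : ∀ x : ℝ≥0∞, K * x ^ (1 / p) = (K ^ p * x) ^ (1 / p) := fun x => by
      rw [ENNReal.mul_rpow_of_nonneg _ _ (by positivity), ← ENNReal.rpow_mul,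
        mul_one_div_cancel hp0.ne', ENNReal.rpow_one]
    rw [h3, Finset.mul_sum]
    refine ENNReal.rpow_le_rpow (Finset.sum_le_sum fun Q hQ => ?_) (by positivity)
    have hpos := G.measure_pos k Q hQ
    calc _ ≤ m Q ^ (1 - s * p - p / 2) * (K ^ p * m Q ^ (p / 2 - 1) * osc m p f Q ^ p) := by
          gcongr
          exact hG.sum_haarCoeff_rpow_le_osc D hp hf hQ
      _ = K ^ p * (m Q ^ (1 - s * p - p / 2) * m Q ^ (p / 2 - 1) * osc m p f Q ^ p) := by ring
      _ = _ := by
          rw [← ENNReal.rpow_add _ _ hpos.ne' (measure_ne_top _ _)]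
          congr 3
          ring

end Grid.IsGood

/-! ### Standard coefficients controlled by Haar coefficients -/

theorem rpow_le_max_of_mem_Icc {a b t : ℝ} (ha : 0 < a) (hat : a ≤ t) (htb : t ≤ b) (r : ℝ) :
    t ^ r ≤ max (b ^ r) (a ^ r) := by
  rcases le_total 0 r with hr | hr
  · exact le_max_of_le_left (Real.rpow_le_rpow (ha.le.trans hat) htb hr)
  · exact le_max_of_le_right (Real.rpow_le_rpow_of_nonpos ha hat hr)

theorem max_rpow_pos (h₁ : 0 < l₁) (r : ℝ) : 0 < max (l₂ ^ r) (l₁ ^ r) :=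
  lt_max_of_lt_right (Real.rpow_pos_of_pos h₁ r)

theorem one_le_stdConst (h₁ : 0 < l₁) (h₂ : 0 < l₂) (s p : ℝ) : 1 ≤ stdConst l₁ l₂ s p := by
  have h := one_le_waveletConst l₁ l₂ h₁ h₂
  have h' := max_rpow_pos (l₂ := l₂) h₁ (1 / p - s)
  have : 0 ≤ waveletConst l₁ l₂ * max (l₂ ^ (1 / p - s)) (l₁ ^ (1 / p - s)) * l₁ ^ (-2 - 1 / p) := by
    positivity
  rw [stdConst]
  linarith

/-- The estimates below use only the power λ₁^{-3/2}; the stated constant is larger because λ₁ < 1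
and `waveletConst` is at least 1. -/
theorem max_mul_le_stdConst (h₁ : 0 < l₁) (h₁' : l₁ < 1) (h₂ : 0 < l₂) (s : ℝ) {p : ℝ}
    (hp : 1 ≤ p) :
    max (l₂ ^ (1 / p - s)) (l₁ ^ (1 / p - s)) * l₁ ^ (-(3 / 2) : ℝ) ≤ stdConst l₁ l₂ s p := by
  have h := one_le_waveletConst l₁ l₂ h₁ h₂
  have h' := max_rpow_pos (l₂ := l₂) h₁ (1 / p - s)
  have h3 : l₁ ^ (-(3 / 2) : ℝ) ≤ l₁ ^ (-2 - 1 / p) := by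
    refine Real.rpow_le_rpow_of_exponent_ge h₁ h₁'.le ?_
    have : 0 < 1 / p := by positivity
    linarith
  rw [stdConst]
  calc _ ≤ 1 * max (l₂ ^ (1 / p - s)) (l₁ ^ (1 / p - s)) * l₁ ^ (-2 - 1 / p) := by
        rw [one_mul]; gcongr
    _ ≤ waveletConst l₁ l₂ * max (l₂ ^ (1 / p - s)) (l₁ ^ (1 / p - s)) * l₁ ^ (-2 - 1 / p) := by
        gcongr
    _ ≤ _ := by linarith

namespace Grid.IsGood

variable (hG : G.IsGood l₁ l₂)
include hG

/-- A single term of the identity for the sum of squares is at most 1/|P| ≤ 1/(λ₁|Q|). -/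
theorem abs_haarValue_le_rpow [IsFiniteMeasure m] (D : G.Choices) {k : ℕ} {Q P : Set I}
    (hQ : Q ∈ G.cells k) (hP : P ∈ G.children k Q) {S : Finset (Set I) × Finset (Set I)}
    (hS : S ∈ G.haarFamily D k Q) : |haarValue m.real S P| ≤ (l₁ * m.real Q) ^ (-(1 / 2) : ℝ) := by
  have hQ0 := Grid.measureReal_pos hQ
  have hl := hG.pos
  have h := sum_haarValue_sq D.nodup_order D.mem_order (w := m.real) (G.children k Q)
    (fun R hR => Grid.measureReal_pos (Grid.mem_below.1 hR).1) (hG.two_le_card_children hQ) hP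
  have h4 : ∑ P ∈ G.children k Q, m.real P = m.real Q := hG.totalMeasure_children hQ
  have h1 : haarValue m.real S P ^ 2 ≤ 1 / m.real P - 1 / m.real Q := by
    rw [← h4, ← h]
    exact Finset.single_le_sum (f := fun S => haarValue m.real S P ^ 2)
      (fun _ _ => sq_nonneg _) hS
  refine (sq_le_sq₀ (abs_nonneg _) (by positivity)).1 ?_
  have h2 : ((l₁ * m.real Q) ^ (-(1 / 2) : ℝ)) ^ 2 = 1 / (l₁ * m.real Q) := by
    rw [← Real.rpow_natCast, ← Real.rpow_mul (by positivity)]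
    norm_num [Real.rpow_neg_one]
  rw [sq_abs, h2]
  have h3 : 1 / m.real P ≤ 1 / (l₁ * m.real Q) := by
    gcongr
    exact (hG.child_ratio hQ hP).1
  have h5 : 0 < 1 / m.real Q := by positivity
  linarith

/-- The ratio |P|/|Q| lies in [λ₁, λ₂]; the sign of 1/p - s is not known, so the larger endpoint
value is taken. -/
theorem one_div_measureReal_rpow_le [IsFiniteMeasure m] (s p : ℝ) {k : ℕ} {Q P : Set I}
    (hQ : Q ∈ G.cells k) (hP : P ∈ G.children k Q) :
    1 / m.real P ^ (s - 1 / p) ≤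
      max (l₂ ^ (1 / p - s)) (l₁ ^ (1 / p - s)) * m.real Q ^ (1 / p - s) := by
  have hQ0 := Grid.measureReal_pos hQ
  have hP0 := Grid.measureReal_pos (Grid.mem_below.1 hP).1
  have hr := hG.child_ratio hQ hP
  have h1 : 1 / m.real P ^ (s - 1 / p) = (m.real P / m.real Q) ^ (1 / p - s) *
      m.real Q ^ (1 / p - s) := by
    rw [← Real.mul_rpow (by positivity) hQ0.le, div_mul_cancel₀ _ hQ0.ne', one_div
      (m.real P ^ _), ← Real.rpow_neg hP0.le, neg_sub]
  rw [h1]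
  gcongr
  exact rpow_le_max_of_mem_Icc hG.pos ((le_div_iff₀ hQ0).2 hr.1) ((div_le_iff₀ hQ0).2 hr.2) _

/-- Only the pairs that see P contribute, at most as many as there are children, and the power mean
inequality brings in this number to the power p - 1. -/
theorem enorm_stdCoeff_rpow_le [IsFiniteMeasure m] (D : G.Choices) (s : ℝ) {p : ℝ} (hp : 1 ≤ p)
    (f : I → ℂ) {k : ℕ} {Q P : Set I} (hQ : Q ∈ G.cells k) (hP : P ∈ G.children k Q) :
    ‖G.stdCoeff D s p f (k + 1) P‖ₑ ^ p ≤
      ENNReal.ofReal (max (l₂ ^ (1 / p - s)) (l₁ ^ (1 / p - s)) * m.real Q ^ (1 / p - s) *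
        (l₁ * m.real Q) ^ (-(1 / 2) : ℝ)) ^ p *
      ((G.children k Q).card : ℝ≥0∞) ^ (p - 1) *
      ∑ S ∈ G.haarFamily D k Q, ‖haarCoeff m f S‖ₑ ^ p := by
  classical
  have hp0 : 0 < p := by linarith
  have hP' := (Grid.mem_below.1 hP).1
  have hQ0 := Grid.measureReal_pos hQ
  have hM := max_rpow_pos (l₂ := l₂) hG.pos (1 / p - s)
  have hcard : ((G.haarFamily D k Q).filter fun S => P ∈ S.1 ∨ P ∈ S.2).card ≤
      (G.children k Q).card :=
    (card_pairs_of_mem_le D.nodup_order D.mem_order _ (hG.two_le_card_children hQ) hP).trans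
      (by have := hG.two_le_card_children hQ; omega)
  have h1 : ‖((1 / m.real P ^ (s - 1 / p) : ℝ) : ℂ)‖ₑ ≤ ENNReal.ofReal
      (max (l₂ ^ (1 / p - s)) (l₁ ^ (1 / p - s)) * m.real Q ^ (1 / p - s)) := by
    rw [← ofReal_norm, Complex.norm_real, Real.norm_of_nonneg (by positivity)]
    exact ENNReal.ofReal_le_ofReal (hG.one_div_measureReal_rpow_le s p hQ hP)
  have h2 : ∑ S ∈ G.haarFamily D k Q, haarCoeff m f S * (haarWavelet m S (D.pt P) : ℂ) =
      ∑ S ∈ (G.haarFamily D k Q).filter (fun S => P ∈ S.1 ∨ P ∈ S.2),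
        haarCoeff m f S * (haarValue m.real S P : ℂ) := by
    rw [Finset.sum_filter]
    refine Finset.sum_congr rfl fun S hS => ?_
    have h := hG.haarFamily_props D hQ hS
    rw [hG.haarWavelet_eq_haarValue h.1 h.2.1 hP' (D.pt_mem _ P hP')]
    split_ifs with h'
    · rfl
    · push Not at h'
      rw [haarValue_eq_zero _ h'.1 h'.2, Complex.ofReal_zero, mul_zero]
  have h3 : ‖∑ S ∈ G.haarFamily D k Q, haarCoeff m f S * (haarWavelet m S (D.pt P) : ℂ)‖ₑ ≤
      ENNReal.ofReal ((l₁ * m.real Q) ^ (-(1 / 2) : ℝ)) *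
        ∑ S ∈ (G.haarFamily D k Q).filter (fun S => P ∈ S.1 ∨ P ∈ S.2), ‖haarCoeff m f S‖ₑ := by
    rw [h2, Finset.mul_sum]
    refine (enorm_sum_le _ _).trans (Finset.sum_le_sum fun S hS => ?_)
    rw [enorm_mul, mul_comm]
    gcongr
    rw [← ofReal_norm, Complex.norm_real, Real.norm_eq_abs]
    exact ENNReal.ofReal_le_ofReal
      (hG.abs_haarValue_le_rpow D hQ hP (Finset.mem_filter.1 hS).1)
  have h4 : (∑ S ∈ (G.haarFamily D k Q).filter (fun S => P ∈ S.1 ∨ P ∈ S.2),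
      ‖haarCoeff m f S‖ₑ) ^ p ≤ ((G.children k Q).card : ℝ≥0∞) ^ (p - 1) *
      ∑ S ∈ G.haarFamily D k Q, ‖haarCoeff m f S‖ₑ ^ p := by
    refine (ENNReal.rpow_sum_le_const_mul_sum_rpow _ _ hp).trans (mul_le_mul' ?_ ?_)
    · exact ENNReal.rpow_le_rpow (by exact_mod_cast hcard) (by linarith)
    · exact Finset.sum_le_sum_of_subset (Finset.filter_subset _ _)
  rw [hG.stdCoeff_succ_eq D s p f hQ hP, enorm_mul]
  calc _ ≤ (ENNReal.ofReal (max (l₂ ^ (1 / p - s)) (l₁ ^ (1 / p - s)) * m.real Q ^ (1 / p - s)) *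
        (ENNReal.ofReal ((l₁ * m.real Q) ^ (-(1 / 2) : ℝ)) *
        ∑ S ∈ (G.haarFamily D k Q).filter (fun S => P ∈ S.1 ∨ P ∈ S.2),
          ‖haarCoeff m f S‖ₑ)) ^ p := by gcongr
    _ = ENNReal.ofReal (max (l₂ ^ (1 / p - s)) (l₁ ^ (1 / p - s)) * m.real Q ^ (1 / p - s) *
        (l₁ * m.real Q) ^ (-(1 / 2) : ℝ)) ^ p *
        (∑ S ∈ (G.haarFamily D k Q).filter (fun S => P ∈ S.1 ∨ P ∈ S.2),
          ‖haarCoeff m f S‖ₑ) ^ p := by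
        rw [← mul_assoc, ← ENNReal.ofReal_mul (by positivity), ENNReal.mul_rpow_of_nonneg _ _ hp0.le]
    _ ≤ _ := by
        rw [mul_assoc (ENNReal.ofReal _ ^ p)]
        exact mul_le_mul' le_rfl h4

theorem sum_enorm_stdCoeff_rpow_le [IsFiniteMeasure m] (D : G.Choices) (s : ℝ) {p : ℝ}
    (hp : 1 ≤ p) (f : I → ℂ) {k : ℕ} {Q : Set I} (hQ : Q ∈ G.cells k) :
    ∑ P ∈ G.children k Q, ‖G.stdCoeff D s p f (k + 1) P‖ₑ ^ p ≤
      ENNReal.ofReal (stdConst l₁ l₂ s p) ^ p * (m Q ^ (1 - s * p - p / 2) *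
        ∑ S ∈ G.haarFamily D k Q, ‖haarCoeff m f S‖ₑ ^ p) := by
  have hp0 : 0 < p := by linarith
  have hQ0 := Grid.measureReal_pos hQ
  have hl := hG.pos
  have hM := max_rpow_pos (l₂ := l₂) hG.pos (1 / p - s)
  set M := max (l₂ ^ (1 / p - s)) (l₁ ^ (1 / p - s)) with hMdef
  set n := (G.children k Q).card with hn
  set B := ∑ S ∈ G.haarFamily D k Q, ‖haarCoeff m f S‖ₑ ^ p with hB
  have hn0 : 0 < n := by have := hG.two_le_card_children hQ; omega
  have hnl : (n : ℝ) ≤ l₁⁻¹ := by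
    rw [← one_div, le_div_iff₀ hl]
    exact hG.card_children_mul_le hQ
  refine (Finset.sum_le_card_nsmul _ _ _ fun P hP =>
    hG.enorm_stdCoeff_rpow_le D s hp f hQ hP).trans ?_
  rw [← hn, ← hMdef, ← hB, nsmul_eq_mul]
  -- Summing the same bound over the n children completes n^{p-1} to n^p, and n ≤ λ₁⁻¹ turns
  -- λ₁^{-1/2} into λ₁^{-3/2}.
  have h1 : (n : ℝ≥0∞) * (n : ℝ≥0∞) ^ (p - 1) = ENNReal.ofReal n ^ p := by
    have h0 : (n : ℝ≥0∞) ≠ 0 := by exact_mod_cast hn0.ne'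
    nth_rw 1 [← ENNReal.rpow_one (n : ℝ≥0∞)]
    rw [← ENNReal.rpow_add _ _ h0 (ENNReal.natCast_ne_top n), add_sub_cancel, ENNReal.ofReal_natCast]
  have h2 : M * m.real Q ^ (1 / p - s) * (l₁ * m.real Q) ^ (-(1 / 2) : ℝ) * n ≤
      stdConst l₁ l₂ s p * m.real Q ^ (1 / p - s - 1 / 2) := by
    have h3 : (l₁ * m.real Q) ^ (-(1 / 2) : ℝ) =
        l₁ ^ (-(1 / 2) : ℝ) * m.real Q ^ (-(1 / 2) : ℝ) := Real.mul_rpow hl.le hQ0.le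
    have h4 : l₁ ^ (-(1 / 2) : ℝ) * l₁⁻¹ = l₁ ^ (-(3 / 2) : ℝ) := by
      rw [← Real.rpow_neg_one, ← Real.rpow_add hl]; norm_num
    have h5 : m.real Q ^ (1 / p - s) * m.real Q ^ (-(1 / 2) : ℝ) =
        m.real Q ^ (1 / p - s - 1 / 2) := by rw [← Real.rpow_add hQ0, ← sub_eq_add_neg]
    calc _ ≤ M * m.real Q ^ (1 / p - s) * (l₁ * m.real Q) ^ (-(1 / 2) : ℝ) * l₁⁻¹ := by gcongr
      _ = M * l₁ ^ (-(3 / 2) : ℝ) * m.real Q ^ (1 / p - s - 1 / 2) := by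
          rw [h3, ← h4, ← h5]; ring
      _ ≤ _ := by
          gcongr
          exact max_mul_le_stdConst hl (hG.lt.trans hG.lt_one) hG.l₂_pos s hp
  have h6 : ENNReal.ofReal (m.real Q ^ (1 / p - s - 1 / 2)) ^ p = m Q ^ (1 - s * p - p / 2) := by
    rw [← ENNReal.ofReal_rpow_of_pos hQ0, ofReal_measureReal (measure_ne_top _ _),
      ← ENNReal.rpow_mul]
    congr 1
    field_simp
  calc _ = ENNReal.ofReal (M * m.real Q ^ (1 / p - s) * (l₁ * m.real Q) ^ (-(1 / 2) : ℝ)) ^ p *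
        ((n : ℝ≥0∞) * (n : ℝ≥0∞) ^ (p - 1)) * B := by ring
    _ = ENNReal.ofReal (M * m.real Q ^ (1 / p - s) * (l₁ * m.real Q) ^ (-(1 / 2) : ℝ) * n) ^ p *
        B := by
        rw [h1, ← ENNReal.mul_rpow_of_nonneg _ _ hp0.le, ← ENNReal.ofReal_mul (by positivity)]
    _ ≤ ENNReal.ofReal (stdConst l₁ l₂ s p * m.real Q ^ (1 / p - s - 1 / 2)) ^ p * B := by
        gcongr
    _ = _ := by
        have := one_le_stdConst hl hG.l₂_pos s p
        rw [ENNReal.ofReal_mul (by linarith), ENNReal.mul_rpow_of_nonneg _ _ hp0.le, h6, mul_assoc]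

theorem stdNorm_le_haarNorm [IsFiniteMeasure m] (D : G.Choices) (s : ℝ) {p : ℝ} (hp : 1 ≤ p)
    {q : ℝ≥0∞} (hq : 1 ≤ q) (f : I → ℂ) :
    G.stdNorm D s p q f ≤ ENNReal.ofReal (stdConst l₁ l₂ s p) * G.haarNorm D s p q f := by
  have hp0 : 0 < p := by linarith
  have hK1 : 1 ≤ ENNReal.ofReal (stdConst l₁ l₂ s p) := by
    simpa using one_le_stdConst hG.pos hG.l₂_pos s p
  rw [Grid.stdNorm, Grid.haarNorm, mul_add]
  refine add_le_add ?_ ?_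
  · refine le_trans (le_of_eq ?_) (le_mul_of_one_le_left' hK1)
    rw [Grid.stdCoeff, enorm_mul, enorm_measureReal_rpow hG.measure_univ_pos]
  · rw [← lqNorm_const_mul hq]
    refine lqNorm_mono fun k => ?_
    have h3 : ∀ K x : ℝ≥0∞, K * x ^ (1 / p) = (K ^ p * x) ^ (1 / p) := fun K x => by
      rw [ENNReal.mul_rpow_of_nonneg _ _ (by positivity), ← ENNReal.rpow_mul,
        mul_one_div_cancel hp0.ne', ENNReal.rpow_one]
    rw [h3, Finset.mul_sum, lpSum, ← hG.sum_sum_below (Nat.le_succ k)]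
    exact ENNReal.rpow_le_rpow (Finset.sum_le_sum fun Q hQ =>
      hG.sum_enorm_stdCoeff_rpow_le D s hp f hQ) (by positivity)

end Grid.IsGood

/-! ### The four norms -/

theorem eLpNorm_const_mul (z : ℂ) (f : I → ℂ) (p : ℝ≥0∞) (μ : Measure I) :
    eLpNorm (fun x => z * f x) p μ = ‖z‖ₑ * eLpNorm f p μ :=
  eLpNorm_const_smul z f p μ

theorem Grid.IsRepresentation.besovNorm_le {s p : ℝ} (q : ℝ≥0∞) {c : Set I → ℂ}
    {a : Set I → I → ℂ} {f : I → ℂ} (h : G.IsRepresentation s p c a f) :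
    G.besovNorm s p q f ≤ G.cost p q c :=
  iInf_le_of_le c (iInf_le_of_le a (iInf_le _ h))

theorem Grid.isRepresentation_zero [IsFiniteMeasure m] {s p : ℝ} {f : I → ℂ}
    (hf : f =ᵐ[m] fun _ => 0) :
    G.IsRepresentation s p (fun _ => 0) (canonicalAtom m s p) f where
  atom k Q hQ := isSouzaAtom_canonicalAtom s p hQ
  abs_conv := by
    have : ∀ k, G.block (fun _ => 0) (canonicalAtom m s p) k = fun _ => 0 := fun k => by
      ext x
      simp [Grid.block]
    simp [this]
  tendsto := by
    refine tendsto_const_nhds.congr fun n => ?_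
    rw [eLpNorm_congr_ae (g := fun _ => (0 : ℂ)), eLpNorm_zero']
    filter_upwards [hf] with x hx
    simp [Grid.block, hx]

theorem Grid.besovNorm_eq_zero_of_ae [IsFiniteMeasure m] {s p : ℝ} (hp : 1 ≤ p) {q : ℝ≥0∞}
    (hq : 1 ≤ q) {f : I → ℂ} (hf : f =ᵐ[m] fun _ => 0) : G.besovNorm s p q f = 0 := by
  have hp0 : 0 < p := by linarith
  refine le_antisymm ?_ zero_le
  refine ((Grid.isRepresentation_zero hf).besovNorm_le q).trans_eq ?_
  rw [Grid.cost, ← lqNorm_zero hq]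
  congr 1
  ext k
  simp [lpSum, hp0]

/-- Both series use the canonical atoms, so the coefficients can be added; with arbitrary atoms this
would fail. -/
theorem Grid.IsRepresentation.add [IsFiniteMeasure m] {s p : ℝ} (hp : 1 ≤ p) {c c' : Set I → ℂ}
    {f g : I → ℂ} (hf : AEStronglyMeasurable f m) (hg : AEStronglyMeasurable g m)
    (h : G.IsRepresentation s p c (canonicalAtom m s p) f)
    (h' : G.IsRepresentation s p c' (canonicalAtom m s p) g) :
    G.IsRepresentation s p (fun Q => c Q + c' Q) (canonicalAtom m s p) fun x => f x + g x := by
  have hb : ∀ k, G.block (fun Q => c Q + c' Q) (canonicalAtom m s p) k =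
      G.block c (canonicalAtom m s p) k + G.block c' (canonicalAtom m s p) k := by
    intro k
    ext x
    simp only [Grid.block, Pi.add_apply, ← Finset.sum_add_distrib, add_mul]
  have hm := fun c k => (Grid.measurable_canonicalBlock (G := G) s p c k).aestronglyMeasurable (μ := m)
  have hsm : ∀ (f : I → ℂ), AEStronglyMeasurable f m → ∀ c n, AEStronglyMeasurable
      (fun x => f x - ∑ k ∈ Finset.range n, G.canonicalBlock s p c k x) m := fun f hf c n =>
    hf.sub (Finset.measurable_fun_sum _ fun k _ =>
      Grid.measurable_canonicalBlock s p c k).aestronglyMeasurable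
  refine ⟨h.atom, ?_, ?_⟩
  · refine lt_of_le_of_lt ?_ (ENNReal.add_lt_top.2 ⟨h.abs_conv, h'.abs_conv⟩)
    rw [← ENNReal.tsum_add]
    refine ENNReal.tsum_le_tsum fun k => ?_
    rw [hb]
    exact eLpNorm_add_le (hm c k) (hm c' k) (one_le_ofReal hp)
  · have hl := h.tendsto.add h'.tendsto
    rw [add_zero] at hl
    refine tendsto_of_tendsto_of_tendsto_of_le_of_le tendsto_const_nhds hl
      (fun _ => zero_le) fun n => ?_
    refine le_trans (le_of_eq ?_)
      (eLpNorm_add_le (hsm f hf c n) (hsm g hg c' n) (one_le_ofReal hp))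
    congr 1
    ext x
    simp only [hb, Pi.add_apply, Finset.sum_add_distrib]
    ring

theorem Grid.cost_add_le {p : ℝ} (hp : 1 ≤ p) {q : ℝ≥0∞} (hq : 1 ≤ q) (c c' : Set I → ℂ) :
    G.cost p q (fun Q => c Q + c' Q) ≤ G.cost p q c + G.cost p q c' :=
  (lqNorm_mono fun _ => (lpSum_mono _ hp fun _ _ => enorm_add_le _ _).trans
    (lpSum_add_le _ hp _ _)).trans (lqNorm_add_le hq _ _)

theorem Grid.besovNorm_add_le [IsFiniteMeasure m] {s p : ℝ} (hp : 1 ≤ p) {q : ℝ≥0∞} (hq : 1 ≤ q)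
    {f g : I → ℂ} (hf : AEStronglyMeasurable f m) (hg : AEStronglyMeasurable g m) :
    G.besovNorm s p q (fun x => f x + g x) ≤ G.besovNorm s p q f + G.besovNorm s p q g := by
  rw [Grid.besovNorm, Grid.besovNorm, Grid.besovNorm]
  simp only [ENNReal.iInf_add, ENNReal.add_iInf]
  refine le_iInf fun c₂ => le_iInf fun a₂ => le_iInf fun h₂ => le_iInf fun c₁ => le_iInf fun a₁ =>
    le_iInf fun h₁ => ?_
  obtain ⟨c₁', hc₁, h₁'⟩ := h₁.exists_canonical
  obtain ⟨c₂', hc₂, h₂'⟩ := h₂.exists_canonical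
  refine ((h₁'.add hp hf hg h₂').besovNorm_le q).trans ?_
  exact (Grid.cost_add_le hp hq _ _).trans
    (add_le_add (Grid.cost_mono hp hc₁) (Grid.cost_mono hp hc₂))

theorem Grid.IsRepresentation.const_mul {s p : ℝ} {c : Set I → ℂ} {a : Set I → I → ℂ}
    {f : I → ℂ} (h : G.IsRepresentation s p c a f) (z : ℂ) :
    G.IsRepresentation s p (fun Q => z * c Q) a fun x => z * f x := by
  have hb : ∀ k x, G.block (fun Q => z * c Q) a k x = z * G.block c a k x := by
    intro k x
    simp only [Grid.block, Finset.mul_sum, mul_assoc]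
  refine ⟨h.atom, ?_, ?_⟩
  · have : ∀ k, eLpNorm (G.block (fun Q => z * c Q) a k) (ENNReal.ofReal p) m =
        ‖z‖ₑ * eLpNorm (G.block c a k) (ENNReal.ofReal p) m := fun k => by
      rw [← eLpNorm_const_mul]
      congr 1
      ext x
      exact hb k x
    simp_rw [this]
    rw [ENNReal.tsum_mul_left]
    exact ENNReal.mul_lt_top enorm_lt_top h.abs_conv
  · have hl := ENNReal.Tendsto.const_mul (a := ‖z‖ₑ) h.tendsto (Or.inr enorm_ne_top)
    rw [mul_zero] at hl
    refine hl.congr fun n => ?_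
    rw [← eLpNorm_const_mul]
    congr 1
    ext x
    simp only [hb, ← Finset.mul_sum, mul_sub]

theorem Grid.cost_const_mul {p : ℝ} (hp : 1 ≤ p) {q : ℝ≥0∞} (hq : 1 ≤ q) (z : ℂ)
    (c : Set I → ℂ) : G.cost p q (fun Q => z * c Q) = ‖z‖ₑ * G.cost p q c := by
  simp only [Grid.cost, enorm_mul, lpSum_const_mul _ hp, lqNorm_const_mul hq]

theorem Grid.besovNorm_const_mul_le [IsFiniteMeasure m] {s p : ℝ} (hp : 1 ≤ p) {q : ℝ≥0∞}
    (hq : 1 ≤ q) (z : ℂ) (f : I → ℂ) :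
    G.besovNorm s p q (fun x => z * f x) ≤ ‖z‖ₑ * G.besovNorm s p q f := by
  -- For z = 0 the factor does not pass through an infimum that may be ∞.
  rcases eq_or_ne z 0 with rfl | hz
  · rw [Grid.besovNorm_eq_zero_of_ae hp hq (by simp)]
    exact zero_le
  · have hz' : ‖z‖ₑ ≠ 0 := by simpa using hz
    rw [Grid.besovNorm, Grid.besovNorm]
    simp only [ENNReal.mul_iInf_of_ne hz' enorm_ne_top]
    refine le_iInf fun c => le_iInf fun a => le_iInf fun h => ?_
    rw [← Grid.cost_const_mul hp hq]
    exact (h.const_mul z).besovNorm_le q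

theorem haarCoeff_const_mul (z : ℂ) (f : I → ℂ) (S : Finset (Set I) × Finset (Set I)) :
    haarCoeff m (fun x => z * f x) S = z * haarCoeff m f S := by
  rw [haarCoeff, haarCoeff, ← integral_const_mul]
  simp only [mul_assoc]

theorem haarCoeffTop_const_mul (z : ℂ) (f : I → ℂ) :
    haarCoeffTop m (fun x => z * f x) = z * haarCoeffTop m f := by
  rw [haarCoeffTop, haarCoeffTop, ← integral_const_mul]
  simp only [mul_assoc]

theorem haarCoeffTop_add {f g : I → ℂ} (hf : Integrable f m) (hg : Integrable g m) :
    haarCoeffTop m (fun x => f x + g x) = haarCoeffTop m f + haarCoeffTop m g := by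
  rw [haarCoeffTop_eq, haarCoeffTop_eq, haarCoeffTop_eq, integral_add hf hg, add_mul]

theorem haarCoeff_add {f g : I → ℂ} (hf : Integrable f m) (hg : Integrable g m)
    {S : Finset (Set I) × Finset (Set I)} (h1 : ∀ R ∈ S.1, MeasurableSet R)
    (h2 : ∀ R ∈ S.2, MeasurableSet R) :
    haarCoeff m (fun x => f x + g x) S = haarCoeff m f S + haarCoeff m g S := by
  rw [haarCoeff_eq_haarSum (f := fun x => f x + g x) (hf.add hg) h1 h2,
    haarCoeff_eq_haarSum hf h1 h2, haarCoeff_eq_haarSum hg h1 h2]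
  have h4 : ∀ R, ∫ x in R, f x + g x ∂m = ∫ x in R, f x ∂m + ∫ x in R, g x ∂m := fun R =>
    integral_add hf.integrableOn hg.integrableOn
  simp only [haarSum, h4, Finset.sum_add_distrib]
  ring

theorem Grid.stdCoeff_const_mul (D : G.Choices) (s p : ℝ) (z : ℂ) (f : I → ℂ) (k : ℕ)
    (P : Set I) : G.stdCoeff D s p (fun x => z * f x) k P = z * G.stdCoeff D s p f k P := by
  cases k with
  | zero =>
    rw [Grid.stdCoeff, Grid.stdCoeff, haarCoeffTop_const_mul]
    ring
  | succ k =>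
    rw [Grid.stdCoeff, Grid.stdCoeff, mul_left_comm]
    simp only [haarCoeff_const_mul, Finset.mul_sum, mul_assoc]

theorem Grid.stdNorm_const_mul_le (D : G.Choices) (s : ℝ) {p : ℝ} (hp : 1 ≤ p) {q : ℝ≥0∞}
    (hq : 1 ≤ q) (z : ℂ) (f : I → ℂ) :
    G.stdNorm D s p q (fun x => z * f x) ≤ ‖z‖ₑ * G.stdNorm D s p q f := by
  simp only [Grid.stdNorm, Grid.stdCoeff_const_mul, enorm_mul, lpSum_const_mul _ hp,
    lqNorm_const_mul hq, mul_add, le_refl]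

/-- The level `k` term of `N_haar` as a weighted `ℓ^p` norm. -/
theorem Grid.haarLevel_eq_weightedSum (D : G.Choices) (s p : ℝ) (f : I → ℂ) (k : ℕ) :
    (∑ Q ∈ G.cells k, m Q ^ (1 - s * p - p / 2) *
        ∑ S ∈ G.haarFamily D k Q, ‖haarCoeff m f S‖ₑ ^ p) ^ (1 / p) =
      weightedSum p ((G.cells k).sigma fun Q => G.haarFamily D k Q)
        (fun x => m x.1 ^ (1 - s * p - p / 2)) fun x => ‖haarCoeff m f x.2‖ₑ := by
  rw [weightedSum, Finset.sum_sigma]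
  simp only [Finset.mul_sum]

theorem Grid.haarNorm_const_mul_le (D : G.Choices) (s : ℝ) {p : ℝ} (hp : 1 ≤ p) {q : ℝ≥0∞}
    (hq : 1 ≤ q) (z : ℂ) (f : I → ℂ) :
    G.haarNorm D s p q (fun x => z * f x) ≤ ‖z‖ₑ * G.haarNorm D s p q f := by
  rw [Grid.haarNorm, Grid.haarNorm, haarCoeffTop_const_mul, enorm_mul, mul_add, mul_left_comm,
    ← lqNorm_const_mul hq]
  refine add_le_add le_rfl (lqNorm_mono fun k => ?_)
  rw [Grid.haarLevel_eq_weightedSum, Grid.haarLevel_eq_weightedSum, ← weightedSum_const_mul _ hp]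
  refine weightedSum_mono _ hp fun x _ => ?_
  rw [haarCoeff_const_mul, enorm_mul]

theorem osc_const_mul_le {p : ℝ} (hp : 1 ≤ p) (z : ℂ) (f : I → ℂ) (Q : Set I) :
    osc m p (fun x => z * f x) Q ≤ ‖z‖ₑ * osc m p f Q := by
  have key : ∀ c : ℂ, osc m p (fun x => z * f x) Q ≤
      ‖z‖ₑ * (∫⁻ x in Q, ‖f x - c‖ₑ ^ p ∂m) ^ (1 / p) := by
    intro c
    refine (iInf_le _ (z * c)).trans_eq ?_
    rw [← eLpNorm_ofReal_eq hp (fun x => f x - c), ← eLpNorm_const_mul,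
      ← eLpNorm_ofReal_eq hp fun x => z * f x - z * c]
    simp only [mul_sub]
  rcases eq_or_ne z 0 with rfl | hz
  · simpa using key 0
  · have hz' : ‖z‖ₑ ≠ 0 := by simpa using hz
    rw [osc, osc, ENNReal.mul_iInf_of_ne hz' enorm_ne_top]
    exact le_iInf key

theorem osc_add_le {p : ℝ} (hp : 1 ≤ p) {f g : I → ℂ} (hf : AEStronglyMeasurable f m)
    (hg : AEStronglyMeasurable g m) (Q : Set I) :
    osc m p (fun x => f x + g x) Q ≤ osc m p f Q + osc m p g Q := by
  simp only [osc, ENNReal.iInf_add, ENNReal.add_iInf]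
  refine le_iInf fun c' => le_iInf fun c => (iInf_le _ (c + c')).trans ?_
  rw [← eLpNorm_ofReal_eq hp (fun x => f x - c), ← eLpNorm_ofReal_eq hp (fun x => g x - c'),
    ← eLpNorm_ofReal_eq hp fun x => f x + g x - (c + c')]
  refine le_trans (le_of_eq ?_) (eLpNorm_add_le (hf.sub aestronglyMeasurable_const).restrict
    (hg.sub aestronglyMeasurable_const).restrict (one_le_ofReal hp))
  congr 1
  ext x
  simp only [Pi.add_apply]
  ring

theorem Grid.oscNorm_const_mul_le (s : ℝ) {p : ℝ} (hp : 1 ≤ p) {q : ℝ≥0∞}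
    (hq : 1 ≤ q) (z : ℂ) (f : I → ℂ) :
    G.oscNorm s p q (fun x => z * f x) ≤ ‖z‖ₑ * G.oscNorm s p q f := by
  rw [Grid.oscNorm, Grid.oscNorm, eLpNorm_const_mul, mul_add, mul_left_comm]
  refine add_le_add le_rfl ?_
  rw [← lqNorm_const_mul hq]
  refine lqNorm_mono fun k => ?_
  exact (weightedSum_mono _ hp fun Q _ => osc_const_mul_le hp z f Q).trans_eq
    (weightedSum_const_mul _ hp _ _ _)

theorem Grid.oscNorm_add_le (s : ℝ) {p : ℝ} (hp : 1 ≤ p) {q : ℝ≥0∞} (hq : 1 ≤ q) {f g : I → ℂ}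
    (hf : AEStronglyMeasurable f m) (hg : AEStronglyMeasurable g m) :
    G.oscNorm s p q (fun x => f x + g x) ≤ G.oscNorm s p q f + G.oscNorm s p q g := by
  rw [Grid.oscNorm, Grid.oscNorm, Grid.oscNorm, add_add_add_comm, ← mul_add]
  refine add_le_add ?_ ?_
  · gcongr
    exact eLpNorm_add_le hf hg (one_le_ofReal hp)
  · refine (lqNorm_mono fun k => ?_).trans (lqNorm_add_le hq _ _)
    exact (weightedSum_mono _ hp fun Q _ => osc_add_le hp hf hg Q).trans
      (weightedSum_add_le _ hp _ _ _)

namespace Grid.IsGood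

variable (hG : G.IsGood l₁ l₂)
include hG

theorem haarCoeff_add_of_mem [IsFiniteMeasure m] (D : G.Choices) {f g : I → ℂ}
    (hf : Integrable f m) (hg : Integrable g m) {k : ℕ} {Q : Set I} (hQ : Q ∈ G.cells k)
    {S : Finset (Set I) × Finset (Set I)} (hS : S ∈ G.haarFamily D k Q) :
    haarCoeff m (fun x => f x + g x) S = haarCoeff m f S + haarCoeff m g S :=
  haarCoeff_add hf hg
    (fun R hR => Grid.measurableSet_below R ((hG.haarFamily_props D hQ hS).1 hR))
    (fun R hR => Grid.measurableSet_below R ((hG.haarFamily_props D hQ hS).2.1 hR))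

theorem haarNorm_add_le [IsFiniteMeasure m] (D : G.Choices) (s : ℝ) {p : ℝ} (hp : 1 ≤ p)
    {q : ℝ≥0∞} (hq : 1 ≤ q) {f g : I → ℂ} (hf : Integrable f m) (hg : Integrable g m) :
    G.haarNorm D s p q (fun x => f x + g x) ≤ G.haarNorm D s p q f + G.haarNorm D s p q g := by
  rw [Grid.haarNorm, Grid.haarNorm, Grid.haarNorm, add_add_add_comm, ← mul_add]
  refine add_le_add ?_ ?_
  · rw [haarCoeffTop_add hf hg]
    gcongr
    exact enorm_add_le _ _
  · refine (lqNorm_mono fun k => ?_).trans (lqNorm_add_le hq _ _)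
    simp only [Grid.haarLevel_eq_weightedSum]
    refine (weightedSum_mono _ hp fun x hx => ?_).trans (weightedSum_add_le _ hp _ _ _)
    rw [Finset.mem_sigma] at hx
    rw [hG.haarCoeff_add_of_mem D hf hg hx.1 hx.2]
    exact enorm_add_le _ _

theorem stdCoeff_add [IsFiniteMeasure m] (D : G.Choices) (s p : ℝ) {f g : I → ℂ}
    (hf : Integrable f m) (hg : Integrable g m) (k : ℕ) (P : Set I) :
    G.stdCoeff D s p (fun x => f x + g x) k P =
      G.stdCoeff D s p f k P + G.stdCoeff D s p g k P := by
  classical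
  cases k with
  | zero =>
    rw [Grid.stdCoeff, Grid.stdCoeff, Grid.stdCoeff, haarCoeffTop_add hf hg, mul_add]
  | succ k =>
    rw [Grid.stdCoeff, Grid.stdCoeff, Grid.stdCoeff, ← mul_add, ← Finset.sum_add_distrib]
    congr 1
    refine Finset.sum_congr rfl fun Q hQ => ?_
    rw [← Finset.sum_add_distrib]
    refine Finset.sum_congr rfl fun S hS => ?_
    rw [hG.haarCoeff_add_of_mem D hf hg (Finset.mem_filter.1 hQ).1 hS, add_mul]

theorem stdNorm_add_le [IsFiniteMeasure m] (D : G.Choices) (s : ℝ) {p : ℝ} (hp : 1 ≤ p)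
    {q : ℝ≥0∞} (hq : 1 ≤ q) {f g : I → ℂ} (hf : Integrable f m) (hg : Integrable g m) :
    G.stdNorm D s p q (fun x => f x + g x) ≤ G.stdNorm D s p q f + G.stdNorm D s p q g := by
  rw [Grid.stdNorm, Grid.stdNorm, Grid.stdNorm, add_add_add_comm]
  simp only [hG.stdCoeff_add D s p hf hg]
  refine add_le_add (enorm_add_le _ _) ?_
  refine (lqNorm_mono fun k => ?_).trans (lqNorm_add_le hq _ _)
  exact (lpSum_mono _ hp fun _ _ => enorm_add_le _ _).trans (lpSum_add_le _ hp _ _)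

/-- The mean oscillation norm dominates a positive multiple of |f|_p, and it is bounded by the Besov
norm. -/
theorem ae_eq_zero_of_besovNorm_eq_zero [IsFiniteMeasure m] {s p : ℝ} (hs : 0 < s) (hp : 1 ≤ p)
    {q : ℝ≥0∞} (hq : 1 ≤ q) {f : I → ℂ} (hf : AEStronglyMeasurable f m)
    (h : G.besovNorm s p q f = 0) : f =ᵐ[m] fun _ => 0 := by
  have h1 := hG.oscNorm_le_besovNorm hs hp hq hf
  rw [h, mul_zero, nonpos_iff_eq_zero, Grid.oscNorm, add_eq_zero, mul_eq_zero] at h1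
  have h2 : m Set.univ ^ (-s) ≠ 0 :=
    (ENNReal.rpow_pos hG.measure_univ_pos (measure_ne_top _ _)).ne'
  exact (eLpNorm_eq_zero_iff hf (zero_lt_one.trans_le (one_le_ofReal hp)).ne').1
    (h1.1.resolve_left h2)

/-- A subadditive and homogeneous functional comparable with the Besov norm is a norm on the Besov
space. -/
theorem isNormOn_besovSpace [IsFiniteMeasure m] {s p : ℝ} (hs : 0 < s) (hp : 1 ≤ p)
    {q : ℝ≥0∞} (hq : 1 ≤ q) {N : (I → ℂ) → ℝ≥0∞} {A B : ℝ≥0∞} (hB : B ≠ ∞)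
    (hadd : ∀ f g, Integrable f m → Integrable g m → N (fun x => f x + g x) ≤ N f + N g)
    (hmul : ∀ z : ℂ, ∀ f, N (fun x => z * f x) ≤ ‖z‖ₑ * N f)
    (hle : ∀ f, Integrable f m → G.besovNorm s p q f ≤ A * N f)
    (hge : ∀ f, Integrable f m → N f ≤ B * G.besovNorm s p q f) :
    IsNormOn m (G.besovSpace s p q) N := by
  have hint : ∀ f ∈ G.besovSpace s p q, Integrable f m := fun f hf =>
    hf.1.integrable (one_le_ofReal hp)
  have hmem : ∀ f, AEStronglyMeasurable f m → (G.besovNorm s p q f < ∞ ↔ f ∈ G.besovSpace s p q) :=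
    fun f hf => hG.besovNorm_lt_top_iff hs hp hq hf
  refine ⟨?_, ?_, ?_, ?_, ?_, ?_, ?_⟩
  · rw [← hmem _ aestronglyMeasurable_const, Grid.besovNorm_eq_zero_of_ae hp hq (by rfl)]
    exact ENNReal.zero_lt_top
  · intro f hf g hg
    have hf' := (hint f hf).1
    have hg' := (hint g hg).1
    rw [← hmem (fun x => f x + g x) (hf'.add hg')]
    exact (Grid.besovNorm_add_le hp hq hf' hg').trans_lt
      (ENNReal.add_lt_top.2 ⟨(hmem f hf').2 hf, (hmem g hg').2 hg⟩)
  · intro z f hf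
    have hf' := (hint f hf).1
    rw [← hmem (fun x => z * f x) (hf'.const_mul z)]
    exact (Grid.besovNorm_const_mul_le hp hq z f).trans_lt
      (ENNReal.mul_lt_top enorm_lt_top ((hmem f hf').2 hf))
  · intro f hf
    exact (hge f (hint f hf)).trans_lt
      (ENNReal.mul_lt_top hB.lt_top ((hmem f (hint f hf).1).2 hf))
  · intro f hf g hg
    exact hadd f g (hint f hf) (hint g hg)
  · intro z f _
    refine le_antisymm (hmul z f) ?_
    rcases eq_or_ne z 0 with rfl | hz
    · simp
    -- The inequality for z⁻¹, applied to z f, is the reverse inequality.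
    · have h1 := hmul z⁻¹ fun x => z * f x
      simp only [inv_mul_cancel_left₀ hz] at h1
      calc ‖z‖ₑ * N f ≤ ‖z‖ₑ * (‖z⁻¹‖ₑ * N fun x => z * f x) := by gcongr
        _ = _ := by rw [← mul_assoc, ← enorm_mul, mul_inv_cancel₀ hz, enorm_one, one_mul]
  · intro f hf
    have hf' := hint f hf
    constructor
    · intro h
      refine hG.ae_eq_zero_of_besovNorm_eq_zero hs hp hq hf'.1 (nonpos_iff_eq_zero.1 ?_)
      exact (hle f hf').trans (by rw [h, mul_zero])
    · intro h
      refine nonpos_iff_eq_zero.1 ((hge f hf').trans ?_)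
      rw [Grid.besovNorm_eq_zero_of_ae hp hq h, mul_zero]

end Grid.IsGood

end GridBesov

end

theorem theorem13p1 {I : Type*} [MeasurableSpace I] (m : Measure I) [IsFiniteMeasure m]
    (G : GridBesov.Grid m) (l₁ l₂ : ℝ) (hG : G.IsGood l₁ l₂) (D : G.Choices)
    (s p : ℝ) (q : ℝ≥0∞) (hs : 0 < s) (hp : 1 ≤ p) (hq : 1 ≤ q) :
    (∀ f : I → ℂ, Integrable f m →
      ((G.besovNorm s p q f < ∞ ↔ f ∈ G.besovSpace s p q) ∧
        (G.stdNorm D s p q f < ∞ ↔ f ∈ G.besovSpace s p q) ∧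
        (G.haarNorm D s p q f < ∞ ↔ f ∈ G.besovSpace s p q) ∧
        (G.oscNorm s p q f < ∞ ↔ f ∈ G.besovSpace s p q)) ∧
      G.besovNorm s p q f ≤ G.stdNorm D s p q f ∧
      G.stdNorm D s p q f ≤
        ENNReal.ofReal (GridBesov.stdConst l₁ l₂ s p) * G.haarNorm D s p q f ∧
      G.haarNorm D s p q f ≤
        ENNReal.ofReal (GridBesov.waveletConst l₁ l₂) * G.oscNorm s p q f ∧
      G.oscNorm s p q f ≤ G.oscConst l₂ s p q * G.besovNorm s p q f) ∧
    G.oscConst l₂ s p q < ∞ ∧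
    (∀ f ∈ G.besovSpace s p q, Integrable f m) ∧
    GridBesov.IsNormOn m (G.besovSpace s p q) (G.besovNorm s p q) ∧
    GridBesov.IsNormOn m (G.besovSpace s p q) (G.stdNorm D s p q) ∧
    GridBesov.IsNormOn m (G.besovSpace s p q) (G.haarNorm D s p q) ∧
    GridBesov.IsNormOn m (G.besovSpace s p q) (G.oscNorm s p q) := by
  have hB := fun (f : I → ℂ) (hf : Integrable f m) =>
    hG.besovNorm_le_stdNorm D hs hp hq hf
  have hS := fun (f : I → ℂ) => hG.stdNorm_le_haarNorm D s hp hq f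
  have hH := fun (f : I → ℂ) (hf : Integrable f m) =>
    hG.haarNorm_le_oscNorm D (s := s) hp hq hf
  have hO := fun (f : I → ℂ) (hf : Integrable f m) =>
    hG.oscNorm_le_besovNorm hs hp hq hf.1
  have hC := hG.oscConst_lt_top hs hp hq
  set CS := ENNReal.ofReal (GridBesov.stdConst l₁ l₂ s p) with hCS
  set CW := ENNReal.ofReal (GridBesov.waveletConst l₁ l₂) with hCW
  set CO := G.oscConst l₂ s p q with hCO
  have hSt : CS ≠ ∞ := ENNReal.ofReal_ne_top
  have hWt : CW ≠ ∞ := ENNReal.ofReal_ne_top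
  -- Composing the four inequalities around the cycle bounds each functional above and below by the
  -- Besov norm, with finite constants.
  have hHB : ∀ f, Integrable f m → G.haarNorm D s p q f ≤ CW * CO * G.besovNorm s p q f :=
    fun f hf => (hH f hf).trans (by rw [mul_assoc]; gcongr; exact hO f hf)
  have hSB : ∀ f, Integrable f m → G.stdNorm D s p q f ≤ CS * (CW * CO) * G.besovNorm s p q f :=
    fun f hf => (hS f).trans (by rw [mul_assoc]; gcongr; exact hHB f hf)
  have hBH : ∀ f, Integrable f m → G.besovNorm s p q f ≤ CS * G.haarNorm D s p q f :=
    fun f hf => (hB f hf).trans (hS f)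
  have hBO : ∀ f, Integrable f m → G.besovNorm s p q f ≤ CS * CW * G.oscNorm s p q f :=
    fun f hf => (hBH f hf).trans (by rw [mul_assoc]; gcongr; exact hH f hf)
  have hWO : CW * CO ≠ ∞ := ENNReal.mul_ne_top hWt hC.ne
  have hSWO : CS * (CW * CO) ≠ ∞ := ENNReal.mul_ne_top hSt hWO
  have hSW : CS * CW ≠ ∞ := ENNReal.mul_ne_top hSt hWt
  refine ⟨fun f hf => ⟨?_, hB f hf, hS f, hH f hf, hO f hf⟩, hC,
    fun f hf => hf.1.integrable (GridBesov.one_le_ofReal hp), ?_, ?_, ?_, ?_⟩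
  · have hiff := hG.besovNorm_lt_top_iff hs hp hq hf.1
    have key : ∀ {N A B : ℝ≥0∞}, A ≠ ∞ → B ≠ ∞ → G.besovNorm s p q f ≤ A * N →
        N ≤ B * G.besovNorm s p q f → (N < ∞ ↔ f ∈ G.besovSpace s p q) := by
      intro N A B hA hB h1 h2
      rw [← hiff]
      exact ⟨fun h => h1.trans_lt (ENNReal.mul_lt_top hA.lt_top h),
        fun h => h2.trans_lt (ENNReal.mul_lt_top hB.lt_top h)⟩
    exact ⟨hiff, key ENNReal.one_ne_top hSWO ((hB f hf).trans_eq (one_mul _).symm) (hSB f hf),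
      key hSt hWO (hBH f hf) (hHB f hf), key hSW hC.ne (hBO f hf) (hO f hf)⟩
  · exact hG.isNormOn_besovSpace hs hp hq (A := 1) (B := 1) ENNReal.one_ne_top
      (fun f g hf hg => GridBesov.Grid.besovNorm_add_le hp hq hf.1 hg.1)
      (GridBesov.Grid.besovNorm_const_mul_le hp hq) (fun _ _ => (one_mul _).ge)
      (fun _ _ => (one_mul _).ge)
  · exact hG.isNormOn_besovSpace hs hp hq (A := 1) hSWO
      (fun f g hf hg => hG.stdNorm_add_le D s hp hq hf hg)
      (GridBesov.Grid.stdNorm_const_mul_le D s hp hq) (fun f hf => (hB f hf).trans_eq (one_mul _).symm)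
      hSB
  · exact hG.isNormOn_besovSpace hs hp hq hWO
      (fun f g hf hg => hG.haarNorm_add_le D s hp hq hf hg)
      (GridBesov.Grid.haarNorm_const_mul_le D s hp hq) hBH hHB
  · exact hG.isNormOn_besovSpace hs hp hq hC.ne
      (fun f g hf hg => GridBesov.Grid.oscNorm_add_le s hp hq hf.1 hg.1)
      (GridBesov.Grid.oscNorm_const_mul_le s hp hq) hBO hO
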